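/- **Setting.** Let $U=[n]$, $n\ge 1$, $d\ge 1$, let $F_1,\dots,F_d:2^U\to\mathbb R$ be monotone and submodular with $F_i(\emptyset)\ge 0$, $\mathbf F=(F_1,\dots,F_d)^T$, and $f(T)=\mathbf F(T)^T\mathbf w$ with an unknown weight vector $\mathbf w\ge 0$. Let $\|\mathbf w\|_2\le S$ with $S>0$, and $\|\mathbf F(\{a\})\|_2\le L$ for all $a\in U$. Write $\Delta\mathbf F(T,a)=\mathbf F(T\cup\{a\})-\mathbf F(T)$. The $t$-th noisy sample, taken with feature $\mathbf x\in\mathbb R^d$, returns $\mathbf x^T\mathbf w+\xi_t$, where the $\xi_t$ are i.i.d., zero-mean and $R$-sub-Gaussian ($\mathbb E e^{s\xi_t}\le e^{s^2R^2/2}$ for all $s$), $R>0$. Let $\kappa\ge1$ be the budget, $OPT$ a maximizer of $f$ over $\{T:|T|\le\kappa\}$, $\epsilon>0$, $\delta\in(0,1)$, $\lambda>0$, $\alpha\in(0,1)$, and $\alpha<1/2$ if $\kappa=1$. Put $\epsilon'=\epsilon/\kappa$. **Algorithm LinTG.** Initially $\mathbf A=\lambda I$, $\mathbf b=0$; every sample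 $r$ with feature $\mathbf x$ updates $\mathbf A\leftarrow\mathbf A+\mathbf x\mathbf x^T$, $\mathbf b\leftarrow\mathbf b+r\mathbf x$. For each $a\in[n]$ take $N_0=\lceil\frac{2R^2}{\epsilon'^2}\log\frac{6n}{\delta}\rceil$ samples with feature $\mathbf F(\{a\})$, with average $\hat f(a)$; these features are the arms $\mathbf x_1,\dots,\mathbf x_n$, with sample counts $T_i=N_0$. Let $g=\max_a\hat f(a)$, $S_{\mathrm{out}}=\emptyset$, $m=n$. For $w=g,(1-\alpha)g,(1-\alpha)^2g,\dots$, as long as $w>\alpha g/\kappa$, go through $a=1,\dots,n$; each time that $|S_{\mathrm{out}}|<\kappa$, *evaluate* the marginal gain of adding $a$ to $S_{\mathrm{out}}$: increase $m$ by one, make $\mathbf x_m=\Delta\mathbf F(S_{\mathrm{out}},a)$ a new arm, sample it once ($T_m=1$), and repeat the following. With $\hat{\mathbf w}=\mathbf A^{-1}\mathbf b$ and $$\beta=\Big(R\sqrt{2\log\tfrac{2\det(\mathbf A)^{1/2}\det(\lambda I)^{-1/2}}{\delta}}+\lambda^{1/2}S\Big)\sqrt{\mathbf x_m^T\mathbf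 A^{-1}\mathbf x_m},$$ if $\mathbf x_m^T\hat{\mathbf w}-\beta\ge w-\epsilon'$, add $a$ to $S_{\mathrm{out}}$ and end the evaluation; else if $\mathbf x_m^T\hat{\mathbf w}+\beta\le w+\epsilon'$, end the evaluation; else sample an arm $i$ that minimizes $T_i/p^*_i$ over $\{i\in[m]:p^*_i>0\}$ and increase $T_i$ by one. Here $p^*_i=|c^*_i|/\sum_{j\in[m]}|c^*_j|$ (with $0/0=0$), where $c^*$ is an optimal solution of $\min\sum_{i\in[m]}|c_i|$ subject to $\mathbf x_m=\sum_{i\in[m]}c_i\mathbf x_i$, and $\rho^{(m)}$ is the optimal value. Ties (among optimal $c^*$, and among minimizing arms) are broken by an arbitrary fixed rule. At the end return $S_{\mathrm{out}}$. **Theorem.** LinTG always terminates, and it makes at most $n\lceil\log(\kappa/\alpha)/\alpha\rceil$ evaluations of marginal gains (if $\kappa\ge e^2\alpha$, at most $n\log(\kappa/\alpha)/\alpha$). With probability at least $1-\delta$ the following statements hold simultaneously. 1. The output satisfies $|S_{\mathrm{out}}|\le\kappa$ and $f(S_{\mathrm{out}})\ge(1-e^{-1}-\alpha)f(OPT)-2\epsilon$.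 2. If $\lambda\le\frac{2R^2}{S^2}\log\frac2\delta$, then each evaluation, say the one with index $m$ (the value of $m$ during it), of the gain of adding $a$ to the then current set $T$ with threshold $w$, takes at most $$\sum_{i\in[m]}\max\{4H^{(m)}_iR^2(2\log\tfrac2\delta+d\log M^{(m)})+1-N^{(m)}_i,\,0\}$$ samples, where $N^{(m)}_i$ is the number of samples of arm $i$ before this evaluation (so $N^{(m)}_m=0$), $N^{(m)}$ is the total number of samples before it, $$H^{(m)}_i=\frac{p^*_i\rho^{(m)}}{\max\{\frac{\epsilon/\kappa+|w-\Delta\mathbf F(T,a)^T\mathbf w|}{2},\epsilon/\kappa\}^2},\qquad H^{(m)}_\epsilon=\sum_{i\in[m]}H^{(m)}_i,$$ $$M^{(m)}=\frac{16H^{(m)}_\epsilon R^2L^2}{\lambda}\log\frac2\delta+\frac{32(H^{(m)}_\epsilon)^2R^4L^4}{\lambda^2}+\frac{2(N^{(m)}+m)L^2}{\lambda d}+2 .$$ -/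

import Mathlib

open Matrix Finset MeasureTheory ProbabilityTheory

/-- A set function on the subsets of `Fin n` is submodular. -/
def SubmodularFn {n : ℕ} (g : Finset (Fin n) → ℝ) : Prop :=
  ∀ A B : Finset (Fin n), g (A ∪ B) + g (A ∩ B) ≤ g A + g B

/-- The objective `f(T) = ∑ i, w i * F i (T)`. -/
def linObjective {n d : ℕ} (F : Finset (Fin n) → Fin d → ℝ) (w : Fin d → ℝ)
    (T : Finset (Fin n)) : ℝ :=
  F T ⬝ᵥ w

/-- The marginal gain vector `ΔF(T, a) = F(T ∪ {a}) - F(T)`. -/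
def gainVec {n d : ℕ} (F : Finset (Fin n) → Fin d → ℝ) (T : Finset (Fin n)) (a : Fin n) :
    Fin d → ℝ :=
  F (insert a T) - F T

/-- The numerical inputs of the algorithm: accuracy `eps`, failure probability `delta`, threshold
decrease `alpha`, regularizer `lam`, sub-Gaussian parameter `R`, bound `S` on the Euclidean norm
of the weight vector, and budget `kappa`. -/
structure LinTGParams where
  eps : ℝ
  delta : ℝ
  alpha : ℝ
  lam : ℝ
  R : ℝ
  S : ℝ
  kappa : ℕ

/-- The accuracy per element, `ε' = ε / κ`. -/
noncomputable def LinTGParams.eps' (P : LinTGParams) : ℝ := P.eps / P.kappa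

/-- `c 0, …, c (m-1)` is an optimal solution of
`min ∑ i < m, |c i|` subject to `X (m-1) = ∑ i < m, c i • X i`. -/
def IsL1Optimal {d : ℕ} (m : ℕ) (X : ℕ → Fin d → ℝ) (c : ℕ → ℝ) : Prop :=
  X (m - 1) = ∑ i ∈ range m, c i • X i ∧
    ∀ c' : ℕ → ℝ, X (m - 1) = ∑ i ∈ range m, c' i • X i →
      ∑ i ∈ range m, |c i| ≤ ∑ i ∈ range m, |c' i|

/-- How the two kinds of ties are broken: `coef` returns some optimal solution of the `L1` problem
above, and `pick` returns some minimizer of `T i / p i` over the indices `i < m` with `p i > 0`. -/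
structure LinTGRule (d : ℕ) where
  coef : ℕ → (ℕ → Fin d → ℝ) → ℕ → ℝ
  coef_opt : ∀ (m : ℕ) (X : ℕ → Fin d → ℝ), 0 < m → IsL1Optimal m X (coef m X)
  pick : ℕ → (ℕ → ℝ) → (ℕ → ℕ) → ℕ
  pick_spec : ∀ (m : ℕ) (p : ℕ → ℝ) (T : ℕ → ℕ), (∃ i < m, 0 < p i) →
    pick m p T < m ∧ 0 < p (pick m p T) ∧
      ∀ j < m, 0 < p j → (T (pick m p T) : ℝ) / p (pick m p T) ≤ (T j : ℝ) / p j

/-- The optimal value `ρ` of the `L1` problem. -/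
def LinTGRule.rho {d : ℕ} (rule : LinTGRule d) (m : ℕ) (X : ℕ → Fin d → ℝ) : ℝ :=
  ∑ i ∈ range m, |rule.coef m X i|

/-- The allocation ratio `p* i = |c i| / ∑ j < m, |c j|`. -/
noncomputable def LinTGRule.alloc {d : ℕ} (rule : LinTGRule d) (m : ℕ) (X : ℕ → Fin d → ℝ)
    (i : ℕ) : ℝ :=
  |rule.coef m X i| / rule.rho m X

/-- What is recorded about one evaluation of a marginal gain: the index `m` of the evaluation
(which is also the number of arms during it), the current set `S`, the element `a`, the threshold
`w`, the arms `X 0, …, X (m-1)`, the number `N i` of samples of arm `i` and the total number `Ntot`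
of samples before the evaluation, and the number of samples that the evaluation takes. -/
structure LinTGEval (n d : ℕ) where
  m : ℕ
  S : Finset (Fin n)
  a : Fin n
  w : ℝ
  X : ℕ → Fin d → ℝ
  N : ℕ → ℕ
  Ntot : ℕ
  samples : ℕ

/-- The memory of the algorithm: solution `S`, matrix `A`, vector `b`, total number `t` of samples
so far, number `m` of arms, the arms `X 0, …, X (m-1)`, the number `T i` of samples of arm `i`,
the current threshold `w`, and the list of the evaluations made so far. -/
structure LinTGState (n d : ℕ) where
  S : Finset (Fin n)
  A : Matrix (Fin d) (Fin d) ℝ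
  b : Fin d → ℝ
  t : ℕ
  m : ℕ
  X : ℕ → Fin d → ℝ
  T : ℕ → ℕ
  w : ℝ
  evals : List (LinTGEval n d)

/-- The state of a loop after `k` passes through its body (`none` if some pass diverges). -/
def loopIter {σ : Type} (body : σ → Option σ) (s : σ) : ℕ → Option σ
  | 0 => some s
  | k + 1 => (loopIter body s k).bind body

open Classical in
/-- `while cond do body`, started in `s`. The value is `none` if the loop diverges. -/
noncomputable def whileLoop {σ : Type} (cond : σ → Prop) (body : σ → Option σ) (s : σ) :
    Option σ :=
  if h : ∃ k, ∃ s', loopIter body s k = some s' ∧ ¬ cond s' then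
    loopIter body s (Nat.find h)
  else none

section Algorithm

variable {n d : ℕ}

/-- The least-squares estimate `A⁻¹ b`. -/
noncomputable def LinTGState.what (st : LinTGState n d) : Fin d → ℝ := st.A⁻¹ *ᵥ st.b

/-- The current marginal gain vector, which is the last arm. -/
def LinTGState.x (st : LinTGState n d) : Fin d → ℝ := st.X (st.m - 1)

/-- The confidence width
`β = (R √(2 log (2 det(A)^(1/2) det(λI)^(-1/2) / δ)) + λ^(1/2) S) * ‖x‖_{A⁻¹}`. -/
noncomputable def LinTGState.beta (P : LinTGParams) (st : LinTGState n d) : ℝ :=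
  (P.R * √(2 * Real.log (2 * st.A.det ^ (1 / 2 : ℝ) *
      (P.lam • (1 : Matrix (Fin d) (Fin d) ℝ)).det ^ (-(1 / 2) : ℝ) / P.delta)) +
    P.lam ^ (1 / 2 : ℝ) * P.S) * √(st.x ⬝ᵥ (st.A⁻¹ *ᵥ st.x))

def LinTGState.Accept (P : LinTGParams) (st : LinTGState n d) : Prop :=
  st.w - P.eps' ≤ st.x ⬝ᵥ st.what - st.beta P

def LinTGState.Reject (P : LinTGParams) (st : LinTGState n d) : Prop :=
  st.x ⬝ᵥ st.what + st.beta P ≤ st.w + P.eps'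

/-- Take one noisy sample with feature `x`. Here and below, `reward t x` is the answer if the
sample number `t` (counted from `0`) is taken with feature `x`. -/
def LinTGState.observe (reward : ℕ → (Fin d → ℝ) → ℝ) (st : LinTGState n d) (x : Fin d → ℝ) :
    LinTGState n d :=
  { st with
    A := st.A + vecMulVec x x
    b := st.b + reward st.t x • x
    t := st.t + 1 }

/-- The number of samples per element in the initial phase. -/
noncomputable def LinTGParams.N0 (P : LinTGParams) (n : ℕ) : ℕ :=
  ⌈2 * P.R ^ 2 / P.eps' ^ 2 * Real.log (6 * n / P.delta)⌉₊

/-- The average of the `N0` initial samples with feature `F({a})`. -/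
noncomputable def fhat (P : LinTGParams) (F : Finset (Fin n) → Fin d → ℝ)
    (reward : ℕ → (Fin d → ℝ) → ℝ) (a : Fin n) : ℝ :=
  (∑ k ∈ range (P.N0 n), reward (a * P.N0 n + k) (F {a})) / P.N0 n

/-- `g = max_a fhat(a)`. -/
noncomputable def gmax (P : LinTGParams) (F : Finset (Fin n) → Fin d → ℝ)
    (reward : ℕ → (Fin d → ℝ) → ℝ) : ℝ :=
  ⨆ a : Fin n, fhat P F reward a

/-- The state after the initial phase. -/
noncomputable def initState (P : LinTGParams) (F : Finset (Fin n) → Fin d → ℝ)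
    (reward : ℕ → (Fin d → ℝ) → ℝ) : LinTGState n d where
  S := ∅
  A := P.lam • (1 : Matrix (Fin d) (Fin d) ℝ) +
    ∑ a : Fin n, (P.N0 n : ℝ) • vecMulVec (F {a}) (F {a})
  b := ∑ a : Fin n, ((P.N0 n : ℝ) * fhat P F reward a) • F {a}
  t := n * P.N0 n
  m := n
  X := fun i => if h : i < n then F {⟨i, h⟩} else 0
  T := fun i => if i < n then P.N0 n else 0
  w := gmax P F reward
  evals := []

/-- Beginning of an evaluation: one sample of the marginal gain of `a`, which becomes a new arm. -/
def beginEval (F : Finset (Fin n) → Fin d → ℝ) (reward : ℕ → (Fin d → ℝ) → ℝ)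
    (st : LinTGState n d) (a : Fin n) : LinTGState n d :=
  { st.observe reward (gainVec F st.S a) with
    m := st.m + 1
    X := Function.update st.X st.m (gainVec F st.S a)
    T := Function.update st.T st.m 1 }

/-- One pass through the sampling loop: sample the arm that lags most behind its allocation. -/
noncomputable def sampleStep (rule : LinTGRule d) (reward : ℕ → (Fin d → ℝ) → ℝ)
    (st : LinTGState n d) : LinTGState n d :=
  let i := rule.pick st.m (rule.alloc st.m st.X) st.T
  { st.observe reward (st.X i) with T := Function.update st.T i (st.T i + 1) }

open Classical in
/-- End of the evaluation of `a` that began in the state `old` and ends in the state `st`. -/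
noncomputable def finishEval (P : LinTGParams) (old : LinTGState n d) (a : Fin n)
    (st : LinTGState n d) : LinTGState n d :=
  { st with
    S := if st.Accept P then insert a st.S else st.S
    evals := st.evals ++ [⟨st.m, old.S, a, st.w, st.X, old.T, old.t, st.t - old.t⟩] }

/-- Processing of the element `a` within a round. -/
noncomputable def processElement (P : LinTGParams) (rule : LinTGRule d)
    (F : Finset (Fin n) → Fin d → ℝ) (reward : ℕ → (Fin d → ℝ) → ℝ)
    (st : LinTGState n d) (a : Fin n) : Option (LinTGState n d) :=
  if st.S.card < P.kappa then
    (whileLoop (fun s => ¬ s.Accept P ∧ ¬ s.Reject P) (fun s => some (sampleStep rule reward s))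
      (beginEval F reward st a)).map (finishEval P st a)
  else some st

/-- One round: all elements are processed, then the threshold is decreased. -/
noncomputable def linTGRound (P : LinTGParams) (rule : LinTGRule d)
    (F : Finset (Fin n) → Fin d → ℝ) (reward : ℕ → (Fin d → ℝ) → ℝ)
    (st : LinTGState n d) : Option (LinTGState n d) :=
  ((List.finRange n).foldlM (processElement P rule F reward) st).map
    fun s => { s with w := (1 - P.alpha) * s.w }

/-- Linear Threshold Greedy: the final state, or `none` if the run does not terminate. -/
noncomputable def LinTG (P : LinTGParams) (rule : LinTGRule d)
    (F : Finset (Fin n) → Fin d → ℝ) (reward : ℕ → (Fin d → ℝ) → ℝ) :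
    Option (LinTGState n d) :=
  whileLoop (fun s => P.alpha * gmax P F reward / P.kappa < s.w)
    (linTGRound P rule F reward) (initState P F reward)

/-- `H_i = p*_i ρ / max {(ε/κ + |w - ΔF(S,a)ᵀ w*|)/2, ε/κ}²` for an evaluation `e`, where `wt` is
the true weight vector `w*`. -/
noncomputable def LinTGEval.H (P : LinTGParams) (rule : LinTGRule d)
    (F : Finset (Fin n) → Fin d → ℝ) (wt : Fin d → ℝ) (e : LinTGEval n d) (i : ℕ) : ℝ :=
  rule.alloc e.m e.X i * rule.rho e.m e.X /
    max ((P.eps / P.kappa + |e.w - gainVec F e.S e.a ⬝ᵥ wt|) / 2) (P.eps / P.kappa) ^ 2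

/-- `H_ε = ∑ i, H_i`. -/
noncomputable def LinTGEval.Htot (P : LinTGParams) (rule : LinTGRule d)
    (F : Finset (Fin n) → Fin d → ℝ) (wt : Fin d → ℝ) (e : LinTGEval n d) : ℝ :=
  ∑ i ∈ range e.m, e.H P rule F wt i

noncomputable def LinTGEval.M (P : LinTGParams) (rule : LinTGRule d)
    (F : Finset (Fin n) → Fin d → ℝ) (wt : Fin d → ℝ) (L : ℝ) (e : LinTGEval n d) : ℝ :=
  16 * e.Htot P rule F wt * P.R ^ 2 * L ^ 2 / P.lam * Real.log (2 / P.delta) +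
    32 * e.Htot P rule F wt ^ 2 * P.R ^ 4 * L ^ 4 / P.lam ^ 2 +
    2 * (e.Ntot + e.m) * L ^ 2 / (P.lam * d) + 2

/-- The bound on the number of samples of an evaluation. -/
noncomputable def LinTGEval.sampleBound (P : LinTGParams) (rule : LinTGRule d)
    (F : Finset (Fin n) → Fin d → ℝ) (wt : Fin d → ℝ) (L : ℝ) (e : LinTGEval n d) : ℝ :=
  ∑ i ∈ range e.m,
    max (4 * e.H P rule F wt i * P.R ^ 2 *
      (2 * Real.log (2 / P.delta) + d * Real.log (e.M P rule F wt L)) + 1 - e.N i) 0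

end Algorithm

/-! The proof separates a confidence bound valid at all times from a deterministic analysis of every
run on which it holds.

Confidence. Let `V` be the regularized Gram matrix and `s` the noise-weighted sum of the first `t`
features. Since the feature of a sample depends only on earlier noise, `√(λ^d / det V) * exp(sᵀ V⁻¹
s / (2R²))` is a nonnegative supermartingale: by Sherman–Morrison and the matrix determinant lemma,
one step multiplies it by the normalized exponential of a quadratic polynomial in the new noise
term, and `HasSubgaussianMGF.lintegral_exp_quadratic_le` bounds the mean of this factor by one.
Ville's inequality then yields `measure_exists_selfNormalized_le`, used with failure probability
`δ/2`; Hoeffding's inequality covers the initial averages with `δ/3`. That the features really are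
determined by earlier noise is shown by replaying the algorithm sample by sample
(`isAdapted_runConfig`, `measurable_runFeature`).

Number of samples. Because the sampled arm `i` lags most behind its allocation, `xᵀ A⁻¹ x ≤ ρ p*_i /
T_i`. So while the width exceeds `D`, this arm satisfies `T_i ≤ p*_i ρ D⁻²` times a quantity
logarithmic in the clock (`ArmInvariant.pick_spec`, `evalState_count_le`). An undecided test has
width above `ε'`, which forces termination for any rewards; when the intervals are correct the width
also exceeds `(ε' + |w - gain|) / 2`, which gives `samples_le_sampleBound`.

Quality. Correct intervals make accepted gains at least `w - ε'` and rejected ones at most `w + ε'`.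
By submodularity each newly added element contracts the gap to the optimum by `1 - (1-α)/κ`, up to
`2ε'`. If the budget remains unfilled, all gains are small at the end and the initial estimate of
the best singleton controls the loss. `GreedyInvariant` carries both arguments through the loops. -/

/-! ### Rank-one updates, inverse quadratic forms and determinants. -/

section LinearAlgebra

lemma posDef_smul_one_real {ι : Type*} [DecidableEq ι] {c : ℝ} (hc : 0 < c) :
    (c • (1 : Matrix ι ι ℝ)).PosDef :=
  Matrix.PosDef.one.smul hc

variable {ι : Type*} [Fintype ι] {A : Matrix ι ι ℝ}

lemma vecMulVec_mulVec_real (x y z : ι → ℝ) : vecMulVec x y *ᵥ z = (y ⬝ᵥ z) • x := by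
  rw [vecMulVec_mulVec]
  ext i
  simp [mul_comm]

lemma posSemidef_vecMulVec_self_real (x : ι → ℝ) : (vecMulVec x x).PosSemidef := by
  simpa using posSemidef_vecMulVec_self_star x

lemma Matrix.IsHermitian.dotProduct_mulVec_comm_real (hA : A.IsHermitian) (x y : ι → ℝ) :
    x ⬝ᵥ (A *ᵥ y) = y ⬝ᵥ (A *ᵥ x) := by
  have h : Aᵀ = A := by simpa [Matrix.IsHermitian, conjTranspose_eq_transpose_of_trivial] using hA
  rw [dotProduct_mulVec, ← mulVec_transpose, h, dotProduct_comm]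

lemma dotProduct_self_eq_norm_sq (x : ι → ℝ) : x ⬝ᵥ x = ‖WithLp.toLp 2 x‖ ^ 2 := by
  rw [EuclideanSpace.real_norm_sq_eq]
  simp [dotProduct, sq]

lemma Matrix.PosDef.add_vecMulVec_self (hA : A.PosDef) (x : ι → ℝ) :
    (A + vecMulVec x x).PosDef :=
  hA.add_posSemidef (posSemidef_vecMulVec_self_real x)

variable [DecidableEq ι]

lemma Matrix.PosDef.isUnit_det_real (hA : A.PosDef) : IsUnit A.det :=
  hA.det_pos.ne'.isUnit

lemma Matrix.PosDef.mulVec_inv_mulVec (hA : A.PosDef) (x : ι → ℝ) : A *ᵥ (A⁻¹ *ᵥ x) = x := by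
  rw [mulVec_mulVec, mul_nonsing_inv _ hA.isUnit_det_real, one_mulVec]

lemma Matrix.PosDef.inv_mulVec_mulVec (hA : A.PosDef) (x : ι → ℝ) : A⁻¹ *ᵥ (A *ᵥ x) = x := by
  rw [mulVec_mulVec, nonsing_inv_mul _ hA.isUnit_det_real, one_mulVec]

lemma Matrix.PosDef.inv_dotProduct_comm (hA : A.PosDef) (x y : ι → ℝ) :
    x ⬝ᵥ (A⁻¹ *ᵥ y) = y ⬝ᵥ (A⁻¹ *ᵥ x) :=
  hA.inv.isHermitian.dotProduct_mulVec_comm_real x y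

lemma Matrix.PosDef.inv_dotProduct_nonneg (hA : A.PosDef) (x : ι → ℝ) :
    0 ≤ x ⬝ᵥ (A⁻¹ *ᵥ x) := by
  simpa using hA.inv.posSemidef.dotProduct_mulVec_nonneg x

/-- Cauchy–Schwarz for the inner product given by `A⁻¹`. -/
lemma Matrix.PosDef.inv_dotProduct_sq_le (hA : A.PosDef) (x y : ι → ℝ) :
    (x ⬝ᵥ (A⁻¹ *ᵥ y)) ^ 2 ≤ (x ⬝ᵥ (A⁻¹ *ᵥ x)) * (y ⬝ᵥ (A⁻¹ *ᵥ y)) := by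
  have h : ∀ c : ℝ, 0 ≤ (x ⬝ᵥ (A⁻¹ *ᵥ x)) * (c * c) + (2 * (x ⬝ᵥ (A⁻¹ *ᵥ y))) * c +
      y ⬝ᵥ (A⁻¹ *ᵥ y) := by
    intro c
    have h1 := hA.inv_dotProduct_nonneg (c • x + y)
    have h2 := hA.inv_dotProduct_comm y x
    simp only [mulVec_add, mulVec_smul, dotProduct_add, add_dotProduct, smul_dotProduct,
      dotProduct_smul, smul_eq_mul] at h1
    rw [h2] at h1
    linarith
  have := discrim_le_zero h
  rw [discrim] at this
  nlinarith

/-- The matrix determinant lemma; it makes the normalization of the supermartingale multiplicative.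
-/
lemma Matrix.PosDef.det_add_vecMulVec_self (hA : A.PosDef) (x : ι → ℝ) :
    (A + vecMulVec x x).det = A.det * (1 + x ⬝ᵥ (A⁻¹ *ᵥ x)) := by
  rw [vecMulVec_eq Unit, det_add_replicateCol_mul_replicateRow hA.isUnit_det_real]
  congr 1
  rw [det_unique, Matrix.mul_assoc, add_apply, one_apply_eq, mul_apply]
  congr 1

/-- The Sherman–Morrison formula for the quadratic form of the inverse. -/
lemma Matrix.PosDef.inv_add_vecMulVec_quadratic (hA : A.PosDef) (x s : ι → ℝ) (e : ℝ) :
    (s + e • x) ⬝ᵥ ((A + vecMulVec x x)⁻¹ *ᵥ (s + e • x)) =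
      s ⬝ᵥ (A⁻¹ *ᵥ s) + (2 * e * (x ⬝ᵥ (A⁻¹ *ᵥ s)) + e ^ 2 * (x ⬝ᵥ (A⁻¹ *ᵥ x)) -
        (x ⬝ᵥ (A⁻¹ *ᵥ s)) ^ 2) / (1 + x ⬝ᵥ (A⁻¹ *ᵥ x)) := by
  have hq := hA.inv_dotProduct_nonneg x
  set q := x ⬝ᵥ (A⁻¹ *ᵥ x) with hqd
  set u := x ⬝ᵥ (A⁻¹ *ᵥ s) with hud
  have hq1 : 1 + q ≠ 0 := by positivity
  -- This is the Sherman–Morrison solution; applying `A + vecMulVec x x` to it verifies it.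
  have hy : (A + vecMulVec x x)⁻¹ *ᵥ (s + e • x) =
      A⁻¹ *ᵥ s + (e - (u + e * q) / (1 + q)) • (A⁻¹ *ᵥ x) := by
    rw [← (hA.add_vecMulVec_self x).inv_mulVec_mulVec
      (A⁻¹ *ᵥ s + (e - (u + e * q) / (1 + q)) • (A⁻¹ *ᵥ x))]
    congr 1
    rw [add_mulVec, vecMulVec_mulVec_real, mulVec_add, mulVec_smul, hA.mulVec_inv_mulVec,
      hA.mulVec_inv_mulVec, dotProduct_add, dotProduct_smul, ← hqd, ← hud, add_assoc, ← add_smul]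
    congr 2
    simp only [smul_eq_mul]
    field_simp
    ring
  rw [hy]
  simp only [dotProduct_add, add_dotProduct, smul_dotProduct, dotProduct_smul, smul_eq_mul]
  rw [hA.inv_dotProduct_comm s x, ← hqd, ← hud]
  field_simp
  ring

/-- If `A = c I + B` with `B` positive semidefinite, then `wᵀ A⁻¹ w ≤ wᵀ w / c`. -/
lemma inv_dotProduct_le_of_add_posSemidef {B : Matrix ι ι ℝ} {c : ℝ} (hc : 0 < c)
    (hB : B.PosSemidef) (w : ι → ℝ) :
    w ⬝ᵥ ((c • (1 : Matrix ι ι ℝ) + B)⁻¹ *ᵥ w) ≤ (w ⬝ᵥ w) / c := by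
  have hA : (c • (1 : Matrix ι ι ℝ) + B).PosDef := (posDef_smul_one_real hc).add_posSemidef hB
  set A := c • (1 : Matrix ι ι ℝ) + B with hAd
  set y := A⁻¹ *ᵥ w with hy
  have h1 : A *ᵥ y = w := hA.mulVec_inv_mulVec w
  have h2 : w ⬝ᵥ y = c * (y ⬝ᵥ y) + y ⬝ᵥ (B *ᵥ y) := by
    rw [dotProduct_comm, ← h1, hAd]
    simp [add_mulVec, smul_mulVec]
  have h3 : 0 ≤ y ⬝ᵥ (B *ᵥ y) := by simpa using hB.dotProduct_mulVec_nonneg y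
  -- Expanded: `wᵀw ≥ 2c wᵀy - c² yᵀy`. Since `c yᵀy ≤ wᵀy`, the right side is at least `c wᵀy`.
  have h4 : 0 ≤ (w - c • y) ⬝ᵥ (w - c • y) := by
    simpa using dotProduct_star_self_nonneg (w - c • y)
  simp only [sub_dotProduct, dotProduct_sub, smul_dotProduct, dotProduct_smul, smul_eq_mul] at h4
  rw [dotProduct_comm y w] at h4
  rw [le_div_iff₀ hc]
  nlinarith

/-- If `x = ∑ cᵢ xᵢ` and `A = λ I + ∑ Tᵢ xᵢ xᵢᵀ`, then `xᵀ A⁻¹ x ≤ ∑ cᵢ² / Tᵢ`. -/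
lemma inv_dotProduct_le_sum_sq_div {α : Type*} (s : Finset α) (lam : ℝ) (hlam : 0 < lam)
    (T c : α → ℝ) (X : α → ι → ℝ) (hT : ∀ i ∈ s, 0 < T i) :
    (∑ i ∈ s, c i • X i) ⬝ᵥ ((lam • (1 : Matrix ι ι ℝ) + ∑ i ∈ s, T i • vecMulVec (X i) (X i))⁻¹ *ᵥ
      (∑ i ∈ s, c i • X i)) ≤ ∑ i ∈ s, c i ^ 2 / T i := by
  have hB : (∑ i ∈ s, T i • vecMulVec (X i) (X i)).PosSemidef :=
    posSemidef_sum s fun i hi => (posSemidef_vecMulVec_self_real (X i)).smul (hT i hi).le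
  set x := ∑ i ∈ s, c i • X i with hx
  have hA := (posDef_smul_one_real (ι := ι) hlam).add_posSemidef hB
  set A := lam • (1 : Matrix ι ι ℝ) + ∑ i ∈ s, T i • vecMulVec (X i) (X i) with hAd
  set y := A⁻¹ *ᵥ x with hy
  have h1 : A *ᵥ y = x := hA.mulVec_inv_mulVec x
  have h2 : x ⬝ᵥ y = lam * (y ⬝ᵥ y) + ∑ i ∈ s, T i * (X i ⬝ᵥ y) ^ 2 := by
    rw [dotProduct_comm, ← h1, hAd, add_mulVec, dotProduct_add, smul_mulVec, one_mulVec,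
      dotProduct_smul, sum_mulVec, dotProduct_sum, smul_eq_mul]
    congr 1
    refine sum_congr rfl fun i _ => ?_
    rw [smul_mulVec, vecMulVec_mulVec_real, dotProduct_smul, dotProduct_smul, dotProduct_comm y]
    simp only [smul_eq_mul]
    ring
  have h3 : x ⬝ᵥ y = ∑ i ∈ s, c i * (X i ⬝ᵥ y) := by
    conv_lhs => rw [hx]
    rw [sum_dotProduct]
    simp
  have h5 : 0 ≤ y ⬝ᵥ y := by simpa using dotProduct_star_self_nonneg y
  -- Summed over `i`, the last terms are at most `xᵀy` by `h2`, so one of the two copies of `xᵀy` on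
  -- the left cancels.
  have h6 : ∀ i ∈ s, 2 * (c i * (X i ⬝ᵥ y)) ≤ c i ^ 2 / T i + T i * (X i ⬝ᵥ y) ^ 2 := by
    intro i hi
    have hTi := hT i hi
    have : c i ^ 2 / T i + T i * (X i ⬝ᵥ y) ^ 2 - 2 * (c i * (X i ⬝ᵥ y)) =
        (c i - T i * (X i ⬝ᵥ y)) ^ 2 / T i := by
      field_simp
      ring
    have h7 : 0 ≤ (c i - T i * (X i ⬝ᵥ y)) ^ 2 / T i := by positivity
    linarith
  have h7 := sum_le_sum h6
  rw [← mul_sum, sum_add_distrib, ← h3] at h7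
  have h8 : 0 ≤ lam * (y ⬝ᵥ y) := by positivity
  linarith

/-- The determinant-trace inequality. -/
lemma Matrix.PosDef.log_det_le (hA : A.PosDef) {r : ℝ} (hr : 0 < r)
    (htr : A.trace ≤ Fintype.card ι * r) : Real.log A.det ≤ Fintype.card ι * Real.log r := by
  have hpos := hA.eigenvalues_pos
  have hdet := hA.isHermitian.det_eq_prod_eigenvalues
  have htr' := hA.isHermitian.trace_eq_sum_eigenvalues
  simp only [RCLike.ofReal_real_eq_id, id] at hdet htr'
  rw [hdet, Real.log_prod fun i _ => (hpos i).ne']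
  -- The tangent of the logarithm at `r`; its linear terms sum to something nonpositive by the trace
  -- bound.
  have h : ∀ i, Real.log (hA.isHermitian.eigenvalues i) ≤
      Real.log r + (hA.isHermitian.eigenvalues i / r - 1) := by
    intro i
    have h1 := Real.log_le_sub_one_of_pos (div_pos (hpos i) hr)
    rw [Real.log_div (hpos i).ne' hr.ne'] at h1
    linarith
  refine (sum_le_sum fun i _ => h i).trans ?_
  rw [sum_add_distrib, sum_sub_distrib, ← sum_div, ← htr']
  simp only [sum_const, card_univ, nsmul_eq_mul, mul_one]
  have : A.trace / r ≤ Fintype.card ι := by rwa [div_le_iff₀ hr]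
  linarith

end LinearAlgebra

/-! ### Concentration: self-normalized martingale bound and Hoeffding's inequality. -/

section SelfNormalized

open scoped ENNReal NNReal

/-- Averaging over an auxiliary Gaussian `g` linearizes the square in the exponent, so that the
sub-Gaussian hypothesis, which concerns linear exponents only, becomes applicable. -/
lemma exp_eq_lintegral_gaussianPDFReal (b s e : ℝ) :
    ENNReal.ofReal (Real.exp (b * e + s ^ 2 * e ^ 2 / 2)) =
      ∫⁻ g, ENNReal.ofReal (gaussianPDFReal 0 1 g) * ENNReal.ofReal (Real.exp ((b + s * g) * e)) := by
  have h : ∀ g, ENNReal.ofReal (gaussianPDFReal 0 1 g) * ENNReal.ofReal (Real.exp ((b + s * g) * e)) =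
      ENNReal.ofReal (Real.exp (b * e + s ^ 2 * e ^ 2 / 2)) *
        ENNReal.ofReal (gaussianPDFReal (s * e) 1 g) := by
    intro g
    rw [← ENNReal.ofReal_mul (gaussianPDFReal_nonneg _ _ _), ← ENNReal.ofReal_mul (Real.exp_nonneg _)]
    congr 1
    simp only [gaussianPDFReal_def, NNReal.coe_one]
    rw [mul_assoc, mul_left_comm (Real.exp _), ← Real.exp_add, ← Real.exp_add]
    congr 2
    ring
  simp_rw [h]
  rw [lintegral_const_mul _ (measurable_gaussianPDFReal _ _).ennreal_ofReal,
    lintegral_gaussianPDFReal_eq_one _ one_ne_zero, mul_one]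

variable {Ω : Type*} {mΩ : MeasurableSpace Ω} {μ : Measure Ω}

lemma ProbabilityTheory.HasSubgaussianMGF.lintegral_exp_le {X : Ω → ℝ} {c : ℝ≥0}
    (h : HasSubgaussianMGF X c μ) (t : ℝ) :
    ∫⁻ ω, ENNReal.ofReal (Real.exp (t * X ω)) ∂μ ≤ ENNReal.ofReal (Real.exp (c * t ^ 2 / 2)) := by
  rw [← ofReal_integral_eq_lintegral_ofReal (h.integrable_exp_mul t)
    (Filter.Eventually.of_forall fun _ => Real.exp_nonneg _)]
  exact ENNReal.ofReal_le_ofReal (h.mgf_le t)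

/-- The exponential moment of a quadratic function of a sub-Gaussian variable. -/
lemma ProbabilityTheory.HasSubgaussianMGF.lintegral_exp_quadratic_le [SFinite μ] {X : Ω → ℝ} {R : ℝ}
    (hR : 0 < R) (hX : Measurable X) (h : HasSubgaussianMGF X (Real.toNNReal (R ^ 2)) μ)
    {q : ℝ} (hq : 0 ≤ q) (u : ℝ) :
    ∫⁻ ω, ENNReal.ofReal (Real.exp ((2 * X ω * u + X ω ^ 2 * q - u ^ 2) / (2 * R ^ 2 * (1 + q)))) ∂μ
      ≤ ENNReal.ofReal √(1 + q) := by
  have hv : (0 : ℝ) < R ^ 2 := by positivity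
  obtain ⟨v, hvd⟩ : ∃ v, v = R ^ 2 := ⟨_, rfl⟩
  rw [← hvd] at hv h ⊢
  have hq1 : 0 < 1 + q := by positivity
  -- The exponent is `K + b X + s² X² / 2`. Here `v s² = q / (1 + q) < 1`, which keeps the later
  -- integral over `g` finite.
  obtain ⟨s, hs⟩ : ∃ s, s = √(q / (v * (1 + q))) := ⟨_, rfl⟩
  have hs2 : s ^ 2 = q / (v * (1 + q)) := by rw [hs, Real.sq_sqrt (by positivity)]
  obtain ⟨b, hb⟩ : ∃ b, b = u / (v * (1 + q)) := ⟨_, rfl⟩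
  obtain ⟨K, hK⟩ : ∃ K, K = -(u ^ 2 / (2 * v * (1 + q))) := ⟨_, rfl⟩
  have h1 : ∀ ω, ENNReal.ofReal (Real.exp ((2 * X ω * u + X ω ^ 2 * q - u ^ 2) / (2 * v * (1 + q)))) =
      ∫⁻ g, ENNReal.ofReal (Real.exp K) * (ENNReal.ofReal (gaussianPDFReal 0 1 g) *
        ENNReal.ofReal (Real.exp ((b + s * g) * X ω))) := by
    intro ω
    rw [lintegral_const_mul', ← exp_eq_lintegral_gaussianPDFReal,
      ← ENNReal.ofReal_mul (Real.exp_nonneg _), ← Real.exp_add]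
    · congr 2
      rw [hs2, hb, hK]
      field_simp
      ring
    · exact ENNReal.ofReal_ne_top
  simp_rw [h1]
  rw [lintegral_lintegral_swap]
  -- The sub-Gaussian bound gives `v (b + s g)² / 2` in the exponent. Completing the square against
  -- `-g² / 2` produces a Gaussian density of variance `1 + q`; the remaining constant cancels `K`
  -- exactly, leaving `√(1 + q)`.
  · have h2 : ∀ g, ∫⁻ ω, ENNReal.ofReal (Real.exp K) * (ENNReal.ofReal (gaussianPDFReal 0 1 g) *
        ENNReal.ofReal (Real.exp ((b + s * g) * X ω))) ∂μ ≤
        ENNReal.ofReal √(1 + q) * ENNReal.ofReal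
          (gaussianPDFReal (v * b * s * (1 + q)) (Real.toNNReal (1 + q)) g) := by
      intro g
      rw [lintegral_const_mul' _ _ ENNReal.ofReal_ne_top, lintegral_const_mul' _ _ ENNReal.ofReal_ne_top]
      refine (mul_le_mul_right (mul_le_mul_right (h.lintegral_exp_le (b + s * g)) _) _).trans ?_
      rw [Real.coe_toNNReal _ hv.le, ← ENNReal.ofReal_mul (gaussianPDFReal_nonneg _ _ _),
        ← ENNReal.ofReal_mul (Real.exp_nonneg _), ← ENNReal.ofReal_mul (Real.sqrt_nonneg _)]
      refine le_of_eq (congrArg _ ?_)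
      simp only [gaussianPDFReal_def, NNReal.coe_one, Real.coe_toNNReal _ hq1.le]
      have h3 : √(2 * Real.pi * (1 + q)) = √(2 * Real.pi * 1) * √(1 + q) := by
        rw [mul_one, Real.sqrt_mul (by positivity)]
      have h4 : √(1 + q) ≠ 0 := by positivity
      have h7 : √(1 + q) * ((√(2 * Real.pi * 1))⁻¹ * (√(1 + q))⁻¹) = (√(2 * Real.pi * 1))⁻¹ := by
        field_simp
      rw [h3, mul_inv, mul_assoc, mul_left_comm (Real.exp K), ← Real.exp_add, ← Real.exp_add,
        ← mul_assoc (√(1 + q)), h7]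
      congr 2
      have h5 : (b + s * g) ^ 2 = b ^ 2 + 2 * b * s * g + s ^ 2 * g ^ 2 := by ring
      have h6 : (g - v * b * s * (1 + q)) ^ 2 =
        g ^ 2 - 2 * v * b * s * (1 + q) * g + v ^ 2 * b ^ 2 * s ^ 2 * (1 + q) ^ 2 := by ring
      rw [h5, h6, hs2, hK, hb]
      field_simp
      ring
    refine (lintegral_mono h2).trans ?_
    rw [lintegral_const_mul' _ _ ENNReal.ofReal_ne_top, lintegral_gaussianPDFReal_eq_one, mul_one]
    simpa using hq1
  · refine Measurable.aemeasurable ?_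
    have h5 := (measurable_gaussianPDFReal 0 1)
    simp only [Function.uncurry_def]
    fun_prop

/-- Ville's maximal inequality. -/
lemma mul_measure_exists_le_of_setLIntegral_succ_le (𝓕 : ℕ → MeasurableSpace Ω)
    (hmono : Monotone 𝓕) (hle : ∀ t, 𝓕 t ≤ mΩ) (M : ℕ → Ω → ℝ≥0∞)
    (hM : ∀ t, Measurable[𝓕 t] (M t))
    (hstep : ∀ t B, MeasurableSet[𝓕 t] B → ∫⁻ ω in B, M (t + 1) ω ∂μ ≤ ∫⁻ ω in B, M t ω ∂μ)
    (c : ℝ≥0∞) : c * μ {ω | ∃ t, c ≤ M t ω} ≤ ∫⁻ ω, M 0 ω ∂μ := by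
  have hmeas : ∀ t, MeasurableSet[𝓕 t] {ω | c ≤ M t ω} := fun t => hM t measurableSet_Ici
  have hB : ∀ t, MeasurableSet[𝓕 t] {ω | ∀ s ≤ t, ¬ c ≤ M s ω} := by
    intro t
    have : {ω | ∀ s ≤ t, ¬ c ≤ M s ω} = ⋂ s ∈ Set.Iic t, {ω | c ≤ M s ω}ᶜ := by
      ext ω
      simp
    rw [this]
    exact @MeasurableSet.biInter _ _ (𝓕 t) _ _ (Set.to_countable _)
      fun s hs => (@MeasurableSet.compl _ _ (𝓕 t) (hmono hs _ (hmeas s)))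
  -- The stopped process in disguise: on paths that have crossed, `c` is charged, and on the others
  -- the supermartingale property is applied to the past event of not having crossed yet.
  have key : ∀ t, c * μ {ω | ∃ s ≤ t, c ≤ M s ω} + ∫⁻ ω in {ω | ∀ s ≤ t, ¬ c ≤ M s ω}, M t ω ∂μ ≤
      ∫⁻ ω, M 0 ω ∂μ := by
    intro t
    induction t with
    | zero =>
      have h1 : {ω | ∃ s ≤ 0, c ≤ M s ω} = {ω | c ≤ M 0 ω} := by ext; simp
      have h2 : {ω | ∀ s ≤ 0, ¬ c ≤ M s ω} = {ω | c ≤ M 0 ω}ᶜ := by ext; simp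
      rw [h1, h2, ← lintegral_add_compl (μ := μ) (M 0) (hle 0 _ (hmeas 0))]
      refine add_le_add ?_ le_rfl
      calc c * μ {ω | c ≤ M 0 ω} = ∫⁻ _ in {ω | c ≤ M 0 ω}, c ∂μ := by simp
        _ ≤ _ := setLIntegral_mono' (hle 0 _ (hmeas 0)) fun ω h => h
    | succ t ih =>
      refine le_trans ?_ ih
      set D := {ω | ∀ s ≤ t, ¬ c ≤ M s ω} with hD
      have h1 : {ω | ∃ s ≤ t + 1, c ≤ M s ω} ⊆ {ω | ∃ s ≤ t, c ≤ M s ω} ∪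
          ({ω | c ≤ M (t + 1) ω} ∩ D) := by
        rintro ω ⟨s, hs, h⟩
        by_cases h' : ∃ s ≤ t, c ≤ M s ω
        · exact Or.inl h'
        · right
          push Not at h'
          refine ⟨?_, fun s hs => not_le.2 (h' s hs)⟩
          rcases Nat.le_succ_iff.1 hs with h2 | rfl
          · exact absurd h (not_le.2 (h' s h2))
          · exact h
      have h2 : {ω | ∀ s ≤ t + 1, ¬ c ≤ M s ω} = {ω | c ≤ M (t + 1) ω}ᶜ ∩ D := by
        ext ω
        simp only [hD, Set.mem_ofPred_eq, Set.mem_inter_iff, Set.mem_compl_iff, Nat.le_succ_iff]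
        constructor
        · exact fun h => ⟨h _ (Or.inr rfl), fun s hs => h s (Or.inl hs)⟩
        · rintro ⟨h, h'⟩ s (hs | rfl)
          · exact h' s hs
          · exact h
      have hm1 := hle _ _ (hmeas (t + 1))
      have hmD := hle _ _ (hB t)
      calc _ ≤ c * (μ {ω | ∃ s ≤ t, c ≤ M s ω} + μ ({ω | c ≤ M (t + 1) ω} ∩ D)) +
            ∫⁻ ω in {ω | c ≤ M (t + 1) ω}ᶜ ∩ D, M (t + 1) ω ∂μ := by
            rw [h2]
            gcongr
            exact (measure_mono h1).trans (measure_union_le _ _)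
        _ ≤ c * μ {ω | ∃ s ≤ t, c ≤ M s ω} + (∫⁻ ω in {ω | c ≤ M (t + 1) ω} ∩ D, M (t + 1) ω ∂μ +
            ∫⁻ ω in {ω | c ≤ M (t + 1) ω}ᶜ ∩ D, M (t + 1) ω ∂μ) := by
            rw [mul_add, add_assoc]
            gcongr
            calc _ = ∫⁻ _ in {ω | c ≤ M (t + 1) ω} ∩ D, c ∂μ := by simp
              _ ≤ _ := setLIntegral_mono' (hm1.inter hmD) fun ω h => h.1
        _ = c * μ {ω | ∃ s ≤ t, c ≤ M s ω} + ∫⁻ ω in D, M (t + 1) ω ∂μ := by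
            rw [← Measure.restrict_restrict hm1, ← Measure.restrict_restrict hm1.compl,
              lintegral_add_compl _ hm1]
        _ ≤ _ := by
            exact add_le_add le_rfl (hstep t D (hB t))
  have hU : {ω | ∃ t, c ≤ M t ω} = ⋃ t, {ω | ∃ s ≤ t, c ≤ M s ω} := by
    ext ω
    simp only [Set.mem_ofPred_eq, Set.mem_iUnion]
    exact ⟨fun ⟨t, h⟩ => ⟨t, t, le_rfl, h⟩, fun ⟨_, s, _, h⟩ => ⟨s, h⟩⟩
  have hmonoU : Monotone fun t => {ω | ∃ s ≤ t, c ≤ M s ω} :=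
    fun a b hab ω ⟨s, hs, h⟩ => ⟨s, hs.trans hab, h⟩
  rw [hU, hmonoU.measure_iUnion, ENNReal.mul_iSup]
  exact iSup_le fun t => le_self_add.trans (key t)

lemma measurable_det_of_entries {m : MeasurableSpace Ω} {ι : Type*} [Fintype ι] [DecidableEq ι]
    {A : Ω → Matrix ι ι ℝ} (hA : ∀ i j, Measurable[m] fun ω => A ω i j) :
    Measurable[m] fun ω => (A ω).det := by
  simp only [det_apply']
  fun_prop

lemma measurable_inv_of_entries {m : MeasurableSpace Ω} {ι : Type*} [Fintype ι] [DecidableEq ι]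
    {A : Ω → Matrix ι ι ℝ} (hA : ∀ i j, Measurable[m] fun ω => A ω i j) (i j : ι) :
    Measurable[m] fun ω => (A ω)⁻¹ i j := by
  simp only [Matrix.inv_def, Matrix.smul_apply, adjugate_apply, Ring.inverse_eq_inv', smul_eq_mul]
  refine (measurable_det_of_entries hA).inv.mul (measurable_det_of_entries fun k l => ?_)
  by_cases h : k = j
  · subst h
    simp
  · simpa [updateRow_apply, h] using hA k l

/-- The σ-algebra generated by the first `t` terms of a sequence of real functions. -/
abbrev pastSigma (ξ : ℕ → Ω → ℝ) (t : ℕ) : MeasurableSpace Ω :=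
  ⨆ i ∈ Set.Iio t, MeasurableSpace.comap (ξ i) inferInstance

lemma pastSigma_mono (ξ : ℕ → Ω → ℝ) : Monotone (pastSigma ξ) :=
  fun _ _ h => biSup_mono fun _ hi => lt_of_lt_of_le hi h

lemma pastSigma_le {ξ : ℕ → Ω → ℝ} (hξ : ∀ t, Measurable (ξ t)) (t : ℕ) : pastSigma ξ t ≤ mΩ :=
  iSup₂_le fun i _ => (hξ i).comap_le

lemma measurable_pastSigma (ξ : ℕ → Ω → ℝ) {i t : ℕ} (h : i < t) :
    Measurable[pastSigma ξ t] (ξ i) :=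
  (comap_measurable (ξ i)).mono (le_biSup (f := fun i => MeasurableSpace.comap (ξ i) inferInstance)
    (show i ∈ Set.Iio t from h)) le_rfl

/-- Independence of blocks with disjoint index sets, here the indices below `t` and `t` itself. -/
lemma indepFun_of_measurable_pastSigma {ξ : ℕ → Ω → ℝ} (hξ : ∀ t, Measurable (ξ t))
    (hind : iIndepFun ξ μ) {β : Type*} {mβ : MeasurableSpace β} {t : ℕ} {Y : Ω → β}
    (hY : Measurable[pastSigma ξ t] Y) : IndepFun Y (ξ t) μ := by
  have h := ProbabilityTheory.indep_iSup_of_disjoint (μ := μ)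
    (m := fun i => MeasurableSpace.comap (ξ i) inferInstance)
    (fun i => (hξ i).comap_le) hind (S := Set.Iio t) (T := {t}) (by simp)
  rw [IndepFun_iff_Indep]
  refine indep_of_indep_of_le_left (indep_of_indep_of_le_right h ?_) hY.comap_le
  simp

/-- The regularized Gram matrix of the first `t` features. -/
noncomputable def gramMatrix {d : ℕ} (lam : ℝ) (φ : ℕ → Ω → Fin d → ℝ) (t : ℕ) (ω : Ω) :
    Matrix (Fin d) (Fin d) ℝ :=
  lam • (1 : Matrix (Fin d) (Fin d) ℝ) + ∑ s ∈ range t, vecMulVec (φ s ω) (φ s ω)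

/-- The sum of the first `t` features, weighted with the noise. -/
noncomputable def noiseSum {d : ℕ} (ξ : ℕ → Ω → ℝ) (φ : ℕ → Ω → Fin d → ℝ) (t : ℕ) (ω : Ω) :
    Fin d → ℝ :=
  ∑ s ∈ range t, ξ s ω • φ s ω

lemma gramMatrix_succ {d : ℕ} (lam : ℝ) (φ : ℕ → Ω → Fin d → ℝ) (t : ℕ) (ω : Ω) :
    gramMatrix lam φ (t + 1) ω = gramMatrix lam φ t ω + vecMulVec (φ t ω) (φ t ω) := by
  simp [gramMatrix, sum_range_succ, add_assoc]

lemma noiseSum_succ {d : ℕ} (ξ : ℕ → Ω → ℝ) (φ : ℕ → Ω → Fin d → ℝ) (t : ℕ) (ω : Ω) :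
    noiseSum ξ φ (t + 1) ω = noiseSum ξ φ t ω + ξ t ω • φ t ω := by
  simp [noiseSum, sum_range_succ]

lemma gramMatrix_posDef {d : ℕ} {lam : ℝ} (hlam : 0 < lam) (φ : ℕ → Ω → Fin d → ℝ) (t : ℕ)
    (ω : Ω) : (gramMatrix lam φ t ω).PosDef :=
  (posDef_smul_one_real hlam).add_posSemidef
    (posSemidef_sum _ fun _ _ => posSemidef_vecMulVec_self_real _)

/-- The mixture supermartingale. -/
noncomputable def mixtureProcess {d : ℕ} (lam R : ℝ) (ξ : ℕ → Ω → ℝ) (φ : ℕ → Ω → Fin d → ℝ)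
    (t : ℕ) (ω : Ω) : ℝ≥0∞ :=
  ENNReal.ofReal (√(lam ^ d / (gramMatrix lam φ t ω).det) *
    Real.exp ((noiseSum ξ φ t ω ⬝ᵥ ((gramMatrix lam φ t ω)⁻¹ *ᵥ noiseSum ξ φ t ω)) / (2 * R ^ 2)))

section Measurability

variable {d : ℕ} {lam R : ℝ} {ξ : ℕ → Ω → ℝ} {φ : ℕ → Ω → Fin d → ℝ}

lemma measurable_gramMatrix (hφ : ∀ t, Measurable[pastSigma ξ t] (φ t)) (t : ℕ) (i j : Fin d) :
    Measurable[pastSigma ξ t] fun ω => gramMatrix lam φ t ω i j := by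
  simp only [gramMatrix, Matrix.add_apply, Matrix.sum_apply, vecMulVec_apply]
  refine Measurable.const_add (Finset.measurable_sum _ fun s hs => ?_) _
  have h := (hφ s).mono (pastSigma_mono ξ (mem_range.1 hs).le) le_rfl
  exact ((measurable_pi_apply i).comp h).mul ((measurable_pi_apply j).comp h)

lemma measurable_noiseSum (hφ : ∀ t, Measurable[pastSigma ξ t] (φ t)) (t : ℕ) :
    Measurable[pastSigma ξ t] (noiseSum ξ φ t) := by
  have : noiseSum ξ φ t = fun ω => ∑ s ∈ range t, ξ s ω • φ s ω := rfl
  rw [this]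
  refine Finset.measurable_sum _ fun s hs => ?_
  exact (measurable_pastSigma ξ (mem_range.1 hs)).smul
    ((hφ s).mono (pastSigma_mono ξ (mem_range.1 hs).le) le_rfl)

lemma measurable_dotProduct_mulVec {m : MeasurableSpace Ω} {B : Ω → Matrix (Fin d) (Fin d) ℝ}
    {x y : Ω → Fin d → ℝ} (hB : ∀ i j, Measurable[m] fun ω => B ω i j) (hx : Measurable[m] x)
    (hy : Measurable[m] y) : Measurable[m] fun ω => x ω ⬝ᵥ (B ω *ᵥ y ω) := by
  simp only [dotProduct, mulVec]
  refine Finset.measurable_sum _ fun i _ => ?_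
  refine ((measurable_pi_apply i).comp hx).mul (Finset.measurable_sum _ fun j _ => ?_)
  exact (hB i j).mul ((measurable_pi_apply j).comp hy)

lemma measurable_mixtureProcess (hφ : ∀ t, Measurable[pastSigma ξ t] (φ t)) (t : ℕ) :
    Measurable[pastSigma ξ t] (mixtureProcess lam R ξ φ t) := by
  have h1 := measurable_det_of_entries (measurable_gramMatrix (lam := lam) hφ t)
  have h2 := measurable_dotProduct_mulVec (measurable_inv_of_entries (measurable_gramMatrix (lam := lam) hφ t))
    (measurable_noiseSum hφ t) (measurable_noiseSum hφ t)
  exact ((h1.const_div _).sqrt.mul (h2.div_const _).exp).ennreal_ofReal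

/-- Sherman–Morrison makes the exponent additive and the determinant lemma makes the prefactor
multiplicative. In the resulting factor only `ξ t` is not determined by the past. -/
lemma mixtureProcess_succ (hlam : 0 < lam) (t : ℕ) (ω : Ω) :
    mixtureProcess lam R ξ φ (t + 1) ω = mixtureProcess lam R ξ φ t ω *
      ((ENNReal.ofReal √(1 + φ t ω ⬝ᵥ ((gramMatrix lam φ t ω)⁻¹ *ᵥ φ t ω)))⁻¹ *
      ENNReal.ofReal (Real.exp ((2 * ξ t ω * (φ t ω ⬝ᵥ ((gramMatrix lam φ t ω)⁻¹ *ᵥ noiseSum ξ φ t ω))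
        + ξ t ω ^ 2 * (φ t ω ⬝ᵥ ((gramMatrix lam φ t ω)⁻¹ *ᵥ φ t ω))
        - (φ t ω ⬝ᵥ ((gramMatrix lam φ t ω)⁻¹ *ᵥ noiseSum ξ φ t ω)) ^ 2) /
        (2 * R ^ 2 * (1 + φ t ω ⬝ᵥ ((gramMatrix lam φ t ω)⁻¹ *ᵥ φ t ω)))))) := by
  have hA := gramMatrix_posDef hlam φ t ω
  have hq := hA.inv_dotProduct_nonneg (φ t ω)
  have h1 : 0 < 1 + φ t ω ⬝ᵥ ((gramMatrix lam φ t ω)⁻¹ *ᵥ φ t ω) := by linarith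
  rw [mixtureProcess, mixtureProcess, gramMatrix_succ, noiseSum_succ,
    hA.inv_add_vecMulVec_quadratic, hA.det_add_vecMulVec_self,
    ← ENNReal.ofReal_inv_of_pos (Real.sqrt_pos.2 h1), ← ENNReal.ofReal_mul (by positivity),
    ← ENNReal.ofReal_mul (by positivity)]
  congr 1
  rw [← div_div, Real.sqrt_div' _ h1.le, add_div, Real.exp_add, div_div, mul_comm (1 + _) (2 * R ^ 2)]
  ring

end Measurability

/-- The self-normalized tail bound for vector-valued martingales. -/
theorem measure_exists_selfNormalized_le [IsProbabilityMeasure μ] {d : ℕ} {lam R : ℝ}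
    (hlam : 0 < lam) (hR : 0 < R) {ξ : ℕ → Ω → ℝ} (hξ : ∀ t, Measurable (ξ t))
    (hind : iIndepFun ξ μ) (hsub : ∀ t, HasSubgaussianMGF (ξ t) (Real.toNNReal (R ^ 2)) μ)
    {φ : ℕ → Ω → Fin d → ℝ} (hφ : ∀ t, Measurable[pastSigma ξ t] (φ t)) {δ : ℝ} (hδ : 0 < δ) :
    μ {ω | ∃ t, 2 * R ^ 2 * Real.log (√((gramMatrix lam φ t ω).det / lam ^ d) / δ) ≤
      noiseSum ξ φ t ω ⬝ᵥ ((gramMatrix lam φ t ω)⁻¹ *ᵥ noiseSum ξ φ t ω)} ≤ ENNReal.ofReal δ := by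
  have hville := mul_measure_exists_le_of_setLIntegral_succ_le (μ := μ) (pastSigma ξ)
    (pastSigma_mono ξ) (pastSigma_le hξ) (mixtureProcess lam R ξ φ)
    (measurable_mixtureProcess hφ) ?_ (ENNReal.ofReal δ⁻¹)
  · have h0 : ∫⁻ ω, mixtureProcess lam R ξ φ 0 ω ∂μ = 1 := by
      have : ∀ ω, mixtureProcess lam R ξ φ 0 ω = 1 := by
        intro ω
        have : lam ^ d ≠ 0 := by positivity
        simp [mixtureProcess, gramMatrix, noiseSum, this]
      simp [this]
    rw [h0, ENNReal.ofReal_inv_of_pos hδ, mul_comm, ← div_eq_mul_inv,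
      ENNReal.div_le_iff (by simpa using hδ) ENNReal.ofReal_ne_top, one_mul] at hville
    refine (measure_mono ?_).trans hville
    rintro ω ⟨t, ht⟩
    refine ⟨t, ?_⟩
    rw [mixtureProcess, ← ENNReal.ofReal_inv_of_pos hδ]
    apply ENNReal.ofReal_le_ofReal
    have hdet := (gramMatrix_posDef hlam φ t ω).det_pos
    set D := (gramMatrix lam φ t ω).det
    set Q := noiseSum ξ φ t ω ⬝ᵥ ((gramMatrix lam φ t ω)⁻¹ *ᵥ noiseSum ξ φ t ω)
    have hs : 0 < √(D / lam ^ d) := by positivity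
    have h1 : Real.log (√(D / lam ^ d) / δ) ≤ Q / (2 * R ^ 2) := by
      rw [le_div_iff₀ (by positivity)]
      linarith
    rw [Real.log_le_iff_le_exp (by positivity), div_eq_mul_inv] at h1
    have h2 : √(lam ^ d / D) = (√(D / lam ^ d))⁻¹ := by
      rw [← Real.sqrt_inv, inv_div]
    rw [h2]
    rw [← div_eq_inv_mul, le_div_iff₀ hs, mul_comm]
    exact h1
  · intro t B hB
    set q : Ω → ℝ := fun ω => φ t ω ⬝ᵥ ((gramMatrix lam φ t ω)⁻¹ *ᵥ φ t ω) with hq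
    set u : Ω → ℝ := fun ω => φ t ω ⬝ᵥ ((gramMatrix lam φ t ω)⁻¹ *ᵥ noiseSum ξ φ t ω) with hu
    -- With the event absorbed into `I`, the triple `(I, q, u)` is a function of the past, hence
    -- independent of `ξ t`. Fubini for the product law then replaces conditional expectations.
    set I : Ω → ℝ≥0∞ := B.indicator (mixtureProcess lam R ξ φ t) with hI
    have hinv := measurable_inv_of_entries (measurable_gramMatrix (lam := lam) hφ t)
    have hqm : Measurable[pastSigma ξ t] q := measurable_dotProduct_mulVec hinv (hφ t) (hφ t)
    have hum : Measurable[pastSigma ξ t] u :=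
      measurable_dotProduct_mulVec hinv (hφ t) (measurable_noiseSum hφ t)
    have hIm : Measurable[pastSigma ξ t] I := (measurable_mixtureProcess hφ t).indicator hB
    have hYm : Measurable[pastSigma ξ t] fun ω => (I ω, q ω, u ω) := hIm.prodMk (hqm.prodMk hum)
    have hYm' := hYm.mono (pastSigma_le hξ t) le_rfl
    have hprod := (indepFun_iff_map_prod_eq_prod_map_map hYm'.aemeasurable (hξ t).aemeasurable).1
      (indepFun_of_measurable_pastSigma hξ hind hYm)
    have hB' := pastSigma_le hξ t _ hB
    let h : (ℝ≥0∞ × ℝ × ℝ) × ℝ → ℝ≥0∞ := fun p => p.1.1 * ((ENNReal.ofReal √(1 + p.1.2.1))⁻¹ *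
      ENNReal.ofReal (Real.exp ((2 * p.2 * p.1.2.2 + p.2 ^ 2 * p.1.2.1 - p.1.2.2 ^ 2) /
        (2 * R ^ 2 * (1 + p.1.2.1)))))
    have hh : Measurable h := by fun_prop
    rw [← lintegral_indicator hB', ← lintegral_indicator hB']
    calc _ = ∫⁻ ω, h ((I ω, q ω, u ω), ξ t ω) ∂μ := by
          refine lintegral_congr fun ω => ?_
          by_cases hω : ω ∈ B
          · simp only [hI, Set.indicator_of_mem hω, h]
            exact mixtureProcess_succ hlam t ω
          · simp [hI, hω, h]
      _ = ∫⁻ p, h p ∂(μ.map fun ω => ((I ω, q ω, u ω), ξ t ω)) := by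
          rw [lintegral_map hh (hYm'.prodMk (hξ t))]
      _ = ∫⁻ y, ∫⁻ e, h (y, e) ∂(μ.map (ξ t)) ∂(μ.map fun ω => (I ω, q ω, u ω)) := by
          have := Measure.isProbabilityMeasure_map (μ := μ) (hξ t).aemeasurable
          rw [hprod, lintegral_prod _ hh.aemeasurable]
      _ = ∫⁻ ω, ∫⁻ ω', h ((I ω, q ω, u ω), ξ t ω') ∂μ ∂μ := by
          have := Measure.isProbabilityMeasure_map (μ := μ) (hξ t).aemeasurable
          rw [lintegral_map hh.lintegral_prod_right' hYm']
          refine lintegral_congr fun ω => ?_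
          exact lintegral_map (hh.comp measurable_prodMk_left) (hξ t)
      _ ≤ ∫⁻ ω, I ω ∂μ := by
          refine lintegral_mono fun ω => ?_
          have hq0 : 0 ≤ q ω := (gramMatrix_posDef hlam φ t ω).inv_dotProduct_nonneg _
          have hs : 0 < √(1 + q ω) := by positivity
          simp only [h]
          have hm : Measurable fun ω' => ENNReal.ofReal (Real.exp ((2 * ξ t ω' * u ω +
              ξ t ω' ^ 2 * q ω - u ω ^ 2) / (2 * R ^ 2 * (1 + q ω)))) := by
            have := hξ t
            fun_prop
          rw [lintegral_const_mul _ (hm.const_mul _), lintegral_const_mul _ hm]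
          calc _ ≤ I ω * ((ENNReal.ofReal √(1 + q ω))⁻¹ * ENNReal.ofReal √(1 + q ω)) := by
                gcongr
                exact (hsub t).lintegral_exp_quadratic_le hR (hξ t) hq0 (u ω)
            _ = I ω := by
                rw [ENNReal.inv_mul_cancel (by simpa using hs) ENNReal.ofReal_ne_top, mul_one]

/-- Hoeffding's inequality, two-sided, for a block of consecutive terms. -/
lemma measure_abs_sum_block_ge_le [IsProbabilityMeasure μ] {ξ : ℕ → Ω → ℝ}
    (hind : iIndepFun ξ μ) {c : ℝ≥0} (hsub : ∀ t, HasSubgaussianMGF (ξ t) c μ) (k N : ℕ)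
    {ε : ℝ} (hε : 0 ≤ ε) :
    μ {ω | ε ≤ |∑ i ∈ range N, ξ (k + i) ω|} ≤
      ENNReal.ofReal (2 * Real.exp (-ε ^ 2 / (2 * N * c))) := by
  have hind' : iIndepFun (fun i => ξ (k + i)) μ := hind.precomp (add_right_injective k)
  have hneg : iIndepFun (fun i => -ξ (k + i)) μ :=
    hind'.comp (fun _ x => -x) fun _ => measurable_neg
  have h1 := HasSubgaussianMGF.measure_sum_range_ge_le_of_iIndepFun hind' (n := N)
    (fun i _ => hsub (k + i)) hε
  have h2 := HasSubgaussianMGF.measure_sum_range_ge_le_of_iIndepFun hneg (n := N)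
    (fun i _ => (hsub (k + i)).neg) hε
  have hsubset : {ω | ε ≤ |∑ i ∈ range N, ξ (k + i) ω|} ⊆
      {ω | ε ≤ ∑ i ∈ range N, ξ (k + i) ω} ∪ {ω | ε ≤ ∑ i ∈ range N, (-ξ (k + i)) ω} := by
    intro ω hω
    rcases le_abs.1 (show ε ≤ |∑ i ∈ range N, ξ (k + i) ω| from hω) with h | h
    · exact Or.inl h
    · right
      simpa using h
  refine (measure_mono hsubset).trans ((measure_union_le _ _).trans ?_)
  rw [two_mul, ENNReal.ofReal_add (Real.exp_nonneg _) (Real.exp_nonneg _)]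
  refine add_le_add ?_ ?_
  · rw [← ENNReal.ofReal_toReal (measure_ne_top μ _)]
    exact ENNReal.ofReal_le_ofReal h1
  · rw [← ENNReal.ofReal_toReal (measure_ne_top μ _)]
    exact ENNReal.ofReal_le_ofReal h2

end SelfNormalized

/-! ### Total correctness rules for loops. -/

section Loops

variable {σ : Type} {cond : σ → Prop} {body : σ → Option σ} {s₀ : σ}

/-- Total correctness of a while loop with an invariant `I k` after `k` passes. -/
lemma whileLoop_spec (I : ℕ → σ → Prop) (h0 : I 0 s₀)
    (hstep : ∀ k s, I k s → cond s → ∃ s', body s = some s' ∧ I (k + 1) s')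
    (K : ℕ) (hK : ∀ s, I K s → ¬ cond s) :
    ∃ k ≤ K, ∃ s', whileLoop cond body s₀ = some s' ∧ I k s' ∧ ¬ cond s' := by
  classical
  have hI : ∀ j, (∀ k < j, ¬ ∃ s, loopIter body s₀ k = some s ∧ ¬ cond s) →
      ∃ s, loopIter body s₀ j = some s ∧ I j s := by
    intro j
    induction j with
    | zero => exact fun _ => ⟨s₀, rfl, h0⟩
    | succ j ih =>
      intro h
      obtain ⟨s, hs, hIs⟩ := ih fun k hk => h k (hk.trans j.lt_succ_self)
      have hc : cond s := by
        by_contra hc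
        exact h j j.lt_succ_self ⟨s, hs, hc⟩
      obtain ⟨s', hs', hIs'⟩ := hstep j s hIs hc
      exact ⟨s', by simp [loopIter, hs, hs'], hIs'⟩
  have hex : ∃ k ≤ K, ∃ s, loopIter body s₀ k = some s ∧ ¬ cond s := by
    by_contra h
    push Not at h
    obtain ⟨s, hs, hIs⟩ := hI K fun k hk ⟨s, hs, hc⟩ => hc (h k hk.le s hs)
    exact hK s hIs (h K le_rfl s hs)
  obtain ⟨k, hkK, hk⟩ := hex
  have hex' : ∃ k, ∃ s', loopIter body s₀ k = some s' ∧ ¬ cond s' := ⟨k, hk⟩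
  obtain ⟨s, hs, hIs⟩ := hI (Nat.find hex') fun j hj => Nat.find_min hex' hj
  obtain ⟨s', hs', hc⟩ := Nat.find_spec hex'
  obtain rfl : s = s' := by simpa [hs] using hs'
  refine ⟨Nat.find hex', (Nat.find_min' hex' hk).trans hkK, s, ?_, hIs, hc⟩
  rw [whileLoop, dif_pos hex', hs]

/-- Total correctness of a monadic fold; the invariant may mention the remaining list. -/
lemma foldlM_option_spec {α : Type*} {f : σ → α → Option σ} (I : List α → σ → Prop)
    (hstep : ∀ a l s, I (a :: l) s → ∃ s', f s a = some s' ∧ I l s') :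
    ∀ l s, I l s → ∃ s', l.foldlM f s = some s' ∧ I [] s' := by
  intro l
  induction l with
  | nil => exact fun s h => ⟨s, rfl, h⟩
  | cons a l ih =>
    intro s h
    obtain ⟨s', hs', h'⟩ := hstep a l s h
    obtain ⟨s'', hs'', h''⟩ := ih s' h'
    exact ⟨s'', by simp [List.foldlM_cons, hs', hs''], h''⟩

end Loops

/-! ### Inequalities with a logarithm of the unknown. -/

section RealBounds

/-- A logarithm is eventually dominated by the identity. -/
lemma exists_forall_add_mul_log_lt (a : ℝ) {b c : ℝ} (hb : 0 ≤ b) (hc : 0 ≤ c) :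
    ∃ x₀ : ℝ, ∀ x, x₀ ≤ x → a + b * Real.log (1 + c * x) < x := by
  -- In `log y ≤ η y - 1 - log η` this slope makes the linear term at most `x / 2`.
  obtain ⟨η, hη⟩ : ∃ η : ℝ, η = 1 / (2 * (b * c + 1)) := ⟨_, rfl⟩
  have hbc : 0 ≤ b * c := mul_nonneg hb hc
  have hη0 : 0 < η := by rw [hη]; positivity
  have hη1 : b * c * η ≤ 1 / 2 := by
    rw [hη, mul_one_div, div_le_iff₀ (by positivity)]
    linarith
  refine ⟨max 0 (2 * (a + b * (η - 1 - Real.log η)) + 1), fun x hx => ?_⟩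
  have hx0 : 0 ≤ x := (le_max_left _ _).trans hx
  have hx1 := (le_max_right _ _).trans hx
  have h1 : 0 < 1 + c * x := by positivity
  have h2 := Real.log_le_sub_one_of_pos (mul_pos hη0 h1)
  rw [Real.log_mul hη0.ne' h1.ne'] at h2
  have h3 : b * Real.log (1 + c * x) ≤ b * (η - 1 - Real.log η) + b * c * η * x := by
    have := mul_le_mul_of_nonneg_left h2 hb
    linarith
  have h4 : b * c * η * x ≤ 1 / 2 * x := mul_le_mul_of_nonneg_right hη1 hx0
  linarith

/-- Resolution of the implicit inequality `t ≤ Nm + 4 H R² (2 ℓ + d/2 log (1 + t L² / (λ d)))`. -/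
lemma one_add_le_of_le_add_mul_log {t Nm H R L lam l d : ℝ} (ht : 0 ≤ t)
    (hH : 0 ≤ H) (hlam : 0 < lam) (hl : 0 ≤ l) (hd : 1 ≤ d)
    (h : t ≤ Nm + H * (4 * R ^ 2 * (2 * l + d / 2 * Real.log (1 + t * L ^ 2 / (lam * d))))) :
    1 + t * L ^ 2 / (lam * d) ≤ 16 * H * R ^ 2 * L ^ 2 / lam * l +
      32 * H ^ 2 * R ^ 4 * L ^ 4 / lam ^ 2 + 2 * Nm * L ^ 2 / (lam * d) + 2 := by
  have hd0 : 0 < d := by linarith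
  obtain ⟨y, hy⟩ : ∃ y, y = 1 + t * L ^ 2 / (lam * d) := ⟨_, rfl⟩
  have hy1 : 1 ≤ y := by
    rw [hy, le_add_iff_nonneg_right]
    positivity
  rw [← hy] at h ⊢
  obtain ⟨z, hz⟩ : ∃ z, z = √y := ⟨_, rfl⟩
  have hz2 : z ^ 2 = y := by rw [hz, Real.sq_sqrt (by linarith)]
  have hz0 : 0 < z := by rw [hz]; positivity
  -- This turns the implicit inequality into a quadratic one in `z = √y`, resolved at the end by `2
  -- C z ≤ z² + C²`.
  have hlog : Real.log y ≤ 2 * z := by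
    rw [← hz2, Real.log_pow]
    have := Real.log_le_sub_one_of_pos hz0
    push_cast
    linarith
  have h1 : t ≤ Nm + H * (4 * R ^ 2 * (2 * l + d * z)) := by
    have h0 : d / 2 * Real.log y ≤ d / 2 * (2 * z) := mul_le_mul_of_nonneg_left hlog (by positivity)
    refine h.trans (add_le_add le_rfl (mul_le_mul_of_nonneg_left
      (mul_le_mul_of_nonneg_left ?_ (by positivity)) hH))
    linarith
  have h2 : y ≤ 1 + (Nm + H * (4 * R ^ 2 * (2 * l + d * z))) * L ^ 2 / (lam * d) := by
    conv_lhs => rw [hy]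
    gcongr
  obtain ⟨C, hC⟩ : ∃ C, C = 4 * H * R ^ 2 * L ^ 2 / lam := ⟨_, rfl⟩
  have h3 : (Nm + H * (4 * R ^ 2 * (2 * l + d * z))) * L ^ 2 / (lam * d) =
      Nm * L ^ 2 / (lam * d) + 2 * C * l / d + C * z := by
    rw [hC]
    field_simp
    ring
  have h4 : 2 * C * l / d ≤ 2 * C * l := by
    refine div_le_self ?_ hd
    rw [hC]
    positivity
  have h5 : 16 * H * R ^ 2 * L ^ 2 / lam * l + 32 * H ^ 2 * R ^ 4 * L ^ 4 / lam ^ 2 +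
      2 * Nm * L ^ 2 / (lam * d) + 2 = 4 * C * l + 2 * C ^ 2 + 2 * (Nm * L ^ 2 / (lam * d)) + 2 := by
    rw [hC]
    field_simp
    ring
  rw [h5]
  nlinarith [sq_nonneg (z - C), sq_nonneg C]

end RealBounds

/-! ### Confidence width and allocation of samples in one state. -/

section Evaluation

variable {n d : ℕ} {P : LinTGParams} {L : ℝ}

/-- The arms and the sample counts of a state account for its matrix and for its clock. -/
structure ArmInvariant (P : LinTGParams) (L : ℝ) (st : LinTGState n d) : Prop where
  A_eq : st.A = P.lam • (1 : Matrix (Fin d) (Fin d) ℝ) +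
    ∑ i ∈ range st.m, (st.T i : ℝ) • vecMulVec (st.X i) (st.X i)
  one_le : ∀ i < st.m, 1 ≤ st.T i
  eq_zero : ∀ i, st.m ≤ i → st.T i = 0
  norm_le : ∀ i < st.m, st.X i ⬝ᵥ st.X i ≤ L ^ 2
  t_eq : st.t = ∑ i ∈ range st.m, st.T i

/-- An upper bound on `β² / ‖x‖²` after `τ` samples. -/
noncomputable def widthBound (P : LinTGParams) (L : ℝ) (d : ℕ) (τ : ℝ) : ℝ :=
  2 * P.R ^ 2 * (2 * Real.log (2 / P.delta) + d * Real.log (1 + τ * L ^ 2 / (P.lam * d))) +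
    2 * P.lam * P.S ^ 2

lemma widthBound_mono (hlam : 0 < P.lam) {τ τ' : ℝ} (hτ : 0 ≤ τ) (h : τ ≤ τ') :
    widthBound P L d τ ≤ widthBound P L d τ' := by
  unfold widthBound
  gcongr

lemma log_two_div_nonneg (hdelta0 : 0 < P.delta) (hdelta1 : P.delta < 1) :
    0 ≤ Real.log (2 / P.delta) :=
  Real.log_nonneg (by rw [le_div_iff₀ hdelta0]; linarith)

lemma widthBound_nonneg (hlam : 0 < P.lam) (hdelta0 : 0 < P.delta) (hdelta1 : P.delta < 1)
    {τ : ℝ} (hτ : 0 ≤ τ) : 0 ≤ widthBound P L d τ := by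
  have h1 := log_two_div_nonneg hdelta0 hdelta1
  have h2 : 0 ≤ Real.log (1 + τ * L ^ 2 / (P.lam * d)) :=
    Real.log_nonneg (le_add_of_nonneg_right (by positivity))
  unfold widthBound
  positivity

namespace ArmInvariant

variable {st : LinTGState n d}

lemma posDef (h : ArmInvariant P L st) (hlam : 0 < P.lam) : st.A.PosDef := by
  rw [h.A_eq]
  exact (posDef_smul_one_real hlam).add_posSemidef
    (posSemidef_sum _ fun i _ => (posSemidef_vecMulVec_self_real _).smul (Nat.cast_nonneg _))

/-- Each sample adds at most `L²` to the trace, so the mean eigenvalue is at most `λ (1 + t L² / (λ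
d))`. -/
lemma log_det_le (h : ArmInvariant P L st) (hlam : 0 < P.lam) (hd : 0 < d) :
    Real.log st.A.det ≤ d * Real.log P.lam + d * Real.log (1 + st.t * L ^ 2 / (P.lam * d)) := by
  have hd' : (0 : ℝ) < d := by exact_mod_cast hd
  have h1 := (h.posDef hlam).log_det_le (r := P.lam * (1 + st.t * L ^ 2 / (P.lam * d)))
    (by positivity) ?_
  · rwa [Real.log_mul hlam.ne' (by positivity), Fintype.card_fin, mul_add] at h1
  · rw [h.A_eq, trace_add, trace_smul, trace_one, trace_sum, Fintype.card_fin]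
    have h2 : ∑ i ∈ range st.m, ((st.T i : ℝ) • vecMulVec (st.X i) (st.X i)).trace ≤
        ∑ i ∈ range st.m, (st.T i : ℝ) * L ^ 2 := by
      refine sum_le_sum fun i hi => ?_
      rw [trace_smul, trace_vecMulVec, smul_eq_mul]
      exact mul_le_mul_of_nonneg_left (h.norm_le i (mem_range.1 hi)) (Nat.cast_nonneg _)
    rw [← sum_mul, ← Nat.cast_sum, ← h.t_eq] at h2
    have h3 : (d : ℝ) * (P.lam * (1 + st.t * L ^ 2 / (P.lam * d))) = P.lam * d + st.t * L ^ 2 := by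
      field_simp
    rw [h3, smul_eq_mul]
    linarith

lemma log_ratio_eq (hA : 0 < st.A.det) (hlam : 0 < P.lam) (hdelta0 : 0 < P.delta) :
    Real.log (2 * st.A.det ^ (1 / 2 : ℝ) *
      (P.lam • (1 : Matrix (Fin d) (Fin d) ℝ)).det ^ (-(1 / 2) : ℝ) / P.delta) =
      Real.log (2 / P.delta) + (Real.log st.A.det - d * Real.log P.lam) / 2 := by
  have h1 : (P.lam • (1 : Matrix (Fin d) (Fin d) ℝ)).det = P.lam ^ d := by simp
  have h2 : 0 < P.lam ^ d := by positivity
  have h3 := (Real.rpow_pos_of_pos hA (1 / 2)).ne'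
  have h4 := (Real.rpow_pos_of_pos h2 (-(1 / 2))).ne'
  rw [h1, Real.log_div (by positivity) hdelta0.ne', Real.log_mul (by positivity) h4,
    Real.log_mul two_ne_zero h3, Real.log_rpow hA, Real.log_rpow h2, Real.log_pow,
    Real.log_div two_ne_zero hdelta0.ne']
  ring

/-- Noise and regularization parts are separated by `(x + y)² ≤ 2 (x² + y²)`, the source of the
factors `2` in `widthBound`. -/
lemma beta_sq_le (h : ArmInvariant P L st) (hlam : 0 < P.lam) (hd : 0 < d)
    (hdelta0 : 0 < P.delta) (hdelta1 : P.delta < 1) :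
    st.beta P ^ 2 ≤ widthBound P L d st.t * (st.x ⬝ᵥ (st.A⁻¹ *ᵥ st.x)) := by
  have hA := h.posDef hlam
  have hl := log_two_div_nonneg hdelta0 hdelta1
  unfold LinTGState.beta
  rw [mul_pow, Real.sq_sqrt (hA.inv_dotProduct_nonneg _), log_ratio_eq hA.det_pos hlam hdelta0]
  refine mul_le_mul_of_nonneg_right ?_ (hA.inv_dotProduct_nonneg _)
  have h1 := h.log_det_le hlam hd
  have h2 : 0 ≤ Real.log (1 + st.t * L ^ 2 / (P.lam * d)) :=
    Real.log_nonneg (le_add_of_nonneg_right (by positivity))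
  have h3 : √(2 * (Real.log (2 / P.delta) + (Real.log st.A.det - d * Real.log P.lam) / 2)) ^ 2 ≤
      2 * Real.log (2 / P.delta) + d * Real.log (1 + st.t * L ^ 2 / (P.lam * d)) := by
    -- No lower bound on the determinant is needed: for a negative radicand the real square root is
    -- `0`.
    rcases le_total 0 (2 * (Real.log (2 / P.delta) +
      (Real.log st.A.det - d * Real.log P.lam) / 2)) with h4 | h4
    · rw [Real.sq_sqrt h4]
      linarith
    · have h6 := mul_nonneg (Nat.cast_nonneg (α := ℝ) d) h2
      rw [Real.sqrt_eq_zero_of_nonpos h4, zero_pow two_ne_zero]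
      linarith
  have h5 : (P.lam ^ (1 / 2 : ℝ)) ^ 2 = P.lam := by
    rw [← Real.sqrt_eq_rpow, Real.sq_sqrt hlam.le]
  refine (add_sq_le).trans ?_
  rw [mul_pow, mul_pow, h5, widthBound]
  nlinarith [mul_le_mul_of_nonneg_left h3 (sq_nonneg P.R)]

end ArmInvariant

section Allocation

variable (rule : LinTGRule d) {m : ℕ} {X : ℕ → Fin d → ℝ}

lemma LinTGRule.rho_nonneg : 0 ≤ rule.rho m X := sum_nonneg fun _ _ => abs_nonneg _

/-- The last arm represents itself with coefficient one. -/
lemma LinTGRule.rho_le_one (hm : 0 < m) : rule.rho m X ≤ 1 := by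
  refine ((rule.coef_opt m X hm).2 (fun i => if i = m - 1 then 1 else 0) ?_).trans ?_
  · simp [hm]
  · rw [sum_eq_single (m - 1)]
    · simp
    · intro i _ hi
      simp [hi]
    · simp [hm]

lemma LinTGRule.alloc_nonneg (i : ℕ) : 0 ≤ rule.alloc m X i :=
  div_nonneg (abs_nonneg _) rule.rho_nonneg

lemma LinTGRule.sum_alloc_le_one : ∑ i ∈ range m, rule.alloc m X i ≤ 1 := by
  unfold LinTGRule.alloc
  rw [← sum_div]
  exact div_self_le_one _

/-- The convention `0 / 0 = 0` is harmless: a vanishing optimum has only zero coefficients. -/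
lemma LinTGRule.alloc_mul_rho {i : ℕ} (hi : i < m) :
    rule.alloc m X i * rule.rho m X = |rule.coef m X i| := by
  unfold LinTGRule.alloc
  rcases eq_or_ne (rule.rho m X) 0 with h | h
  · have := (sum_eq_zero_iff_of_nonneg fun _ _ => abs_nonneg _).1 h i (mem_range.2 hi)
    rw [h, this, mul_zero]
  · exact div_mul_cancel₀ _ h

end Allocation

/-- The quadratic form is at most `∑ c_i² / T_i = ρ² ∑ p_i² / T_i`, and `p_i ≤ b T_i` with `∑ p_i ≤
1` gives `ρ² b`. Since `ρ ≤ 1`, one factor `ρ` may be dropped, which matches the form of `H`. -/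
lemma ArmInvariant.inv_dotProduct_le {st : LinTGState n d} (h : ArmInvariant P L st)
    (rule : LinTGRule d) (hlam : 0 < P.lam) (hm : 0 < st.m) {b : ℝ}
    (hb : ∀ i < st.m, rule.alloc st.m st.X i ≤ b * st.T i) :
    st.x ⬝ᵥ (st.A⁻¹ *ᵥ st.x) ≤ rule.rho st.m st.X * b := by
  have hT : ∀ i < st.m, (0 : ℝ) < st.T i := fun i hi => by exact_mod_cast h.one_le i hi
  have hb0 : 0 ≤ b := by
    have := (rule.alloc_nonneg _).trans (hb 0 hm)
    exact nonneg_of_mul_nonneg_left this (hT 0 hm)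
  have h1 := inv_dotProduct_le_sum_sq_div (range st.m) P.lam hlam (fun i => (st.T i : ℝ))
    (rule.coef st.m st.X) st.X fun i hi => hT i (mem_range.1 hi)
  rw [← (rule.coef_opt st.m st.X hm).1, ← h.A_eq] at h1
  refine h1.trans ?_
  have hr0 : 0 ≤ rule.rho st.m st.X := rule.rho_nonneg
  have hr1 : rule.rho st.m st.X ≤ 1 := rule.rho_le_one hm
  have h2 : ∀ i ∈ range st.m, rule.coef st.m st.X i ^ 2 / st.T i ≤
      rule.rho st.m st.X * b * rule.alloc st.m st.X i := by
    intro i hi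
    have hi' := mem_range.1 hi
    have ha : 0 ≤ rule.alloc st.m st.X i := rule.alloc_nonneg i
    rw [← sq_abs, ← rule.alloc_mul_rho hi', div_le_iff₀ (hT i hi')]
    calc (rule.alloc st.m st.X i * rule.rho st.m st.X) ^ 2 =
        (rule.rho st.m st.X * rule.alloc st.m st.X i) * rule.rho st.m st.X *
          rule.alloc st.m st.X i := by ring
      _ ≤ (rule.rho st.m st.X * rule.alloc st.m st.X i) * 1 * (b * st.T i) := by
          gcongr
          exact hb i hi'
      _ = _ := by ring
  refine (sum_le_sum h2).trans ?_
  rw [← mul_sum]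
  exact mul_le_of_le_one_right (by positivity) rule.sum_alloc_le_one

/-- While the confidence width exceeds `D`, the arm sampled next has few samples. -/
lemma ArmInvariant.pick_spec {st : LinTGState n d} (h : ArmInvariant P L st)
    (rule : LinTGRule d) (hlam : 0 < P.lam) (hd : 0 < d)
    (hdelta0 : 0 < P.delta) (hdelta1 : P.delta < 1) (hm : 0 < st.m) {D : ℝ} (hD : 0 < D)
    (hβ : D < st.beta P) :
    rule.pick st.m (rule.alloc st.m st.X) st.T < st.m ∧
      (st.T (rule.pick st.m (rule.alloc st.m st.X) st.T) : ℝ) ≤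
        rule.alloc st.m st.X (rule.pick st.m (rule.alloc st.m st.X) st.T) *
          rule.rho st.m st.X / D ^ 2 * widthBound P L d st.t := by
  have hG : 0 ≤ widthBound P L d st.t := widthBound_nonneg hlam hdelta0 hdelta1 (Nat.cast_nonneg _)
  have hβ2 : D ^ 2 < st.beta P ^ 2 := by gcongr
  have hβ3 := hβ2.trans_le (h.beta_sq_le hlam hd hdelta0 hdelta1)
  have hT : ∀ i < st.m, (0 : ℝ) < st.T i := fun i hi => by exact_mod_cast h.one_le i hi
  -- Otherwise `b = 0` is admissible, the quadratic form is nonpositive, and the width cannot exceed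
  -- `D > 0`.
  have hex : ∃ i < st.m, 0 < rule.alloc st.m st.X i := by
    by_contra hne
    push Not at hne
    have h1 := h.inv_dotProduct_le rule hlam hm (b := 0) fun i hi => by
      simpa using hne i hi
    have h2 := mul_le_mul_of_nonneg_left h1 hG
    nlinarith
  obtain ⟨h1, h2, h3⟩ := rule.pick_spec st.m (rule.alloc st.m st.X) st.T hex
  refine ⟨h1, ?_⟩
  set i := rule.pick st.m (rule.alloc st.m st.X) st.T
  -- Minimality of `T_i / p_i` says `p_j ≤ (p_i / T_i) T_j` for all `j`, so the lagging arm alone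
  -- controls the width.
  have h4 := h.inv_dotProduct_le rule hlam hm (b := rule.alloc st.m st.X i / st.T i) ?_
  · have h5 := hβ3.le.trans (mul_le_mul_of_nonneg_left h4 hG)
    have hTi := hT i h1
    rw [← mul_div_assoc, ← mul_div_assoc, le_div_iff₀ hTi] at h5
    rw [div_mul_eq_mul_div, le_div_iff₀ (by positivity)]
    linarith
  · intro j hj
    rcases (rule.alloc_nonneg (m := st.m) (X := st.X) j).eq_or_lt with h0 | h0
    · rw [← h0]
      have := hT j hj
      have := hT i h1
      positivity
    · have := h3 j hj h0
      rw [div_le_div_iff₀ h2 h0] at this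
      rw [div_mul_eq_mul_div, le_div_iff₀ (hT i h1)]
      linarith

end Evaluation

/-! ### Termination and sample count of one evaluation. -/

section EvaluationLoop

variable {n d : ℕ} {P : LinTGParams} {L : ℝ} {rule : LinTGRule d}
  {F : Finset (Fin n) → Fin d → ℝ} {reward : ℕ → (Fin d → ℝ) → ℝ}

lemma ArmInvariant.beginEval {st : LinTGState n d} (h : ArmInvariant P L st) {a : Fin n}
    (hg : gainVec F st.S a ⬝ᵥ gainVec F st.S a ≤ L ^ 2) :
    ArmInvariant P L (beginEval F reward st a) := by
  have hX : ∀ i < st.m, Function.update st.X st.m (gainVec F st.S a) i = st.X i :=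
    fun i hi => Function.update_of_ne hi.ne _ _
  have hT : ∀ i < st.m, Function.update st.T st.m 1 i = st.T i :=
    fun i hi => Function.update_of_ne hi.ne _ _
  refine ⟨?_, ?_, ?_, ?_, ?_⟩
  · simp only [_root_.beginEval, LinTGState.observe, sum_range_succ, Function.update_self]
    rw [h.A_eq, add_assoc]
    congr 2
    · exact sum_congr rfl fun i hi => by rw [hX i (mem_range.1 hi), hT i (mem_range.1 hi)]
    · simp
  · intro i hi
    rcases Nat.lt_succ_iff_lt_or_eq.1 hi with h1 | rfl
    · simpa [_root_.beginEval, hT i h1] using h.one_le i h1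
    · simp [_root_.beginEval]
  · intro i hi
    have h1 : st.m + 1 ≤ i := hi
    have h2 : i ≠ st.m := by omega
    simpa [_root_.beginEval, Function.update_of_ne h2] using h.eq_zero i (by omega)
  · intro i hi
    rcases Nat.lt_succ_iff_lt_or_eq.1 hi with h1 | rfl
    · simpa [_root_.beginEval, hX i h1] using h.norm_le i h1
    · simpa [_root_.beginEval] using hg
  · simp only [_root_.beginEval, LinTGState.observe, sum_range_succ, Function.update_self]
    rw [h.t_eq]
    congr 1
    exact sum_congr rfl fun i hi => by rw [hT i (mem_range.1 hi)]

lemma ArmInvariant.sampleStep {st : LinTGState n d} (h : ArmInvariant P L st)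
    (hi : rule.pick st.m (rule.alloc st.m st.X) st.T < st.m) :
    ArmInvariant P L (sampleStep rule reward st) := by
  unfold _root_.sampleStep
  generalize rule.pick st.m (rule.alloc st.m st.X) st.T = i at hi
  have hT : ∀ j, j ≠ i → Function.update st.T i (st.T i + 1) j = st.T j :=
    fun j hj => Function.update_of_ne hj _ _
  have hmem := mem_range.2 hi
  refine ⟨?_, ?_, ?_, h.norm_le, ?_⟩
  · simp only [LinTGState.observe]
    rw [h.A_eq, add_assoc, ← add_sum_erase _ _ hmem, ← add_sum_erase _ _ hmem,
      Function.update_self]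
    have : ∀ j ∈ (range st.m).erase i, ((Function.update st.T i (st.T i + 1) j : ℕ) : ℝ) •
        vecMulVec (st.X j) (st.X j) = (st.T j : ℝ) • vecMulVec (st.X j) (st.X j) :=
      fun j hj => by rw [hT j (mem_erase.1 hj).1]
    rw [sum_congr rfl this]
    push_cast
    rw [add_smul, one_smul]
    abel
  · intro j hj
    simp only [LinTGState.observe] at hj ⊢
    by_cases hji : j = i
    · subst hji
      simp
    · rw [hT j hji]
      exact h.one_le j hj
  · intro j hj
    simp only [LinTGState.observe] at hj ⊢
    rw [hT j (by omega)]
    exact h.eq_zero j hj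
  · simp only [LinTGState.observe]
    rw [h.t_eq, ← add_sum_erase _ _ hmem, ← add_sum_erase _ _ hmem, Function.update_self]
    have : ∀ j ∈ (range st.m).erase i, Function.update st.T i (st.T i + 1) j = st.T j :=
      fun j hj => hT j (mem_erase.1 hj).1
    rw [sum_congr rfl this]
    ring

/-- The state of an evaluation of `a`, begun in `st`, after `k` passes through the sampling loop. -/
noncomputable def evalState (rule : LinTGRule d) (F : Finset (Fin n) → Fin d → ℝ)
    (reward : ℕ → (Fin d → ℝ) → ℝ) (st : LinTGState n d) (a : Fin n) (k : ℕ) : LinTGState n d :=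
  (sampleStep rule reward)^[k] (beginEval F reward st a)

lemma evalState_succ (st : LinTGState n d) (a : Fin n) (k : ℕ) :
    evalState rule F reward st a (k + 1) = sampleStep rule reward (evalState rule F reward st a k) :=
  Function.iterate_succ_apply' _ _ _

lemma evalState_fields (st : LinTGState n d) (a : Fin n) (k : ℕ) :
    (evalState rule F reward st a k).S = st.S ∧ (evalState rule F reward st a k).w = st.w ∧
    (evalState rule F reward st a k).evals = st.evals ∧
    (evalState rule F reward st a k).m = st.m + 1 ∧
    (evalState rule F reward st a k).X = Function.update st.X st.m (gainVec F st.S a) ∧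
    (evalState rule F reward st a k).t = st.t + 1 + k := by
  induction k with
  | zero => exact ⟨rfl, rfl, rfl, rfl, rfl, rfl⟩
  | succ k ih =>
    rw [evalState_succ]
    obtain ⟨h1, h2, h3, h4, h5, h6⟩ := ih
    exact ⟨h1, h2, h3, h4, h5, by simp [sampleStep, LinTGState.observe, h6, add_assoc]⟩

lemma evalState_x (st : LinTGState n d) (a : Fin n) (k : ℕ) :
    (evalState rule F reward st a k).x = gainVec F st.S a := by
  obtain ⟨-, -, -, h4, h5, -⟩ := evalState_fields (rule := rule) (F := F) (reward := reward) st a k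
  simp [LinTGState.x, h4, h5]

/-- The failed tests place the ends of the confidence interval strictly outside `[w - ε', w + ε']`.
-/
lemma LinTGState.eps'_lt_beta {st : LinTGState n d} (hA : ¬ st.Accept P) (hR : ¬ st.Reject P) :
    P.eps' < st.beta P := by
  unfold LinTGState.Accept at hA
  unfold LinTGState.Reject at hR
  linarith

/-- The coefficient `p*ᵢ ρ` of arm `i` in an evaluation of `a` begun in `st`. -/
noncomputable def evalCoef (rule : LinTGRule d) (F : Finset (Fin n) → Fin d → ℝ)
    (st : LinTGState n d) (a : Fin n) (i : ℕ) : ℝ :=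
  rule.alloc (st.m + 1) (Function.update st.X st.m (gainVec F st.S a)) i *
    rule.rho (st.m + 1) (Function.update st.X st.m (gainVec F st.S a))

lemma evalCoef_nonneg (st : LinTGState n d) (a : Fin n) (i : ℕ) : 0 ≤ evalCoef rule F st a i :=
  mul_nonneg (rule.alloc_nonneg i) rule.rho_nonneg

/-- The sample counts during an evaluation, as long as the confidence width exceeds `D`. -/
lemma evalState_count_le (hlam : 0 < P.lam) (hd : 0 < d) (hdelta0 : 0 < P.delta)
    (hdelta1 : P.delta < 1) {st : LinTGState n d} (h : ArmInvariant P L st) {a : Fin n}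
    (hg : gainVec F st.S a ⬝ᵥ gainVec F st.S a ≤ L ^ 2) {D Γ : ℝ} (hD : 0 < D) (hΓ : 0 ≤ Γ) (k : ℕ)
    (hβ : ∀ j < k, D < (evalState rule F reward st a j).beta P)
    (hw : ∀ j < k, widthBound P L d (evalState rule F reward st a j).t ≤ Γ) :
    ArmInvariant P L (evalState rule F reward st a k) ∧
      ∀ i, ((evalState rule F reward st a k).T i : ℝ) ≤
        max (st.T i : ℝ) (evalCoef rule F st a i / D ^ 2 * Γ + 1) := by
  induction k with
  | zero =>
    refine ⟨h.beginEval hg, fun i => ?_⟩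
    by_cases hi : i = st.m
    · refine le_max_of_le_right ?_
      have := evalCoef_nonneg (rule := rule) (F := F) st a i
      simp only [evalState, Function.iterate_zero, id, beginEval, hi, Function.update_self,
        Nat.cast_one, le_add_iff_nonneg_left]
      rw [← hi]
      positivity
    · refine le_max_of_le_left ?_
      simp [evalState, beginEval, Function.update_of_ne hi]
  | succ k ih =>
    obtain ⟨ih1, ih2⟩ := ih (fun j hj => hβ j (hj.trans k.lt_succ_self))
      (fun j hj => hw j (hj.trans k.lt_succ_self))
    obtain ⟨-, -, -, hm, hX, -⟩ :=
      evalState_fields (rule := rule) (F := F) (reward := reward) st a k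
    have hps := ih1.pick_spec rule hlam hd hdelta0 hdelta1 (by omega) hD (hβ k k.lt_succ_self)
    rw [evalState_succ]
    refine ⟨ih1.sampleStep hps.1, fun i => ?_⟩
    by_cases hi : i = rule.pick (evalState rule F reward st a k).m
      (rule.alloc (evalState rule F reward st a k).m (evalState rule F reward st a k).X)
      (evalState rule F reward st a k).T
    -- Before this sample the picked arm obeyed the bound without the `+ 1`, by `pick_spec`; the `+
    -- 1` pays for the sample.
    · refine le_max_of_le_right ?_
      rw [← hi] at hps
      simp only [sampleStep, ← hi, Function.update_self, Nat.cast_add, Nat.cast_one]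
      refine add_le_add (hps.2.trans ?_) le_rfl
      rw [hm, hX]
      exact mul_le_mul_of_nonneg_left (hw k k.lt_succ_self)
        (div_nonneg (evalCoef_nonneg st a i) (by positivity))
    · simp only [sampleStep, Function.update_of_ne hi]
      exact ih2 i

/-- The count bounds are summed over the arms with `Γ` taken at the final time itself. The result is
implicit: the clock also occurs on the right, but only inside a logarithm. -/
lemma evalState_time_le (hlam : 0 < P.lam) (hd : 0 < d) (hdelta0 : 0 < P.delta)
    (hdelta1 : P.delta < 1) {st : LinTGState n d} (h : ArmInvariant P L st) {a : Fin n}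
    (hg : gainVec F st.S a ⬝ᵥ gainVec F st.S a ≤ L ^ 2) {D : ℝ} (hD : 0 < D) (k : ℕ)
    (hβ : ∀ j < k, D < (evalState rule F reward st a j).beta P) :
    ((evalState rule F reward st a k).t : ℝ) ≤ st.t + (st.m + 1 : ℕ) +
      (∑ i ∈ range (st.m + 1), evalCoef rule F st a i / D ^ 2) *
        widthBound P L d (evalState rule F reward st a k).t := by
  set Γ := widthBound P L d (evalState rule F reward st a k).t with hΓd
  have hΓ : 0 ≤ Γ := widthBound_nonneg hlam hdelta0 hdelta1 (Nat.cast_nonneg _)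
  have hf := fun k => evalState_fields (rule := rule) (F := F) (reward := reward) st a k
  obtain ⟨h1, h2⟩ := evalState_count_le (reward := reward) (rule := rule) hlam hd hdelta0 hdelta1 h
    hg hD hΓ k hβ fun j hj => by
      refine widthBound_mono hlam (Nat.cast_nonneg _) ?_
      rw [(hf j).2.2.2.2.2, (hf k).2.2.2.2.2]
      push_cast
      have : (j : ℝ) ≤ k := by exact_mod_cast hj.le
      linarith
  have h3 : ((evalState rule F reward st a k).t : ℝ) =
      ∑ i ∈ range (st.m + 1), ((evalState rule F reward st a k).T i : ℝ) := by
    rw [h1.t_eq, (hf k).2.2.2.1, Nat.cast_sum]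
  have h4 : (st.t : ℝ) = ∑ i ∈ range (st.m + 1), (st.T i : ℝ) := by
    rw [sum_range_succ, h.eq_zero st.m le_rfl, h.t_eq]
    simp
  rw [h3, h4]
  calc _ ≤ ∑ i ∈ range (st.m + 1), ((st.T i : ℝ) + (1 + evalCoef rule F st a i / D ^ 2 * Γ)) := by
        refine sum_le_sum fun i _ => (h2 i).trans (max_le ?_ ?_)
        · have := evalCoef_nonneg (rule := rule) (F := F) st a i
          have : 0 ≤ evalCoef rule F st a i / D ^ 2 * Γ := by positivity
          linarith
        · have : (0 : ℝ) ≤ st.T i := Nat.cast_nonneg _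
          linarith
    _ = _ := by
        rw [sum_add_distrib, sum_add_distrib, sum_mul]
        simp only [sum_const, card_range, nsmul_eq_mul, mul_one, Nat.cast_add, Nat.cast_one]
        ring

/-- Each evaluation terminates, whatever the rewards are. -/
theorem processElement_spec (hlam : 0 < P.lam) (hd : 0 < d) (hdelta0 : 0 < P.delta)
    (hdelta1 : P.delta < 1) (heps : 0 < P.eps') {st : LinTGState n d} (h : ArmInvariant P L st)
    {a : Fin n} (hg : gainVec F st.S a ⬝ᵥ gainVec F st.S a ≤ L ^ 2)
    (hcard : st.S.card < P.kappa) :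
    ∃ k, (∀ j < k, ¬ (evalState rule F reward st a j).Accept P ∧
        ¬ (evalState rule F reward st a j).Reject P) ∧
      ((evalState rule F reward st a k).Accept P ∨ (evalState rule F reward st a k).Reject P) ∧
      processElement P rule F reward st a =
        some (finishEval P st a (evalState rule F reward st a k)) := by
  have hH : 0 ≤ ∑ i ∈ range (st.m + 1), evalCoef rule F st a i / P.eps' ^ 2 :=
    sum_nonneg fun i _ => div_nonneg (evalCoef_nonneg st a i) (by positivity)
  -- Beyond `x₀` the implicit bound with `D = ε'` is contradictory, and `K ≥ x₀` passes push the
  -- clock beyond `x₀`.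
  obtain ⟨x₀, hx₀⟩ := exists_forall_add_mul_log_lt
    (st.t + (st.m + 1 : ℕ) + (∑ i ∈ range (st.m + 1), evalCoef rule F st a i / P.eps' ^ 2) *
      (2 * P.R ^ 2 * (2 * Real.log (2 / P.delta)) + 2 * P.lam * P.S ^ 2))
    (b := (∑ i ∈ range (st.m + 1), evalCoef rule F st a i / P.eps' ^ 2) * (2 * P.R ^ 2 * d))
    (c := L ^ 2 / (P.lam * d)) (by positivity) (by positivity)
  obtain ⟨K, hK⟩ := exists_nat_ge x₀
  obtain ⟨k, -, s, hs, ⟨rfl, hk⟩, hc⟩ := whileLoop_spec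
    (cond := fun s : LinTGState n d => ¬ s.Accept P ∧ ¬ s.Reject P)
    (body := fun s => some (sampleStep rule reward s)) (s₀ := beginEval F reward st a)
    (fun k s => s = evalState rule F reward st a k ∧
      ∀ j < k, ¬ (evalState rule F reward st a j).Accept P ∧
        ¬ (evalState rule F reward st a j).Reject P) ⟨rfl, by simp⟩
    (by
      rintro k s ⟨rfl, h1⟩ hc
      refine ⟨_, rfl, (evalState_succ st a k).symm, fun j hj => ?_⟩
      rcases Nat.lt_succ_iff_lt_or_eq.1 hj with h2 | rfl
      · exact h1 j h2
      · exact hc) K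
    (by
      rintro s ⟨rfl, h1⟩ -
      have h2 := evalState_time_le (reward := reward) (rule := rule) hlam hd hdelta0 hdelta1 h hg heps
        K fun j hj => LinTGState.eps'_lt_beta (h1 j hj).1 (h1 j hj).2
      have ht := (evalState_fields (rule := rule) (F := F) (reward := reward) st a K).2.2.2.2.2
      refine absurd (hx₀ (evalState rule F reward st a K).t ?_) (not_lt.2 (h2.trans (le_of_eq ?_)))
      · refine hK.trans ?_
        rw [ht]
        exact_mod_cast Nat.le_add_left K (st.t + 1)
      · rw [widthBound, mul_div_assoc, mul_comm (L ^ 2 / (P.lam * d))]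
        ring)
  refine ⟨k, hk, ?_, ?_⟩
  · tauto
  · rw [processElement, if_pos hcard, hs, Option.map_some]

/-- The bound on the number of samples of an evaluation, given that the confidence interval is
correct throughout. -/
theorem samples_le_sampleBound (hlam : 0 < P.lam) (hd : 0 < d) (hR : 0 < P.R) (hS : 0 < P.S)
    (hdelta0 : 0 < P.delta) (hdelta1 : P.delta < 1) (heps : 0 < P.eps')
    (hlamS : P.lam ≤ 2 * P.R ^ 2 / P.S ^ 2 * Real.log (2 / P.delta))
    {wt : Fin d → ℝ} {st : LinTGState n d} (h : ArmInvariant P L st)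
    {a : Fin n} (hg : gainVec F st.S a ⬝ᵥ gainVec F st.S a ≤ L ^ 2) {k : ℕ}
    (hk : ∀ j < k, ¬ (evalState rule F reward st a j).Accept P ∧
        ¬ (evalState rule F reward st a j).Reject P)
    (hconf : ∀ j < k, |(evalState rule F reward st a j).x ⬝ᵥ
      (evalState rule F reward st a j).what - (evalState rule F reward st a j).x ⬝ᵥ wt| ≤
        (evalState rule F reward st a j).beta P)
    (e : LinTGEval n d) (he : e = ⟨(evalState rule F reward st a k).m, st.S, a,
      (evalState rule F reward st a k).w, (evalState rule F reward st a k).X, st.T, st.t,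
      (evalState rule F reward st a k).t - st.t⟩) :
    (e.samples : ℝ) ≤ e.sampleBound P rule F wt L := by
  have hf := fun k => evalState_fields (rule := rule) (F := F) (reward := reward) st a k
  rw [(hf k).2.1, (hf k).2.2.2.1, (hf k).2.2.2.2.1] at he
  obtain ⟨D, hDd⟩ : ∃ D, D = max ((P.eps' + |st.w - gainVec F st.S a ⬝ᵥ wt|) / 2) P.eps' := ⟨_, rfl⟩
  have hD : 0 < D := by
    rw [hDd]
    exact lt_max_of_lt_right heps
  -- The true gain lies within one width of the estimate, and neither test succeeds; chaining the
  -- two on the relevant side gives `2β > ε' + |w - gain|`.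
  have hβ : ∀ j < k, D < (evalState rule F reward st a j).beta P := by
    intro j hj
    obtain ⟨h1, h2⟩ := hk j hj
    have h3 := hconf j hj
    have h4 := LinTGState.eps'_lt_beta h1 h2
    unfold LinTGState.Accept at h1
    unfold LinTGState.Reject at h2
    rw [(hf j).2.1] at h1 h2
    rw [evalState_x] at h1 h2 h3
    rw [hDd]
    refine max_lt ?_ h4
    obtain ⟨h5, h6⟩ := abs_le.1 h3
    rw [div_lt_iff₀ two_pos]
    rcases abs_cases (st.w - gainVec F st.S a ⬝ᵥ wt) with ⟨h7, -⟩ | ⟨h7, -⟩ <;> rw [h7] <;> linarith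
  have hH : ∀ i, e.H P rule F wt i = evalCoef rule F st a i / D ^ 2 := by
    intro i
    rw [he, hDd]
    rfl
  have hl := log_two_div_nonneg hdelta0 hdelta1
  -- The condition on `λ` turns the regularization term into a second copy of the confidence term.
  have hlS : 2 * P.lam * P.S ^ 2 ≤ 4 * P.R ^ 2 * Real.log (2 / P.delta) := by
    have h1 := mul_le_mul_of_nonneg_right hlamS (by positivity : 0 ≤ P.S ^ 2)
    have h2 : 2 * P.R ^ 2 / P.S ^ 2 * Real.log (2 / P.delta) * P.S ^ 2 =
      2 * P.R ^ 2 * Real.log (2 / P.delta) := by field_simp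
    linarith
  have hwb : ∀ τ : ℝ, widthBound P L d τ ≤ 4 * P.R ^ 2 * (2 * Real.log (2 / P.delta) +
      d / 2 * Real.log (1 + τ * L ^ 2 / (P.lam * d))) := by
    intro τ
    unfold widthBound
    linarith
  have hH0 : 0 ≤ e.Htot P rule F wt := sum_nonneg fun i _ => by
    rw [hH]
    exact div_nonneg (evalCoef_nonneg st a i) (by positivity)
  have hd1 : (1 : ℝ) ≤ d := by exact_mod_cast hd
  have hem : e.m = st.m + 1 := by rw [he]
  have hHt : e.Htot P rule F wt = ∑ i ∈ range (st.m + 1), evalCoef rule F st a i / D ^ 2 := by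
    rw [LinTGEval.Htot, hem]
    exact sum_congr rfl fun i _ => hH i
  have hM2 : 2 ≤ e.M P rule F wt L := by
    unfold LinTGEval.M
    rw [le_add_iff_nonneg_left]
    positivity
  have hlogM : 0 ≤ Real.log (e.M P rule F wt L) := Real.log_nonneg (by linarith)
  obtain ⟨Γ, hΓd⟩ : ∃ Γ, Γ = 4 * P.R ^ 2 * (2 * Real.log (2 / P.delta) +
    d * Real.log (e.M P rule F wt L)) := ⟨_, rfl⟩
  have hΓ : 0 ≤ Γ := by rw [hΓd]; positivity
  have hw : ∀ j < k, widthBound P L d (evalState rule F reward st a j).t ≤ Γ := by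
    intro j hj
    have h1 := evalState_time_le (reward := reward) (rule := rule) hlam hd hdelta0 hdelta1 h hg hD j
      fun i hi => hβ i (hi.trans hj)
    rw [← hHt] at h1
    have h2 := one_add_le_of_le_add_mul_log (Nat.cast_nonneg _) hH0 hlam hl hd1
      (h1.trans (add_le_add le_rfl (mul_le_mul_of_nonneg_left (hwb _) hH0)))
    have h3 : 16 * e.Htot P rule F wt * P.R ^ 2 * L ^ 2 / P.lam * Real.log (2 / P.delta) +
        32 * e.Htot P rule F wt ^ 2 * P.R ^ 4 * L ^ 4 / P.lam ^ 2 +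
        2 * ((st.t : ℝ) + (st.m + 1 : ℕ)) * L ^ 2 / (P.lam * d) + 2 = e.M P rule F wt L := by
      unfold LinTGEval.M
      rw [hem, he]
    rw [h3] at h2
    refine (hwb _).trans ?_
    rw [hΓd]
    have h4 : Real.log (1 + (evalState rule F reward st a j).t * L ^ 2 / (P.lam * d)) ≤
        Real.log (e.M P rule F wt L) :=
      Real.log_le_log (add_pos_of_pos_of_nonneg one_pos (by positivity)) h2
    have h5 : (d : ℝ) / 2 * Real.log (1 + (evalState rule F reward st a j).t * L ^ 2 / (P.lam * d)) ≤
        d * Real.log (e.M P rule F wt L) :=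
      (mul_le_mul_of_nonneg_left h4 (by positivity)).trans
        (mul_le_mul_of_nonneg_right (by linarith) hlogM)
    gcongr
  obtain ⟨h1, h2⟩ := evalState_count_le (reward := reward) (rule := rule) hlam hd hdelta0 hdelta1 h
    hg hD hΓ k hβ hw
  have h3 : (evalState rule F reward st a k).t =
      ∑ i ∈ range (st.m + 1), (evalState rule F reward st a k).T i := by
    rw [h1.t_eq, (hf k).2.2.2.1]
  have h4 : st.t = ∑ i ∈ range (st.m + 1), st.T i := by
    rw [sum_range_succ, h.eq_zero st.m le_rfl, h.t_eq, add_zero]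
  have h5 : st.t ≤ (evalState rule F reward st a k).t := by
    rw [(hf k).2.2.2.2.2]
    omega
  have h6 : (e.samples : ℝ) = ((evalState rule F reward st a k).t : ℝ) - st.t := by
    rw [he]
    exact Nat.cast_sub h5
  rw [h6, h3, h4, LinTGEval.sampleBound, hem, Nat.cast_sum, Nat.cast_sum, ← sum_sub_distrib]
  refine sum_le_sum fun i _ => ?_
  have h7 : 4 * e.H P rule F wt i * P.R ^ 2 * (2 * Real.log (2 / P.delta) +
      d * Real.log (e.M P rule F wt L)) + 1 - e.N i =
      evalCoef rule F st a i / D ^ 2 * Γ + 1 - st.T i := by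
    rw [hH, hΓd]
    rw [show e.N = st.T by rw [he]]
    ring
  rw [h7]
  rcases le_max_iff.1 (h2 i) with h8 | h8
  · exact le_max_of_le_right (by linarith)
  · exact le_max_of_le_left (by linarith)

end EvaluationLoop

/-! ### Adaptedness of the run, one sample at a time. -/

/-- A run of the algorithm, cut into single samples: the state, what is to be sampled next (`none`
if no more samples are taken, `(true, a)` for the first sample in an evaluation of `a`, and
`(false, a)` for a further one), and the elements that remain after `a` in the round. -/
structure RunConfig (n d : ℕ) where
  act : Option (Bool × Fin n)
  st : LinTGState n d
  todo : List (Fin n)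

namespace RunConfig

variable {n d : ℕ}

/-- The feature of the next sample. -/
noncomputable def feature (rule : LinTGRule d) (F : Finset (Fin n) → Fin d → ℝ)
    (c : RunConfig n d) : Fin d → ℝ :=
  match c.act with
  | none => 0
  | some (true, a) => gainVec F c.st.S a
  | some (false, _) => c.st.X (rule.pick c.st.m (rule.alloc c.st.m c.st.X) c.st.T)

/-- The configuration after the next sample. -/
noncomputable def sample (rule : LinTGRule d) (F : Finset (Fin n) → Fin d → ℝ)
    (reward : ℕ → (Fin d → ℝ) → ℝ) (c : RunConfig n d) : RunConfig n d :=
  match c.act with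
  | none => c
  | some (true, a) => { c with st := beginEval F reward c.st a }
  | some (false, _) => { c with st := sampleStep rule reward c.st }

open Classical in
/-- The configuration between two evaluations; `ok` says whether a new round may begin. -/
noncomputable def resume (P : LinTGParams) (ok : Prop) (st : LinTGState n d)
    (todo : List (Fin n)) : RunConfig n d :=
  if P.kappa ≤ st.S.card then ⟨none, st, todo⟩
  else match todo with
    | a :: l => ⟨some (true, a), st, l⟩
    | [] => if ok then
        match List.finRange n with
        | a :: l => ⟨some (true, a), st, l⟩
        | [] => ⟨none, st, []⟩
      else ⟨none, st, []⟩

open Classical in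
/-- Decision after a sample, given the outcomes of the tests. -/
noncomputable def decideWith (P : LinTGParams) (acc rej ok : Prop) (c : RunConfig n d) :
    RunConfig n d :=
  match c.act with
  | none => c
  | some (_, a) =>
    if ¬ acc ∧ ¬ rej then { c with act := some (false, a) }
    else resume P ok { c.st with
      S := if acc then insert a c.st.S else c.st.S
      w := if c.todo = [] then (1 - P.alpha) * c.st.w else c.st.w } c.todo

/-- Decision after a sample, where `θ` is the least threshold. -/
noncomputable def decide (P : LinTGParams) (θ : ℝ) (c : RunConfig n d) : RunConfig n d :=
  c.decideWith P (c.st.Accept P) (c.st.Reject P) (θ < (1 - P.alpha) * c.st.w)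

/-- The part of a configuration that does not depend continuously on the rewards. -/
def discrete (c : RunConfig n d) : RunConfig n d :=
  { c with st := { c.st with b := 0, w := 0 } }

open Classical in
/-- The threshold after a decision. -/
noncomputable def nextThreshold (P : LinTGParams) (acc rej : Prop) (act : Option (Bool × Fin n))
    (todo : List (Fin n)) (w : ℝ) : ℝ :=
  if act ≠ none ∧ (acc ∨ rej) ∧ todo = [] then (1 - P.alpha) * w else w

lemma resume_st (P : LinTGParams) (ok : Prop) (st : LinTGState n d) (todo : List (Fin n)) :
    (resume P ok st todo).st = st := by
  unfold resume
  repeat' split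
  all_goals rfl

lemma discrete_resume (P : LinTGParams) (ok : Prop) (st : LinTGState n d) (todo : List (Fin n)) :
    (resume P ok st todo).discrete = (resume P ok { st with b := 0, w := 0 } todo).discrete := by
  unfold resume
  dsimp only
  repeat' split
  all_goals rfl

/-- Once the outcomes of the tests are given as propositions, `b` and `w` no longer influence the
discrete part. -/
lemma discrete_decideWith (P : LinTGParams) (acc rej ok : Prop) (c : RunConfig n d) :
    (c.decideWith P acc rej ok).discrete = (c.discrete.decideWith P acc rej ok).discrete := by
  classical
  obtain ⟨act, st, todo⟩ := c
  rcases act with _ | ⟨b, a⟩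
  · rfl
  · simp only [decideWith, discrete]
    split
    · rfl
    · exact (discrete_resume _ _ _ _).trans (discrete_resume P ok { st with
        S := if acc then insert a st.S else st.S
        b := 0
        w := if todo = [] then (1 - P.alpha) * 0 else 0 } todo).symm

lemma decideWith_b (P : LinTGParams) (acc rej ok : Prop) (c : RunConfig n d) :
    (c.decideWith P acc rej ok).st.b = c.st.b := by
  obtain ⟨act, st, todo⟩ := c
  rcases act with _ | ⟨b, a⟩
  · rfl
  · simp only [decideWith]
    split
    · rfl
    · rw [resume_st]

lemma decideWith_w (P : LinTGParams) (acc rej ok : Prop) (c : RunConfig n d) :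
    (c.decideWith P acc rej ok).st.w = nextThreshold P acc rej c.act c.todo c.st.w := by
  classical
  obtain ⟨act, st, todo⟩ := c
  rcases act with _ | ⟨b, a⟩
  · simp [decideWith, nextThreshold]
  · simp only [decideWith, nextThreshold]
    by_cases h : ¬ acc ∧ ¬ rej
    · rw [if_pos h, if_neg (by tauto)]
    · rw [if_neg h, resume_st]
      have h' : acc ∨ rej := by tauto
      simp [h']

lemma discrete_sample (rule : LinTGRule d) (F : Finset (Fin n) → Fin d → ℝ)
    (reward : ℕ → (Fin d → ℝ) → ℝ) (c : RunConfig n d) :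
    (c.sample rule F reward).discrete = (c.discrete.sample rule F 0).discrete := by
  obtain ⟨act, st, todo⟩ := c
  rcases act with _ | ⟨b, a⟩
  · rfl
  · cases b <;> rfl

lemma sample_b (rule : LinTGRule d) (F : Finset (Fin n) → Fin d → ℝ)
    (r : (Fin d → ℝ) → ℝ) (c : RunConfig n d) :
    (c.sample rule F fun _ => r).st.b =
      c.st.b + r (c.discrete.feature rule F) • c.discrete.feature rule F := by
  obtain ⟨act, st, todo⟩ := c
  rcases act with _ | ⟨b, a⟩
  · simp [sample, feature, discrete]
  · cases b <;> rfl

lemma sample_w (rule : LinTGRule d) (F : Finset (Fin n) → Fin d → ℝ)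
    (r : ℕ → (Fin d → ℝ) → ℝ) (c : RunConfig n d) :
    (c.sample rule F r).st.w = c.st.w := by
  obtain ⟨act, st, todo⟩ := c
  rcases act with _ | ⟨b, a⟩
  · rfl
  · cases b <;> rfl

variable {Ω : Type*}

/-- A random configuration is determined by the information in `m`. -/
structure IsAdapted (m : MeasurableSpace Ω) (C : Ω → RunConfig n d) : Prop where
  discrete : @Measurable _ _ m ⊤ fun ω => (C ω).discrete
  b : Measurable[m] fun ω => (C ω).st.b
  w : Measurable[m] fun ω => (C ω).st.w

/-- A preimage splits along the event, so measurability survives even for the full power set as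
target σ-algebra. With that σ-algebra, the tie-breaking rules need no measurability. -/
lemma measurable_prop_prod {α : Type*} {m : MeasurableSpace Ω} {f : Ω → α} {p : Ω → Prop}
    (hf : @Measurable _ _ m ⊤ f) (hp : MeasurableSet[m] {ω | p ω}) :
    @Measurable _ _ m ⊤ fun ω => (f ω, p ω) := by
  intro B _
  have : (fun ω => (f ω, p ω)) ⁻¹' B = (f ⁻¹' {x | (x, True) ∈ B} ∩ {ω | p ω}) ∪
      (f ⁻¹' {x | (x, False) ∈ B} ∩ {ω | p ω}ᶜ) := by
    ext ω
    by_cases h : p ω <;> simp [h]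
  rw [this]
  exact ((hf trivial).inter hp).union ((hf trivial).inter hp.compl)

namespace IsAdapted

variable {m : MeasurableSpace Ω} {C : Ω → RunConfig n d}

lemma mono {m' : MeasurableSpace Ω} (h : IsAdapted m C) (hm : m ≤ m') : IsAdapted m' C :=
  ⟨h.discrete.mono hm le_rfl, h.b.mono hm le_rfl, h.w.mono hm le_rfl⟩

lemma comp_discrete (h : IsAdapted m C) {β : Type*} {mβ : MeasurableSpace β}
    (f : RunConfig n d → β) : Measurable[m] fun ω => f (C ω).discrete :=
  (@measurable_from_top _ _ _ f).comp h.discrete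

lemma feature (h : IsAdapted m C) (rule : LinTGRule d) (F : Finset (Fin n) → Fin d → ℝ) :
    Measurable[m] fun ω => (C ω).feature rule F :=
  h.comp_discrete fun c => c.feature rule F

lemma sample (h : IsAdapted m C) (rule : LinTGRule d) (F : Finset (Fin n) → Fin d → ℝ)
    (wt : Fin d → ℝ) {e : Ω → ℝ} (he : Measurable[m] e) :
    IsAdapted m fun ω => (C ω).sample rule F fun _ x => x ⬝ᵥ wt + e ω := by
  refine ⟨?_, ?_, ?_⟩
  · rw [funext fun ω => discrete_sample rule F (fun _ x => x ⬝ᵥ wt + e ω) (C ω)]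
    exact @Measurable.comp _ _ _ _ ⊤ ⊤ (fun c => (c.sample rule F 0).discrete) _
      (@measurable_from_top _ _ ⊤ _) h.discrete
  · simp only [sample_b]
    have h1 : Measurable[m] fun ω => (C ω).discrete.feature rule F := h.comp_discrete _
    have h2 : Measurable[m] fun ω => (C ω).discrete.feature rule F ⬝ᵥ wt :=
      h.comp_discrete fun c => c.feature rule F ⬝ᵥ wt
    exact h.b.add ((h2.add he).smul h1)
  · simpa only [sample_w] using h.w

lemma measurable_x_dotProduct_what (h : IsAdapted m C) :
    Measurable[m] fun ω => (C ω).st.x ⬝ᵥ (C ω).st.what :=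
  measurable_dotProduct_mulVec (B := fun ω => (C ω).st.A⁻¹)
    (fun i j => h.comp_discrete fun c => c.st.A⁻¹ i j) (h.comp_discrete fun c => c.st.x) h.b

lemma measurableSet_accept (h : IsAdapted m C) (P : LinTGParams) :
    MeasurableSet[m] {ω | (C ω).st.Accept P} :=
  measurableSet_le (h.w.sub_const _)
    (h.measurable_x_dotProduct_what.sub (h.comp_discrete fun c => c.st.beta P))

lemma measurableSet_reject (h : IsAdapted m C) (P : LinTGParams) :
    MeasurableSet[m] {ω | (C ω).st.Reject P} :=
  measurableSet_le (h.measurable_x_dotProduct_what.add (h.comp_discrete fun c => c.st.beta P))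
    (h.w.add_const _)

/-- The next discrete part is a function of the present one and of three events, each a comparison
of measurable reals. -/
lemma decide (h : IsAdapted m C) (P : LinTGParams) {θ : Ω → ℝ} (hθ : Measurable[m] θ) :
    IsAdapted m fun ω => (C ω).decide P (θ ω) := by
  have h1 := measurable_prop_prod h.discrete (h.measurableSet_accept P)
  have h2 := measurable_prop_prod h1 (h.measurableSet_reject P)
  have h3 := measurable_prop_prod h2
    (show MeasurableSet[m] {ω | θ ω < (1 - P.alpha) * (C ω).st.w} from
      measurableSet_lt hθ (h.w.const_mul _))
  refine ⟨?_, ?_, ?_⟩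
  · simp only [RunConfig.decide]
    rw [funext fun ω => discrete_decideWith P ((C ω).st.Accept P) ((C ω).st.Reject P)
      (θ ω < (1 - P.alpha) * (C ω).st.w) (C ω)]
    exact @Measurable.comp _ _ _ _ ⊤ ⊤
      (fun p : ((RunConfig n d × Prop) × Prop) × Prop =>
        (p.1.1.1.decideWith P p.1.1.2 p.1.2 p.2).discrete) _ (@measurable_from_top _ _ ⊤ _) h3
  · simpa only [RunConfig.decide, decideWith_b] using h.b
  · simp only [RunConfig.decide, decideWith_w, nextThreshold]
    refine Measurable.ite ?_ (h.w.const_mul _) h.w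
    exact @h2 {p | p.1.1.act ≠ none ∧ (p.1.2 ∨ p.2) ∧ p.1.1.todo = []} trivial

end IsAdapted

end RunConfig

/-! ### The features of the run are predictable. -/

section RunProcess

variable {n d : ℕ}

/-- The threshold at which the algorithm stops. -/
noncomputable def finalThreshold (P : LinTGParams) (F : Finset (Fin n) → Fin d → ℝ)
    (reward : ℕ → (Fin d → ℝ) → ℝ) : ℝ :=
  P.alpha * gmax P F reward / P.kappa

/-- The configuration before the sample number `n * N0 + j`. -/
noncomputable def runConfig (P : LinTGParams) (rule : LinTGRule d)
    (F : Finset (Fin n) → Fin d → ℝ) (reward : ℕ → (Fin d → ℝ) → ℝ) : ℕ → RunConfig n d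
  | 0 => .resume P (finalThreshold P F reward < gmax P F reward) (initState P F reward) []
  | j + 1 => ((runConfig P rule F reward j).sample rule F fun _ => reward (n * P.N0 n + j)).decide P
      (finalThreshold P F reward)

/-- The feature of the sample number `t`. -/
noncomputable def runFeature (P : LinTGParams) (rule : LinTGRule d)
    (F : Finset (Fin n) → Fin d → ℝ) (reward : ℕ → (Fin d → ℝ) → ℝ) (t : ℕ) : Fin d → ℝ :=
  if h : t / P.N0 n < n then F {⟨t / P.N0 n, h⟩}
  else (runConfig P rule F reward (t - n * P.N0 n)).feature rule F

variable {Ω : Type*} {ξ : ℕ → Ω → ℝ} {wt : Fin d → ℝ} {P : LinTGParams}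
  {F : Finset (Fin n) → Fin d → ℝ}

lemma measurable_fhat (a : Fin n) : Measurable[pastSigma ξ (n * P.N0 n)]
    fun ω => fhat P F (fun t x => x ⬝ᵥ wt + ξ t ω) a := by
  unfold fhat
  refine Measurable.div_const (Finset.measurable_sum _ fun k hk => ?_) _
  refine Measurable.const_add (measurable_pastSigma ξ ?_) _
  have h1 := mem_range.1 hk
  calc (a : ℕ) * P.N0 n + k < (a : ℕ) * P.N0 n + P.N0 n := by omega
    _ = (a + 1) * P.N0 n := by ring
    _ ≤ n * P.N0 n := Nat.mul_le_mul_right _ a.2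

lemma measurable_gmax : Measurable[pastSigma ξ (n * P.N0 n)]
    fun ω => gmax P F (fun t x => x ⬝ᵥ wt + ξ t ω) :=
  Measurable.iSup fun a => measurable_fhat a

lemma isAdapted_runConfig (rule : LinTGRule d) (j : ℕ) :
    RunConfig.IsAdapted (pastSigma ξ (n * P.N0 n + j))
      fun ω => runConfig P rule F (fun t x => x ⬝ᵥ wt + ξ t ω) j := by
  have hg := measurable_gmax (ξ := ξ) (wt := wt) (P := P) (F := F)
  have hθ : Measurable[pastSigma ξ (n * P.N0 n)]
      fun ω => finalThreshold P F (fun t x => x ⬝ᵥ wt + ξ t ω) := (hg.const_mul _).div_const _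
  induction j with
  | zero =>
    refine ⟨?_, ?_, ?_⟩
    · simp only [runConfig]
      rw [funext fun ω => RunConfig.discrete_resume P _ (initState P F fun t x => x ⬝ᵥ wt + ξ t ω) []]
      have h1 := RunConfig.measurable_prop_prod (Ω := Ω) (m := pastSigma ξ (n * P.N0 n))
        (f := fun _ => ()) (@measurable_const _ _ ⊤ _ _) (measurableSet_lt hθ hg)
      exact @Measurable.comp _ _ _ _ ⊤ ⊤
        (fun p : Unit × Prop => (RunConfig.resume P p.2
          { initState P F (fun _ _ => 0) with b := 0, w := 0 } []).discrete) _
        (@measurable_from_top _ _ ⊤ _) h1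
    · simp only [runConfig, RunConfig.resume_st, initState]
      exact Finset.measurable_sum _ fun a _ => ((measurable_fhat a).const_mul _).smul_const _
    · simp only [runConfig, RunConfig.resume_st, initState]
      exact hg
  | succ j ih =>
    have hm : pastSigma ξ (n * P.N0 n + j) ≤ pastSigma ξ (n * P.N0 n + (j + 1)) :=
      pastSigma_mono ξ (by omega)
    exact ((ih.mono hm).sample rule F wt (measurable_pastSigma ξ (by omega))).decide P
      (hθ.mono (pastSigma_mono ξ (by omega)) le_rfl)

/-- Initial features are constants; each later one is a function of the discrete part of the
configuration reached after `t` samples. -/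
lemma measurable_runFeature (hN : 0 < P.N0 n) (rule : LinTGRule d) (t : ℕ) :
    Measurable[pastSigma ξ t]
      fun ω => runFeature P rule F (fun s x => x ⬝ᵥ wt + ξ s ω) t := by
  unfold runFeature
  split_ifs with h
  · exact measurable_const
  · rw [Nat.div_lt_iff_lt_mul hN, not_lt] at h
    have := (isAdapted_runConfig (ξ := ξ) (wt := wt) (P := P) (F := F) rule
      (t - n * P.N0 n)).feature rule F
    rwa [Nat.add_sub_cancel' h] at this

end RunProcess

/-! ### The algorithm follows the replayed run, and its confidence intervals are correct. -/

section Simulation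

variable {n d : ℕ} {P : LinTGParams} {rule : LinTGRule d} {F : Finset (Fin n) → Fin d → ℝ}
  {reward : ℕ → (Fin d → ℝ) → ℝ}

/-- A state without the record of the evaluations. -/
def LinTGState.core (st : LinTGState n d) : LinTGState n d := { st with evals := [] }

/-- The matrix and the vector of a state come from the samples of the run. -/
structure RunHistory (P : LinTGParams) (rule : LinTGRule d) (F : Finset (Fin n) → Fin d → ℝ)
    (reward : ℕ → (Fin d → ℝ) → ℝ) (st : LinTGState n d) : Prop where
  A_eq : st.A = P.lam • (1 : Matrix (Fin d) (Fin d) ℝ) + ∑ s ∈ range st.t,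
    vecMulVec (runFeature P rule F reward s) (runFeature P rule F reward s)
  b_eq : st.b = ∑ s ∈ range st.t,
    reward s (runFeature P rule F reward s) • runFeature P rule F reward s

/-- The state `st` belongs to the evaluation of `a`, with `todo` remaining in the round. -/
def InEval (P : LinTGParams) (rule : LinTGRule d) (F : Finset (Fin n) → Fin d → ℝ)
    (reward : ℕ → (Fin d → ℝ) → ℝ) (st : LinTGState n d) (a : Fin n) (todo : List (Fin n)) : Prop :=
  ∃ j, st.t = n * P.N0 n + j ∧ runConfig P rule F reward j =
    RunConfig.decide P (finalThreshold P F reward) ⟨some (false, a), st.core, todo⟩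

/-- The state `st` lies between two evaluations, with `todo` remaining in the round, unless the
solution is full. -/
def Idle (P : LinTGParams) (rule : LinTGRule d) (F : Finset (Fin n) → Fin d → ℝ)
    (reward : ℕ → (Fin d → ℝ) → ℝ) (st : LinTGState n d) (todo : List (Fin n)) : Prop :=
  P.kappa ≤ st.S.card ∨ ∃ j, st.t = n * P.N0 n + j ∧ runConfig P rule F reward j =
    RunConfig.resume P (finalThreshold P F reward < st.w) st.core todo

/-- As `Idle`, but with the threshold already decreased at the end of a round. -/
def IdleRest (P : LinTGParams) (rule : LinTGRule d) (F : Finset (Fin n) → Fin d → ℝ)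
    (reward : ℕ → (Fin d → ℝ) → ℝ) (st : LinTGState n d) (todo : List (Fin n)) : Prop :=
  (todo ≠ [] → Idle P rule F reward st todo) ∧
    (todo = [] → Idle P rule F reward { st with w := (1 - P.alpha) * st.w } [])

lemma runFeature_add (hN : 0 < P.N0 n) (j : ℕ) :
    runFeature P rule F reward (n * P.N0 n + j) = (runConfig P rule F reward j).feature rule F := by
  have : ¬ (n * P.N0 n + j) / P.N0 n < n := by
    rw [Nat.div_lt_iff_lt_mul hN]
    omega
  rw [runFeature, dif_neg this, Nat.add_sub_cancel_left]

lemma RunHistory.succ {st st' : LinTGState n d} (h : RunHistory P rule F reward st) {x : Fin d → ℝ}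
    (hx : runFeature P rule F reward st.t = x) (hA : st'.A = st.A + vecMulVec x x)
    (hb : st'.b = st.b + reward st.t x • x) (ht : st'.t = st.t + 1) :
    RunHistory P rule F reward st' := by
  constructor
  · rw [hA, ht, sum_range_succ, h.A_eq, hx, add_assoc]
  · rw [hb, ht, sum_range_succ, ← h.b_eq, hx]

lemma RunConfig.resume_cons {ok : Prop} {st : LinTGState n d} {a : Fin n} {l : List (Fin n)}
    (h : st.S.card < P.kappa) : RunConfig.resume P ok st (a :: l) = ⟨some (true, a), st, l⟩ := by
  rw [RunConfig.resume, if_neg (not_le.2 h)]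

/-- Resuming with an empty list already opens the next round when the threshold permits it, so both
lists lead to the same configuration. -/
lemma Idle.new_round {st : LinTGState n d} (hn : 0 < n) (h : Idle P rule F reward st [])
    (hw : finalThreshold P F reward < st.w) : Idle P rule F reward st (List.finRange n) := by
  rcases h with h | ⟨j, h1, h2⟩
  · exact Or.inl h
  · by_cases hc : P.kappa ≤ st.S.card
    · exact Or.inl hc
    · refine Or.inr ⟨j, h1, h2.trans ?_⟩
      have : n ≠ 0 := hn.ne'
      obtain ⟨a, l, hl⟩ := List.exists_cons_of_ne_nil (l := List.finRange n) (by simpa using this)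
      have hc' : ¬ P.kappa ≤ st.core.S.card := hc
      simp only [RunConfig.resume, if_neg hc', hl, if_pos hw]

lemma Idle.begin (hN : 0 < P.N0 n) {st : LinTGState n d} {a : Fin n} {l : List (Fin n)}
    (h : Idle P rule F reward st (a :: l)) (hcard : st.S.card < P.kappa)
    (hh : RunHistory P rule F reward st) :
    InEval P rule F reward (beginEval F reward st a) a l ∧
      RunHistory P rule F reward (beginEval F reward st a) := by
  rcases h with h | ⟨j, h1, h2⟩
  · omega
  · rw [RunConfig.resume_cons (st := st.core) hcard] at h2
    constructor
    · refine ⟨j + 1, by simp [beginEval, LinTGState.observe, h1, add_assoc], ?_⟩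
      rw [runConfig, h2, ← h1]
      rfl
    · refine hh.succ (x := gainVec F st.S a) ?_ rfl rfl rfl
      rw [h1, runFeature_add hN, h2]
      rfl

lemma InEval.sampleStep (hN : 0 < P.N0 n) {st : LinTGState n d} {a : Fin n} {l : List (Fin n)}
    (h : InEval P rule F reward st a l) (hA : ¬ st.Accept P) (hR : ¬ st.Reject P)
    (hh : RunHistory P rule F reward st) :
    InEval P rule F reward (sampleStep rule reward st) a l ∧
      RunHistory P rule F reward (sampleStep rule reward st) := by
  obtain ⟨j, h1, h2⟩ := h
  have h3 : runConfig P rule F reward j = ⟨some (false, a), st.core, l⟩ := by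
    rw [h2]
    unfold RunConfig.decide RunConfig.decideWith
    exact if_pos ⟨hA, hR⟩
  constructor
  · refine ⟨j + 1, by simp [_root_.sampleStep, LinTGState.observe, h1, add_assoc], ?_⟩
    rw [runConfig, h3, ← h1]
    rfl
  · refine hh.succ (x := st.X (rule.pick st.m (rule.alloc st.m st.X) st.T)) ?_ rfl rfl rfl
    rw [h1, runFeature_add hN, h3]
    rfl

/-- The replay lowers the threshold together with the last decision of a round, the algorithm only
after the fold; `IdleRest` bridges this difference. -/
lemma InEval.finish {old st : LinTGState n d} {a : Fin n} {l : List (Fin n)}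
    (h : InEval P rule F reward st a l) (hAR : st.Accept P ∨ st.Reject P) :
    IdleRest P rule F reward (finishEval P old a st) l := by
  classical
  obtain ⟨j, h1, h2⟩ := h
  have h3 : runConfig P rule F reward j = RunConfig.resume P
      (finalThreshold P F reward < (1 - P.alpha) * st.w) { st.core with
        S := if st.Accept P then insert a st.S else st.S
        w := if l = [] then (1 - P.alpha) * st.w else st.w } l := by
    rw [h2]
    unfold RunConfig.decide RunConfig.decideWith
    have : ¬ (¬ st.Accept P ∧ ¬ st.Reject P) := by tauto
    exact if_neg this
  constructor
  · intro hl
    obtain ⟨a', l', rfl⟩ := List.exists_cons_of_ne_nil hl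
    by_cases hc : P.kappa ≤ (finishEval P old a st).S.card
    · exact Or.inl hc
    · refine Or.inr ⟨j, h1, ?_⟩
      rw [h3, if_neg hl]
      exact (RunConfig.resume_cons (st := (finishEval P old a st).core) (not_le.1 hc)).trans
        (RunConfig.resume_cons (st := (finishEval P old a st).core) (not_le.1 hc)).symm
  · rintro rfl
    exact Or.inr ⟨j, h1, h3⟩

lemma evalState_inEval (hN : 0 < P.N0 n) {st : LinTGState n d} {a : Fin n} {l : List (Fin n)}
    (h : Idle P rule F reward st (a :: l)) (hcard : st.S.card < P.kappa)
    (hh : RunHistory P rule F reward st) (k : ℕ)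
    (hk : ∀ j < k, ¬ (evalState rule F reward st a j).Accept P ∧
      ¬ (evalState rule F reward st a j).Reject P) :
    InEval P rule F reward (evalState rule F reward st a k) a l ∧
      RunHistory P rule F reward (evalState rule F reward st a k) := by
  induction k with
  | zero => exact h.begin hN hcard hh
  | succ k ih =>
    obtain ⟨h1, h2⟩ := ih fun j hj => hk j (hj.trans k.lt_succ_self)
    obtain ⟨h3, h4⟩ := hk k k.lt_succ_self
    rw [evalState_succ]
    exact h1.sampleStep hN h3 h4 h2

lemma sum_range_mul_eq {M : Type*} [AddCommMonoid M] (m N : ℕ) (f : ℕ → M) :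
    ∑ s ∈ range (m * N), f s = ∑ a : Fin m, ∑ k ∈ range N, f (a * N + k) := by
  rw [← Finset.sum_range fun a => ∑ k ∈ range N, f (a * N + k)]
  induction m with
  | zero => simp
  | succ m ih => rw [Nat.succ_mul, sum_range_add, ih, sum_range_succ]

lemma runFeature_initial (a : Fin n) {k : ℕ} (hk : k < P.N0 n) :
    runFeature P rule F reward (a * P.N0 n + k) = F {a} := by
  have h : (a * P.N0 n + k) / P.N0 n = a := by
    rw [mul_comm, Nat.mul_add_div (by omega), Nat.div_eq_of_lt hk, add_zero]
  rw [runFeature, dif_pos (by rw [h]; exact a.2)]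
  congr 2
  exact Fin.ext h

lemma runHistory_initState : RunHistory P rule F reward (initState P F reward) := by
  constructor
  · simp only [initState, sum_range_mul_eq]
    congr 1
    refine sum_congr rfl fun a _ => ?_
    rw [sum_congr rfl fun k hk => by rw [runFeature_initial a (mem_range.1 hk)]]
    simp [Nat.cast_smul_eq_nsmul]
  · simp only [initState, sum_range_mul_eq]
    refine sum_congr rfl fun a _ => ?_
    rw [sum_congr rfl fun k hk => by rw [runFeature_initial a (mem_range.1 hk)], ← sum_smul]
    congr 1
    rcases Nat.eq_zero_or_pos (P.N0 n) with h | h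
    · simp [h]
    · rw [fhat, mul_div_cancel₀]
      positivity

lemma idle_initState : Idle P rule F reward (initState P F reward) [] :=
  Or.inr ⟨0, rfl, rfl⟩

lemma armInvariant_initState {L : ℝ} (hN : 0 < P.N0 n)
    (hF : ∀ a : Fin n, F {a} ⬝ᵥ F {a} ≤ L ^ 2) : ArmInvariant P L (initState P F reward) := by
  constructor
  · simp only [initState]
    rw [Finset.sum_range]
    simp
  · intro i hi
    have hi' : i < n := hi
    simp only [initState, if_pos hi']
    exact hN
  · intro i hi
    have hi' : ¬ i < n := not_lt.2 hi
    simp [initState, hi']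
  · intro i hi
    have hi' : i < n := hi
    simpa [initState, hi'] using hF _
  · simp only [initState]
    rw [Finset.sum_range]
    simp

/-- The confidence intervals are correct if the noise satisfies the self-normalized bound. -/
theorem abs_dotProduct_what_sub_le {Ω : Type*} {ξ : ℕ → Ω → ℝ} {wt : Fin d → ℝ} {ω : Ω}
    (hlam : 0 < P.lam) (hdelta0 : 0 < P.delta) (hR : 0 < P.R)
    (hwtS : ‖WithLp.toLp 2 wt‖ ≤ P.S)
    (hω : ∀ t, noiseSum ξ (fun t ω => runFeature P rule F (fun s x => x ⬝ᵥ wt + ξ s ω) t) t ω ⬝ᵥ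
      ((gramMatrix P.lam (fun t ω => runFeature P rule F (fun s x => x ⬝ᵥ wt + ξ s ω) t) t ω)⁻¹ *ᵥ
        noiseSum ξ (fun t ω => runFeature P rule F (fun s x => x ⬝ᵥ wt + ξ s ω) t) t ω) ≤
      2 * P.R ^ 2 * Real.log (√((gramMatrix P.lam
        (fun t ω => runFeature P rule F (fun s x => x ⬝ᵥ wt + ξ s ω) t) t ω).det / P.lam ^ d) /
          (P.delta / 2)))
    {st : LinTGState n d} (h : RunHistory P rule F (fun s x => x ⬝ᵥ wt + ξ s ω) st) :
    |st.x ⬝ᵥ st.what - st.x ⬝ᵥ wt| ≤ st.beta P := by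
  set φ : ℕ → Ω → Fin d → ℝ := fun t ω => runFeature P rule F (fun s x => x ⬝ᵥ wt + ξ s ω) t with hφ
  have hA : st.A = gramMatrix P.lam φ st.t ω := h.A_eq
  have hpd : st.A.PosDef := by
    rw [hA]
    exact gramMatrix_posDef hlam _ _ _
  specialize hω st.t
  rw [← hA] at hω
  set s := noiseSum ξ φ st.t ω with hs
  set x := st.x with hx
  -- Hence the estimation error is `A⁻¹ s - λ A⁻¹ w*`: noise plus regularization bias, each bounded
  -- by Cauchy–Schwarz.
  have hb : st.b = s + st.A *ᵥ wt - P.lam • wt := by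
    rw [h.b_eq, h.A_eq, hs, noiseSum, add_mulVec, smul_mulVec, one_mulVec, sum_mulVec,
      add_sub_assoc, add_sub_cancel_left, ← sum_add_distrib]
    refine sum_congr rfl fun i _ => ?_
    rw [vecMulVec_mulVec_real, add_smul, add_comm]
  have hwhat : x ⬝ᵥ st.what - x ⬝ᵥ wt = x ⬝ᵥ (st.A⁻¹ *ᵥ s) - P.lam * (x ⬝ᵥ (st.A⁻¹ *ᵥ wt)) := by
    rw [LinTGState.what, hb, mulVec_sub, mulVec_add, hpd.inv_mulVec_mulVec, mulVec_smul,
      dotProduct_sub, dotProduct_add, dotProduct_smul, smul_eq_mul]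
    ring
  have hcs := fun y => Real.abs_le_sqrt (hpd.inv_dotProduct_sq_le x y)
  have hw : wt ⬝ᵥ (st.A⁻¹ *ᵥ wt) ≤ P.S ^ 2 / P.lam := by
    rw [h.A_eq]
    refine (inv_dotProduct_le_of_add_posSemidef hlam
      (posSemidef_sum _ fun _ _ => posSemidef_vecMulVec_self_real _) wt).trans ?_
    rw [dotProduct_self_eq_norm_sq]
    gcongr
  have hS : 0 ≤ P.S := (norm_nonneg _).trans hwtS
  have hwS : √(wt ⬝ᵥ (st.A⁻¹ *ᵥ wt)) ≤ P.S / √P.lam := by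
    refine (Real.sqrt_le_sqrt hw).trans ?_
    rw [Real.sqrt_div (sq_nonneg _), Real.sqrt_sq hS]
  have hsR : √(s ⬝ᵥ (st.A⁻¹ *ᵥ s)) ≤ P.R * √(2 * Real.log (2 * st.A.det ^ (1 / 2 : ℝ) *
      (P.lam • (1 : Matrix (Fin d) (Fin d) ℝ)).det ^ (-(1 / 2) : ℝ) / P.delta)) := by
    have hl : 0 < P.lam ^ d := by positivity
    have hdet := hpd.det_pos
    have h1 : Real.log (√(st.A.det / P.lam ^ d) / (P.delta / 2)) =
        Real.log (2 / P.delta) + (Real.log st.A.det - d * Real.log P.lam) / 2 := by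
      rw [Real.log_div (by positivity) (by positivity), Real.log_sqrt (by positivity),
        Real.log_div hdet.ne' hl.ne', Real.log_div hdelta0.ne' two_ne_zero,
        Real.log_div two_ne_zero hdelta0.ne', Real.log_pow]
      ring
    rw [ArmInvariant.log_ratio_eq hdet hlam hdelta0, ← h1]
    refine (Real.sqrt_le_sqrt hω).trans (le_of_eq ?_)
    rw [mul_comm 2 (P.R ^ 2), mul_assoc, Real.sqrt_mul (sq_nonneg _), Real.sqrt_sq hR.le]
  have hq := Real.sqrt_nonneg (x ⬝ᵥ (st.A⁻¹ *ᵥ x))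
  have hl0 : 0 < √P.lam := Real.sqrt_pos.2 hlam
  rw [hwhat, LinTGState.beta, ← Real.sqrt_eq_rpow P.lam, ← hx]
  calc |x ⬝ᵥ (st.A⁻¹ *ᵥ s) - P.lam * (x ⬝ᵥ (st.A⁻¹ *ᵥ wt))|
      ≤ |x ⬝ᵥ (st.A⁻¹ *ᵥ s)| + |P.lam * (x ⬝ᵥ (st.A⁻¹ *ᵥ wt))| := abs_sub _ _
    _ ≤ √(x ⬝ᵥ (st.A⁻¹ *ᵥ x)) * √(s ⬝ᵥ (st.A⁻¹ *ᵥ s)) +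
        P.lam * (√(x ⬝ᵥ (st.A⁻¹ *ᵥ x)) * √(wt ⬝ᵥ (st.A⁻¹ *ᵥ wt))) := by
        have hx0 := hpd.inv_dotProduct_nonneg x
        rw [abs_mul, abs_of_pos hlam, ← Real.sqrt_mul hx0, ← Real.sqrt_mul hx0]
        exact add_le_add (hcs s) (mul_le_mul_of_nonneg_left (hcs wt) hlam.le)
    _ ≤ √(x ⬝ᵥ (st.A⁻¹ *ᵥ x)) * (P.R * √(2 * Real.log (2 * st.A.det ^ (1 / 2 : ℝ) *
      (P.lam • (1 : Matrix (Fin d) (Fin d) ℝ)).det ^ (-(1 / 2) : ℝ) / P.delta))) +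
        P.lam * (√(x ⬝ᵥ (st.A⁻¹ *ᵥ x)) * (P.S / √P.lam)) := by gcongr
    _ = _ := by
        have : P.lam * (√(x ⬝ᵥ (st.A⁻¹ *ᵥ x)) * (P.S / √P.lam)) =
            √P.lam * P.S * √(x ⬝ᵥ (st.A⁻¹ *ᵥ x)) := by
          nth_rewrite 1 [← Real.mul_self_sqrt hlam.le]
          field_simp
        rw [this]
        ring

end Simulation

/-! ### Marginal gains of monotone submodular functions. -/

section Submodular

variable {n : ℕ} {g : Finset (Fin n) → ℝ}

/-- Submodularity is applied to `insert o S` and `T`. If `o ∈ T` the gain on `T` vanishes and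
monotonicity takes over. -/
lemma SubmodularFn.gain_anti (hsub : SubmodularFn g) (hmono : Monotone g) {S T : Finset (Fin n)}
    (hST : S ⊆ T) (o : Fin n) : g (insert o T) - g T ≤ g (insert o S) - g S := by
  by_cases ho : o ∈ T
  · rw [insert_eq_of_mem ho, sub_self]
    exact sub_nonneg.2 (hmono (subset_insert o S))
  · have h := hsub (insert o S) T
    have h1 : insert o S ∪ T = insert o T := by rw [insert_union, union_eq_right.2 hST]
    have h2 : insert o S ∩ T = S := by rw [insert_inter_of_notMem ho, inter_eq_left.2 hST]
    rw [h1, h2] at h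
    linarith

lemma SubmodularFn.le_add_sum_gain (hsub : SubmodularFn g) (hmono : Monotone g)
    (S T : Finset (Fin n)) : g T ≤ g S + ∑ o ∈ T, (g (insert o S) - g S) := by
  have h : g (S ∪ T) ≤ g S + ∑ o ∈ T, (g (insert o S) - g S) := by
    induction T using Finset.induction_on with
    | empty => simp
    | insert a T ha ih =>
      rw [sum_insert ha, union_insert]
      have := hsub.gain_anti hmono (subset_union_left (s₁ := S) (s₂ := T)) a
      linarith
  exact (hmono subset_union_right).trans h

variable {d : ℕ} {F : Finset (Fin n) → Fin d → ℝ} {wt : Fin d → ℝ}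

lemma linObjective_monotone (hmono : ∀ i, Monotone fun T => F T i) (hwt : ∀ i, 0 ≤ wt i) :
    Monotone (linObjective F wt) := fun S T h => by
  simp only [linObjective]
  exact sum_le_sum fun i _ => mul_le_mul_of_nonneg_right (hmono i h) (hwt i)

lemma linObjective_submodular (hsub : ∀ i, SubmodularFn fun T => F T i) (hwt : ∀ i, 0 ≤ wt i) :
    SubmodularFn (linObjective F wt) := fun A B => by
  simp only [linObjective, ← add_dotProduct]
  exact sum_le_sum fun i _ => mul_le_mul_of_nonneg_right (hsub i A B) (hwt i)

lemma linObjective_nonneg (hmono : ∀ i, Monotone fun T => F T i) (hempty : ∀ i, 0 ≤ F ∅ i)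
    (hwt : ∀ i, 0 ≤ wt i) (T : Finset (Fin n)) : 0 ≤ linObjective F wt T := by
  simp only [linObjective]
  exact sum_nonneg fun i _ => mul_nonneg ((hempty i).trans (hmono i (empty_subset T))) (hwt i)

lemma gainVec_dotProduct (T : Finset (Fin n)) (a : Fin n) :
    gainVec F T a ⬝ᵥ wt = linObjective F wt (insert a T) - linObjective F wt T := by
  rw [gainVec, sub_dotProduct, linObjective, linObjective]

/-- In each coordinate the gain lies between `0` and `F {a} i - F ∅ i ≤ F {a} i`. Thus `L` bounds
every arm, not only the initial ones. -/
lemma gainVec_dotProduct_self_le (hmono : ∀ i, Monotone fun T => F T i)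
    (hsub : ∀ i, SubmodularFn fun T => F T i) (hempty : ∀ i, 0 ≤ F ∅ i) (T : Finset (Fin n))
    (a : Fin n) : gainVec F T a ⬝ᵥ gainVec F T a ≤ F {a} ⬝ᵥ F {a} := by
  refine sum_le_sum fun i _ => ?_
  have h1 := (hsub i).gain_anti (hmono i) (empty_subset T) a
  have h2 : F T i ≤ F (insert a T) i := hmono i (subset_insert a T)
  have h3 := hempty i
  simp only [insert_empty_eq] at h1
  have h4 : gainVec F T a i = F (insert a T) i - F T i := rfl
  rw [h4]
  exact mul_self_le_mul_self (by linarith) (by linarith)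

end Submodular

/-! ### Number of rounds and approximation constants. -/

section Numerics

/-- By convexity `e^α ≤ (1 - α) + α e`; divide by `e`. -/
lemma exp_neg_one_sub_le {α : ℝ} (h0 : 0 ≤ α) (h1 : α ≤ 1) :
    Real.exp (-(1 - α)) ≤ 1 / Real.exp 1 + α := by
  have h := convexOn_exp.2 (Set.mem_univ 0) (Set.mem_univ 1) (sub_nonneg.2 h1) h0 (by ring)
  simp only [smul_eq_mul, mul_zero, mul_one, zero_add, Real.exp_zero] at h
  have h2 : Real.exp (-(1 - α)) = Real.exp α / Real.exp 1 := by
    rw [← Real.exp_sub]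
    congr 1
    ring
  rw [h2, div_le_iff₀ (Real.exp_pos 1), add_mul, one_div, inv_mul_cancel₀ (Real.exp_pos 1).ne']
  linarith

lemma one_sub_pow_ceil_le {α x : ℝ} (h0 : 0 < α) (h1 : α < 1) (hx : 0 < x) :
    (1 - α) ^ ⌈Real.log (x / α) / α⌉₊ ≤ α / x := by
  have h2 : 1 - α ≤ Real.exp (-α) := Real.one_sub_le_exp_neg α
  refine (pow_le_pow_left₀ (by linarith) h2 _).trans ?_
  rw [← Real.exp_nat_mul]
  have h3 := Nat.le_ceil (Real.log (x / α) / α)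
  rw [div_le_iff₀ h0] at h3
  have h4 : α / x = Real.exp (-Real.log (x / α)) := by
    rw [← Real.log_inv, inv_div, Real.exp_log (by positivity)]
  rw [h4, Real.exp_le_exp]
  linarith

/-- The sharper estimate `-log (1 - α) ≥ 2α / (2 - α)` makes up for rounding down: with `ℓ = log (x
/ α)`, one needs `2 (ℓ - α) ≥ ℓ (2 - α)`, that is `ℓ ≥ 2`, whence the constant `e²`. -/
lemma one_sub_pow_floor_le {α x : ℝ} (h0 : 0 < α) (h1 : α < 1) (hx : 0 < x)
    (h : Real.exp 2 * α ≤ x) : (1 - α) ^ ⌊Real.log (x / α) / α⌋₊ ≤ α / x := by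
  have hl : 2 ≤ Real.log (x / α) := by
    rw [Real.le_log_iff_exp_le (by positivity), le_div_iff₀ h0]
    exact h
  have hα : 0 < 1 - α := by linarith
  have h2 := Real.le_log_one_add_of_nonneg (x := α / (1 - α)) (by positivity)
  have h3 : 1 + α / (1 - α) = (1 - α)⁻¹ := by
    field_simp
    ring
  have h4 : 2 * (α / (1 - α)) / (α / (1 - α) + 2) = 2 * α / (2 - α) := by
    have : 2 - α ≠ 0 := by linarith
    have h5 : α / (1 - α) + 2 = (2 - α) / (1 - α) := by
      field_simp
      ring
    rw [h5]
    field_simp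
  rw [h3, h4, Real.log_inv] at h2
  have h5 := (Nat.lt_floor_add_one (Real.log (x / α) / α)).le
  rw [div_le_iff₀ h0] at h5
  set K : ℝ := ((⌊Real.log (x / α) / α⌋₊ : ℕ) : ℝ) with hK
  have hK0 : 0 ≤ K := Nat.cast_nonneg _
  have h6 : Real.log (x / α) ≤ K * (2 * α / (2 - α)) := by
    rw [← mul_div_assoc, le_div_iff₀ (by linarith)]
    nlinarith
  have h7 : (1 - α) ^ ⌊Real.log (x / α) / α⌋₊ = Real.exp (K * Real.log (1 - α)) := by
    rw [hK, Real.exp_nat_mul, Real.exp_log hα]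
  have h8 : α / x = Real.exp (-Real.log (x / α)) := by
    rw [← Real.log_inv, inv_div, Real.exp_log (by positivity)]
  rw [h7, h8, Real.exp_le_exp]
  nlinarith [mul_le_mul_of_nonneg_left h2 hK0]

lemma one_third_lt_inv_exp_one : 11 / 30 < 1 / Real.exp 1 := by
  have := Real.exp_one_lt_d9
  rw [div_lt_div_iff₀ (by norm_num) (Real.exp_pos 1)]
  linarith

/-- The approximation guarantee when the budget is exhausted. -/
lemma approx_of_full {κ : ℕ} (hκ : 0 < κ) {α y fo e : ℝ} (h0 : 0 ≤ α) (h1 : α ≤ 1) (hfo : 0 ≤ fo)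
    (hgap : fo - y ≤ (1 - (1 - α) / κ) ^ κ * fo + 2 * e * κ) :
    (1 - 1 / Real.exp 1 - α) * fo - 2 * (κ * e) ≤ y := by
  have h2 : (1 - (1 - α) / κ) ^ κ ≤ Real.exp (-(1 - α)) := by
    refine Real.one_sub_div_pow_le_exp_neg ?_
    have : (1 : ℝ) ≤ κ := by exact_mod_cast hκ
    linarith
  have h3 := mul_le_mul_of_nonneg_right (h2.trans (exp_neg_one_sub_le h0 h1)) hfo
  nlinarith

/-- The approximation guarantee when the budget is not exhausted and is at least two. -/
lemma approx_of_not_full {κ α y fo g τ e : ℝ} (hκ : 2 ≤ κ) (h0 : 0 < α) (h1 : α < 1)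
    (hfo : 0 ≤ fo) (hy : 0 ≤ y) (he : 0 ≤ e) (hτ : τ ≤ α / (1 - α) * g / κ)
    (hB1 : fo ≤ y + κ * (τ + e)) (hB2 : g - e ≤ y + (τ + e)) :
    (1 - 1 / Real.exp 1 - α) * fo - 2 * (κ * e) ≤ y := by
  have hu := one_third_lt_inv_exp_one
  set u := 1 / Real.exp 1
  have hκ0 : 0 < κ := by linarith
  have hκe : 0 ≤ κ * e := by positivity
  -- A nonpositive factor makes the claim trivial. Otherwise `α ≤ 1 - u`, which gives `θ < 2` and `z
  -- > 0` below.
  rcases le_total (1 - u - α) 0 with hc | hc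
  · nlinarith
  obtain ⟨θ, hθ⟩ : ∃ θ, θ = α / (1 - α) := ⟨_, rfl⟩
  rw [← hθ] at hτ
  have hα : 0 < 1 - α := by linarith
  have hθα : θ * (1 - α) = α := by
    rw [hθ]
    field_simp
  have hθ0 : 0 < θ := by rw [hθ]; positivity
  obtain ⟨z, hz⟩ : ∃ z, z = 1 - θ / κ := ⟨_, rfl⟩
  have hzκ : z * κ = κ - θ := by
    rw [hz]
    field_simp
  have hz2 : 1 - θ / 2 ≤ z := by
    rw [hz]
    have : θ / κ ≤ θ / 2 := by gcongr
    linarith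
  have hθ2 : θ < 2 := by
    by_contra h
    nlinarith
  have hz0 : 0 < z := by linarith
  have hτκ : κ * τ ≤ θ * g := by
    rw [le_div_iff₀ hκ0] at hτ
    linarith
  have hτz : τ ≤ (1 - z) * g := by
    rw [hz]
    refine hτ.trans (le_of_eq ?_)
    field_simp
    ring
  -- The bound through the optimum, weighted by `z`, and the bound through the best singleton,
  -- weighted by `θ`, are added to eliminate `g`.
  have h2 : z * (fo - θ * g - κ * e) ≤ z * y := mul_le_mul_of_nonneg_left (by linarith) hz0.le
  have h3 : θ * (z * g - 2 * e) ≤ θ * y := mul_le_mul_of_nonneg_left (by linarith) hθ0.le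
  have h4 : z * fo - (κ + θ) * e ≤ (z + θ) * y := by
    have : z * (κ * e) = (κ - θ) * e := by rw [← mul_assoc, hzκ]
    linarith
  have hα2 : α ^ 2 ≤ u * (2 - α) := by nlinarith
  have h5 : (1 - u - α) * (z + θ) ≤ z := by
    have h6 : (1 - u - α) * θ ≤ (u + α) * (1 - θ / 2) := by
      have h7 : ((1 - u - α) * θ) * (1 - α) ≤ ((u + α) * (1 - θ / 2)) * (1 - α) := by
        have e1 : ((1 - u - α) * θ) * (1 - α) = (1 - u - α) * α := by rw [mul_assoc, hθα]
        have e2 : ((u + α) * (1 - θ / 2)) * (1 - α) = (u + α) * (1 - α - α / 2) := by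
          rw [mul_assoc, sub_mul (1 : ℝ), div_mul_eq_mul_div, hθα, one_mul]
        rw [e1, e2]
        nlinarith
      exact le_of_mul_le_mul_right h7 hα
    have h8 : (u + α) * (1 - θ / 2) ≤ (u + α) * z := mul_le_mul_of_nonneg_left hz2 (by linarith)
    linarith
  have h6 : κ + θ ≤ 2 * κ * (z + θ) := by nlinarith
  have h7 := mul_le_mul_of_nonneg_right h5 hfo
  have h8 := mul_le_mul_of_nonneg_right h6 he
  have h9 : (z + θ) * ((1 - u - α) * fo - 2 * (κ * e)) ≤ (z + θ) * y := by linarith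
  exact le_of_mul_le_mul_left h9 (by linarith)

/-- The approximation guarantee when the budget is one and nothing is chosen. -/
lemma approx_of_not_full_one {α y fo g τ e : ℝ} (h0 : 0 < α) (h1 : α < 1 / 2)
    (hfo : 0 ≤ fo) (he : 0 ≤ e) (hτ : τ ≤ α / (1 - α) * g)
    (hτ' : τ ≤ (1 - α) * g) (hB1 : fo ≤ y + (τ + e)) (hB2 : g - e ≤ fo) :
    (1 - 1 / Real.exp 1 - α) * fo - 2 * e ≤ y := by
  have hu := one_third_lt_inv_exp_one
  set u := 1 / Real.exp 1
  have hα : 0 < 1 - α := by linarith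
  -- For larger `α` the bound `τ ≤ (1 - α) g` suffices, because `1 - u - α ≤ α`; for smaller `α` the
  -- stopping bound does, because `θ ≤ α + u`.
  rcases le_total (2 / 5) α with h | h
  · have h2 : (1 - α) * g ≤ (1 - α) * (fo + e) := mul_le_mul_of_nonneg_left (by linarith) hα.le
    have h3 : (1 - u - α) * fo ≤ α * fo := mul_le_mul_of_nonneg_right (by linarith) hfo
    have h4 : 0 ≤ α * e := by positivity
    nlinarith
  · obtain ⟨θ, hθ⟩ : ∃ θ, θ = α / (1 - α) := ⟨_, rfl⟩
    rw [← hθ] at hτ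
    have hθ0 : 0 < θ := by rw [hθ]; positivity
    have hθ1 : θ ≤ 1 := by
      rw [hθ, div_le_one hα]
      linarith
    have hθu : θ ≤ α + u := by
      rw [hθ, div_le_iff₀ hα]
      nlinarith
    have h2 : θ * g ≤ θ * (fo + e) := mul_le_mul_of_nonneg_left (by linarith) hθ0.le
    have h3 : θ * fo ≤ (α + u) * fo := mul_le_mul_of_nonneg_right hθu hfo
    have h4 : θ * e ≤ 1 * e := mul_le_mul_of_nonneg_right hθ1 he
    linarith

end Numerics

/-! ### Threshold greedy with approximate tests. -/

section Greedy

variable {n d : ℕ}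

/-- The invariant of the threshold greedy algorithm, with `l` remaining in the round. -/
structure GreedyInvariant (P : LinTGParams) (f : Finset (Fin n) → ℝ) (fo : ℝ) (l : List (Fin n))
    (S : Finset (Fin n)) (w : ℝ) : Prop where
  card_le : S.card ≤ P.kappa
  w_pos : 0 < w
  gain_le : S.card < P.kappa → ∀ o, f (insert o S) - f S ≤ w / (1 - P.alpha) + P.eps'
  gain_le_of_notMem : S.card < P.kappa → ∀ o ∉ l, f (insert o S) - f S ≤ w + P.eps'
  gap_le : fo - f S ≤ (1 - (1 - P.alpha) / P.kappa) ^ S.card * fo + 2 * P.eps' * S.card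

namespace GreedyInvariant

variable {P : LinTGParams} {f : Finset (Fin n) → ℝ} {OPT S : Finset (Fin n)} {fo w : ℝ} {a : Fin n}
  {l : List (Fin n)}

lemma reject (h : GreedyInvariant P f fo (a :: l) S w) (ha : f (insert a S) - f S ≤ w + P.eps') :
    GreedyInvariant P f fo l S w := by
  refine ⟨h.card_le, h.w_pos, h.gain_le, fun hc o ho => ?_, h.gap_le⟩
  by_cases hoa : o = a
  · rw [hoa]
    exact ha
  · exact h.gain_le_of_notMem hc o (by simp [hoa, ho])

lemma of_full (h : GreedyInvariant P f fo (a :: l) S w) (hS : P.kappa ≤ S.card) :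
    GreedyInvariant P f fo l S w :=
  ⟨h.card_le, h.w_pos, h.gain_le, fun hc => absurd hc (not_lt.2 hS), h.gap_le⟩

/-- By the previous threshold, `fo - f S ≤ κ (w / (1 - α) + ε')`. With `r = (1 - α) / κ` a new
element therefore gains at least `w - ε' ≥ r (fo - f S) - 2ε'`, and the gap contracts by `1 - r`. -/
lemma accept (hsub : SubmodularFn f) (hmono : Monotone f) (hα0 : 0 < P.alpha) (hα1 : P.alpha < 1)
    (heps : 0 < P.eps') (hfo : fo = f OPT) (hOPT : OPT.card ≤ P.kappa)
    (h : GreedyInvariant P f fo (a :: l) S w) (hS : S.card < P.kappa)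
    (ha : w - P.eps' ≤ f (insert a S) - f S) : GreedyInvariant P f fo l (insert a S) w := by
  have hw := h.w_pos
  -- Elements already chosen are evaluated again and may pass the test when `w ≤ ε'`; this leaves
  -- the set unchanged.
  by_cases haS : a ∈ S
  · rw [insert_eq_of_mem haS]
    exact h.reject (by rw [insert_eq_of_mem haS, sub_self]; linarith)
  have hcard : (insert a S).card = S.card + 1 := card_insert_of_notMem haS
  have hanti := fun o => hsub.gain_anti hmono (subset_insert a S) o
  refine ⟨by omega, hw, fun _ o => (hanti o).trans (h.gain_le hS o), fun _ o ho => ?_, ?_⟩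
  · by_cases hoa : o = a
    · rw [hoa, insert_eq_of_mem (mem_insert_self a S), sub_self]
      linarith
    · exact (hanti o).trans (h.gain_le_of_notMem hS o (by simp [hoa, ho]))
  · have hκ : (0 : ℝ) < P.kappa := by
      have : 0 < P.kappa := by omega
      exact_mod_cast this
    have hκ1 : (1 : ℝ) ≤ P.kappa := by
      have : 1 ≤ P.kappa := by omega
      exact_mod_cast this
    have hα : 0 < 1 - P.alpha := by linarith
    have h1 : fo ≤ f S + P.kappa * (w / (1 - P.alpha) + P.eps') := by
      rw [hfo]
      refine (hsub.le_add_sum_gain hmono S OPT).trans (add_le_add le_rfl ?_)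
      refine (sum_le_sum fun o _ => h.gain_le hS o).trans ?_
      rw [sum_const, nsmul_eq_mul]
      have : (OPT.card : ℝ) ≤ P.kappa := by exact_mod_cast hOPT
      have : 0 < w / (1 - P.alpha) := by positivity
      gcongr
    obtain ⟨r, hr⟩ : ∃ r, r = (1 - P.alpha) / P.kappa := ⟨_, rfl⟩
    have hr0 : 0 < r := by rw [hr]; positivity
    have hr1 : r ≤ 1 := by
      rw [hr, div_le_one hκ]
      linarith
    have hrκ : r * P.kappa = 1 - P.alpha := by
      rw [hr]
      field_simp
    have h2 : r * (fo - f S) ≤ w + P.eps' := by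
      have h3 : r * (fo - f S) ≤ r * (P.kappa * (w / (1 - P.alpha) + P.eps')) :=
        mul_le_mul_of_nonneg_left (by linarith) hr0.le
      have h4 : r * (P.kappa * (w / (1 - P.alpha) + P.eps')) = w + (1 - P.alpha) * P.eps' := by
        rw [← mul_assoc, hrκ]
        field_simp
      have h5 : 0 < P.alpha * P.eps' := by positivity
      linarith
    have h3 := mul_le_mul_of_nonneg_left h.gap_le (sub_nonneg.2 hr1)
    rw [← hr] at h3 ⊢
    rw [hcard, pow_succ]
    push_cast
    have h4 : 0 ≤ r * (2 * P.eps' * S.card) := by positivity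
    linarith

/-- After a complete round every gain is at most `w + ε'`, which is the general bound for the
lowered threshold. -/
lemma next_round (hα1 : P.alpha < 1) (h : GreedyInvariant P f fo [] S w) (l : List (Fin n))
    (hl : ∀ o, o ∈ l) : GreedyInvariant P f fo l S ((1 - P.alpha) * w) := by
  have hα : 0 < 1 - P.alpha := by linarith
  refine ⟨h.card_le, mul_pos hα h.w_pos, fun hc o => ?_, fun _ o ho => absurd (hl o) ho, h.gap_le⟩
  rw [mul_div_cancel_left₀ _ hα.ne']
  exact h.gain_le_of_notMem hc o (by simp)

/-- The guarantee for the output, after `k` rounds that began with the threshold `g`. -/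
theorem approx (hsub : SubmodularFn f) (hmono : Monotone f) (hnonneg : ∀ T, 0 ≤ f T)
    (hκ : 0 < P.kappa) (hα0 : 0 < P.alpha) (hα1 : P.alpha < 1)
    (hα2 : 2 ≤ P.kappa ∨ P.alpha < 1 / 2) (heps : 0 < P.eps') (hOPT : OPT.card ≤ P.kappa)
    (hmax : ∀ T, T.card ≤ P.kappa → f T ≤ f OPT) {g : ℝ} (hg : 0 < g) (hga : g ≤ f {a} + P.eps')
    {k : ℕ} (hw : w = (1 - P.alpha) ^ k * g) (hend : w ≤ P.alpha * g / P.kappa)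
    (h : GreedyInvariant P f (f OPT) l S w) :
    (1 - 1 / Real.exp 1 - P.alpha) * f OPT - 2 * (P.kappa * P.eps') ≤ f S := by
  have hα : 0 < 1 - P.alpha := by linarith
  have hκ' : (0 : ℝ) < P.kappa := by exact_mod_cast hκ
  rcases h.card_le.eq_or_lt with hc | hc
  · have h1 := h.gap_le
    rw [hc] at h1
    exact approx_of_full hκ hα0.le hα1.le (hnonneg OPT) h1
  · have hτ : w / (1 - P.alpha) ≤ P.alpha / (1 - P.alpha) * g / P.kappa := by
      rw [div_le_iff₀ hα]
      refine hend.trans (le_of_eq ?_)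
      field_simp
    have hw0 := h.w_pos
    have hτ0 : 0 < w / (1 - P.alpha) := by positivity
    have hB1 : f OPT ≤ f S + P.kappa * (w / (1 - P.alpha) + P.eps') := by
      refine (hsub.le_add_sum_gain hmono S OPT).trans (add_le_add le_rfl ?_)
      refine (sum_le_sum fun o _ => h.gain_le hc o).trans ?_
      rw [sum_const, nsmul_eq_mul]
      have : (OPT.card : ℝ) ≤ P.kappa := by exact_mod_cast hOPT
      gcongr
    have hB2 : g - P.eps' ≤ f S + (w / (1 - P.alpha) + P.eps') := by
      have h1 := h.gain_le hc a
      have h2 : f {a} ≤ f (insert a S) := hmono (by simp)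
      linarith
    rcases (show 2 ≤ P.kappa ∨ P.kappa = 1 by omega) with h2 | h2
    · exact approx_of_not_full (by exact_mod_cast h2) hα0 hα1 (hnonneg OPT) (hnonneg S)
        heps.le hτ hB1 hB2
    · have hα3 : P.alpha < 1 / 2 := hα2.resolve_left (by omega)
      rw [h2, Nat.cast_one] at hB1 hτ hend ⊢
      rw [one_mul] at hB1 ⊢
      rw [div_one] at hτ hend
      -- For `κ = 1` the loop stops only at `w ≤ α g`, and `α < 1/2` puts both `g` and `(1 - α) g`
      -- above this level.
      have hk : 2 ≤ k := by
        by_contra hk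
        have h3 : k = 0 ∨ k = 1 := by omega
        rcases h3 with rfl | rfl
        · rw [pow_zero, one_mul] at hw
          nlinarith
        · rw [pow_one] at hw
          nlinarith
      have hτ' : w / (1 - P.alpha) ≤ (1 - P.alpha) * g := by
        rw [div_le_iff₀ hα, hw]
        have h3 : (1 - P.alpha) ^ k ≤ (1 - P.alpha) ^ 2 :=
          pow_le_pow_of_le_one hα.le (by linarith) hk
        nlinarith
      have h3 : f {a} ≤ f OPT := hmax {a} (by rw [card_singleton]; exact hκ)
      exact approx_of_not_full_one hα0 hα3 (hnonneg OPT) heps.le hτ hτ' hB1 (by linarith)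

end GreedyInvariant

end Greedy

/-! ### Invariants of the whole run. -/

section Run

variable {n d : ℕ} {P : LinTGParams} {L : ℝ} {rule : LinTGRule d}
  {F : Finset (Fin n) → Fin d → ℝ} {reward : ℕ → (Fin d → ℝ) → ℝ}

/-- The picked index is known to be a genuine arm only because the width of an undecided state
exceeds `ε'`; hence the detour through `evalState_count_le`. -/
lemma evalState_armInvariant (hlam : 0 < P.lam) (hd : 0 < d) (hdelta0 : 0 < P.delta)
    (hdelta1 : P.delta < 1) (heps : 0 < P.eps') {st : LinTGState n d} (h : ArmInvariant P L st)
    {a : Fin n} (hg : gainVec F st.S a ⬝ᵥ gainVec F st.S a ≤ L ^ 2) {k : ℕ}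
    (hk : ∀ j < k, ¬ (evalState rule F reward st a j).Accept P ∧
      ¬ (evalState rule F reward st a j).Reject P) :
    ArmInvariant P L (evalState rule F reward st a k) := by
  have hf := fun k => evalState_fields (rule := rule) (F := F) (reward := reward) st a k
  refine (evalState_count_le hlam hd hdelta0 hdelta1 h hg heps
    (widthBound_nonneg (L := L) (d := d) hlam hdelta0 hdelta1
      (Nat.cast_nonneg (evalState rule F reward st a k).t)) k
    (fun j hj => LinTGState.eps'_lt_beta (hk j hj).1 (hk j hj).2) fun j hj =>
      widthBound_mono hlam (Nat.cast_nonneg _) ?_).1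
  rw [(hf j).2.2.2.2.2, (hf k).2.2.2.2.2]
  exact_mod_cast Nat.add_le_add_left hj.le _

lemma ArmInvariant.finishEval {old st : LinTGState n d} (h : ArmInvariant P L st) (a : Fin n) :
    ArmInvariant P L (finishEval P old a st) :=
  ⟨h.A_eq, h.one_le, h.eq_zero, h.norm_le, h.t_eq⟩

/-- LinTG terminates, whatever the rewards are, and each round makes at most `n` evaluations. -/
theorem linTG_terminates (hlam : 0 < P.lam) (hd : 0 < d) (hdelta0 : 0 < P.delta)
    (hdelta1 : P.delta < 1) (heps : 0 < P.eps') (hN : 0 < P.N0 n)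
    (hF : ∀ a : Fin n, F {a} ⬝ᵥ F {a} ≤ L ^ 2)
    (hg : ∀ S a, gainVec F S a ⬝ᵥ gainVec F S a ≤ L ^ 2) (K : ℕ)
    (hK : (1 - P.alpha) ^ K * gmax P F reward ≤ finalThreshold P F reward) :
    ∃ out, LinTG P rule F reward = some out ∧ out.evals.length ≤ n * K := by
  have hround : ∀ (c : ℕ) (w : ℝ) (st : LinTGState n d), ArmInvariant P L st → st.w = w →
      st.evals.length ≤ c → ∃ st', linTGRound P rule F reward st = some st' ∧
        ArmInvariant P L st' ∧ st'.w = (1 - P.alpha) * w ∧ st'.evals.length ≤ c + n := by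
    intro c w st h1 h2 h3
    obtain ⟨st', h4, h5, h6, h7⟩ := foldlM_option_spec (f := processElement P rule F reward)
      (fun l st => ArmInvariant P L st ∧ st.w = w ∧ st.evals.length + l.length ≤ c + n)
      (by
        rintro a l st ⟨h1, h2, h3⟩
        rw [List.length_cons] at h3
        by_cases hcard : st.S.card < P.kappa
        · obtain ⟨k, hk, -, hpe⟩ := processElement_spec (rule := rule) (reward := reward)
            hlam hd hdelta0 hdelta1 heps h1 (hg st.S a) hcard
          have hf := evalState_fields (rule := rule) (F := F) (reward := reward) st a k
          refine ⟨_, hpe, (evalState_armInvariant hlam hd hdelta0 hdelta1 heps h1 (hg st.S a)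
            hk).finishEval a, hf.2.1.trans h2, ?_⟩
          simp only [finishEval, List.length_append, List.length_singleton, hf.2.2.1]
          omega
        · exact ⟨st, by rw [processElement, if_neg hcard], h1, h2, by omega⟩)
      (List.finRange n) st ⟨h1, h2, by rw [List.length_finRange]; omega⟩
    refine ⟨{ st' with w := (1 - P.alpha) * st'.w }, by rw [linTGRound, h4, Option.map_some],
      ⟨h5.A_eq, h5.one_le, h5.eq_zero, h5.norm_le, h5.t_eq⟩, by rw [← h6], ?_⟩
    simpa using h7
  obtain ⟨k, hkK, out, hout, ⟨-, -, hlen⟩, -⟩ := whileLoop_spec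
    (cond := fun s : LinTGState n d => P.alpha * gmax P F reward / P.kappa < s.w)
    (body := linTGRound P rule F reward) (s₀ := initState P F reward)
    (fun k s => ArmInvariant P L s ∧ s.w = (1 - P.alpha) ^ k * gmax P F reward ∧
      s.evals.length ≤ n * k)
    ⟨armInvariant_initState hN hF, by simp [initState], by simp [initState]⟩
    (by
      rintro k s ⟨h1, h2, h3⟩ -
      obtain ⟨s', h4, h5, h6, h7⟩ := hround _ _ s h1 h2 h3
      exact ⟨s', h4, h5, by rw [h6, pow_succ]; ring, by rw [Nat.mul_succ]; exact h7⟩)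
    K (by
      rintro s ⟨-, h2, -⟩
      rw [not_lt, h2]
      exact hK)
  exact ⟨out, hout, hlen.trans (Nat.mul_le_mul_left n hkK)⟩

variable {wt : Fin d → ℝ} {OPT : Finset (Fin n)}

/-- What is known about a state between two evaluations if all confidence intervals are correct;
`l` remains in the round, and the threshold is `w`. -/
structure RunInvariant (P : LinTGParams) (L : ℝ) (rule : LinTGRule d)
    (F : Finset (Fin n) → Fin d → ℝ) (reward : ℕ → (Fin d → ℝ) → ℝ) (wt : Fin d → ℝ)
    (fo : ℝ) (w : ℝ) (l : List (Fin n)) (st : LinTGState n d) : Prop where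
  arm : ArmInvariant P L st
  history : RunHistory P rule F reward st
  w_eq : st.w = w
  greedy : GreedyInvariant P (linObjective F wt) fo l st.S st.w
  evals : P.lam ≤ 2 * P.R ^ 2 / P.S ^ 2 * Real.log (2 / P.delta) →
    ∀ e ∈ st.evals, (e.samples : ℝ) ≤ e.sampleBound P rule F wt L

/-- Correct intervals serve twice: in the final state they certify the decision, in the earlier
states they bound the number of samples. -/
lemma RunInvariant.processElement (hlam : 0 < P.lam) (hd : 0 < d) (hdelta0 : 0 < P.delta)
    (hdelta1 : P.delta < 1) (hR : 0 < P.R) (hS : 0 < P.S) (heps : 0 < P.eps') (hN : 0 < P.N0 n)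
    (hα0 : 0 < P.alpha) (hα1 : P.alpha < 1)
    (hg : ∀ S a, gainVec F S a ⬝ᵥ gainVec F S a ≤ L ^ 2)
    (hsub : SubmodularFn (linObjective F wt)) (hmono : Monotone (linObjective F wt))
    (hOPT : OPT.card ≤ P.kappa)
    (hconf : ∀ st : LinTGState n d, RunHistory P rule F reward st →
      |st.x ⬝ᵥ st.what - st.x ⬝ᵥ wt| ≤ st.beta P)
    {w : ℝ} {a : Fin n} {l : List (Fin n)} {st : LinTGState n d}
    (h : RunInvariant P L rule F reward wt (linObjective F wt OPT) w (a :: l) st)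
    (hi : IdleRest P rule F reward st (a :: l)) :
    ∃ st', processElement P rule F reward st a = some st' ∧
      RunInvariant P L rule F reward wt (linObjective F wt OPT) w l st' ∧
      IdleRest P rule F reward st' l := by
  classical
  by_cases hcard : st.S.card < P.kappa
  · obtain ⟨k, hk, hAR, hpe⟩ := processElement_spec (rule := rule) (reward := reward)
      hlam hd hdelta0 hdelta1 heps h.arm (hg st.S a) hcard
    have hin := fun j (hj : j ≤ k) => evalState_inEval hN (hi.1 (by simp)) hcard h.history j
      fun i hi => hk i (hi.trans_le hj)
    obtain ⟨hf1, hf2, hf3, -⟩ :=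
      evalState_fields (rule := rule) (F := F) (reward := reward) st a k
    refine ⟨_, hpe, ⟨(evalState_armInvariant hlam hd hdelta0 hdelta1 heps h.arm (hg st.S a)
      hk).finishEval a, ?_, hf2.trans h.w_eq, ?_, ?_⟩, (hin k le_rfl).1.finish hAR⟩
    · exact ⟨(hin k le_rfl).2.A_eq, (hin k le_rfl).2.b_eq⟩
    · have hc := abs_le.1 (hconf _ (hin k le_rfl).2)
      rw [evalState_x, gainVec_dotProduct (wt := wt)] at hc
      simp only [finishEval, hf1, hf2]
      by_cases hA : (evalState rule F reward st a k).Accept P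
      · rw [if_pos hA]
        refine h.greedy.accept hsub hmono hα0 hα1 heps rfl hOPT hcard ?_
        unfold LinTGState.Accept at hA
        rw [evalState_x, hf2] at hA
        linarith
      · rw [if_neg hA]
        refine h.greedy.reject ?_
        have hRj := hAR.resolve_left hA
        unfold LinTGState.Reject at hRj
        rw [evalState_x, hf2] at hRj
        linarith
    · intro hlamS e he
      simp only [finishEval, List.mem_append, List.mem_singleton, hf3] at he
      rcases he with he | he
      · exact h.evals hlamS e he
      · exact samples_le_sampleBound hlam hd hR hS hdelta0 hdelta1 heps hlamS h.arm (hg st.S a) hk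
          (fun j hj => hconf _ (hin j hj.le).2) e he
  · refine ⟨st, by rw [_root_.processElement, if_neg hcard],
      ⟨h.arm, h.history, h.w_eq, h.greedy.of_full (not_lt.1 hcard), h.evals⟩,
      fun _ => Or.inl (not_lt.1 hcard), fun _ => Or.inl (not_lt.1 hcard)⟩

/-- The guarantees of LinTG if all confidence intervals are correct and the initial averages are
accurate. -/
theorem linTG_correct (hn : 0 < n) (hlam : 0 < P.lam) (hd : 0 < d) (hdelta0 : 0 < P.delta)
    (hdelta1 : P.delta < 1) (hR : 0 < P.R) (hS : 0 < P.S) (heps : 0 < P.eps') (hN : 0 < P.N0 n)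
    (hα0 : 0 < P.alpha) (hα1 : P.alpha < 1) (hκ : 0 < P.kappa)
    (hα2 : 2 ≤ P.kappa ∨ P.alpha < 1 / 2)
    (hF : ∀ a : Fin n, F {a} ⬝ᵥ F {a} ≤ L ^ 2)
    (hg : ∀ S a, gainVec F S a ⬝ᵥ gainVec F S a ≤ L ^ 2)
    (hsub : SubmodularFn (linObjective F wt)) (hmono : Monotone (linObjective F wt))
    (hnonneg : ∀ T, 0 ≤ linObjective F wt T) (hOPT : OPT.card ≤ P.kappa)
    (hmax : ∀ T : Finset (Fin n), T.card ≤ P.kappa → linObjective F wt T ≤ linObjective F wt OPT)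
    (hconf : ∀ st : LinTGState n d, RunHistory P rule F reward st →
      |st.x ⬝ᵥ st.what - st.x ⬝ᵥ wt| ≤ st.beta P)
    (hinit : ∀ a, |fhat P F reward a - linObjective F wt {a}| ≤ P.eps') :
    ∃ out, LinTG P rule F reward = some out ∧ out.S.card ≤ P.kappa ∧
      (1 - 1 / Real.exp 1 - P.alpha) * linObjective F wt OPT - 2 * (P.kappa * P.eps') ≤
        linObjective F wt out.S ∧
      (P.lam ≤ 2 * P.R ^ 2 / P.S ^ 2 * Real.log (2 / P.delta) →
        ∀ e ∈ out.evals, (e.samples : ℝ) ≤ e.sampleBound P rule F wt L) := by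
  have : Nonempty (Fin n) := ⟨⟨0, hn⟩⟩
  have hκ' : (0 : ℝ) < P.kappa := by exact_mod_cast hκ
  have hle : ∀ a, fhat P F reward a ≤ gmax P F reward :=
    fun a => le_ciSup (Set.finite_range _).bddAbove a
  obtain ⟨a₀, ha₀⟩ : ∃ a, fhat P F reward a = gmax P F reward :=
    exists_eq_ciSup_of_finite (f := fhat P F reward)
  -- If `g ≤ 0` then `g ≤ α g / κ`, so no round is made. The empty set is good enough: every
  -- singleton has value at most `ε'`, hence `f(OPT) ≤ f(∅) + κ ε'`.
  rcases le_or_gt (gmax P F reward) 0 with hg0 | hg0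
  · obtain ⟨k, -, out, hout, rfl, -⟩ := whileLoop_spec
      (cond := fun s : LinTGState n d => P.alpha * gmax P F reward / P.kappa < s.w)
      (body := linTGRound P rule F reward) (s₀ := initState P F reward)
      (fun _ s => s = initState P F reward) rfl
      (by
        rintro k s rfl hc
        exfalso
        have hc' : P.alpha * gmax P F reward / P.kappa < gmax P F reward := hc
        rw [div_lt_iff₀ hκ'] at hc'
        have : (1 : ℝ) ≤ P.kappa := by exact_mod_cast hκ
        nlinarith) 0
      (by
        rintro s rfl
        rw [not_lt]
        change gmax P F reward ≤ _
        rw [le_div_iff₀ hκ']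
        have : (1 : ℝ) ≤ P.kappa := by exact_mod_cast hκ
        nlinarith)
    refine ⟨_, hout, by simp [initState], ?_, by simp [initState]⟩
    change _ ≤ linObjective F wt ∅
    have h1 : linObjective F wt OPT ≤ linObjective F wt ∅ + P.kappa * P.eps' := by
      refine (hsub.le_add_sum_gain hmono ∅ OPT).trans (add_le_add le_rfl ?_)
      have h2 : ∀ o ∈ OPT, linObjective F wt (insert o ∅) - linObjective F wt ∅ ≤ P.eps' := by
        intro o _
        have h3 := hnonneg ∅
        have h4 := hle o
        have h5 := (abs_le.1 (hinit o)).1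
        rw [insert_empty_eq]
        linarith
      refine (sum_le_sum h2).trans ?_
      rw [sum_const, nsmul_eq_mul]
      have : (OPT.card : ℝ) ≤ P.kappa := by exact_mod_cast hOPT
      gcongr
    have h2 : (1 - 1 / Real.exp 1 - P.alpha) * linObjective F wt OPT ≤
        1 * linObjective F wt OPT := by
      refine mul_le_mul_of_nonneg_right ?_ (hnonneg OPT)
      have := Real.exp_pos 1
      have : 0 < 1 / Real.exp 1 := by positivity
      linarith
    have h3 : 0 < P.kappa * P.eps' := by positivity
    linarith
  · have hgreedy0 : GreedyInvariant P (linObjective F wt) (linObjective F wt OPT) (List.finRange n)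
        ∅ (gmax P F reward) := by
      refine ⟨by simp, hg0, fun _ o => ?_, fun _ o ho => absurd (List.mem_finRange o) ho, ?_⟩
      · have h3 := hnonneg ∅
        have h4 := hle o
        have h5 := (abs_le.1 (hinit o)).1
        have h6 : gmax P F reward ≤ gmax P F reward / (1 - P.alpha) := by
          rw [le_div_iff₀ (by linarith)]
          nlinarith
        rw [insert_empty_eq]
        linarith
      · have := hnonneg ∅
        simp [this]
    have hround : ∀ (w : ℝ) (st : LinTGState n d),
        RunInvariant P L rule F reward wt (linObjective F wt OPT) w (List.finRange n) st →
        Idle P rule F reward st [] → finalThreshold P F reward < st.w →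
        ∃ st', linTGRound P rule F reward st = some st' ∧
          RunInvariant P L rule F reward wt (linObjective F wt OPT) ((1 - P.alpha) * w)
            (List.finRange n) st' ∧ Idle P rule F reward st' [] := by
      intro w st h hi hc
      have hne : List.finRange n ≠ [] := by simpa using hn.ne'
      obtain ⟨st', h1, h2, h3⟩ := foldlM_option_spec (f := processElement P rule F reward)
        (fun l st => RunInvariant P L rule F reward wt (linObjective F wt OPT) w l st ∧
          IdleRest P rule F reward st l)
        (fun a l st ⟨h, hi⟩ => h.processElement hlam hd hdelta0 hdelta1 hR hS heps hN hα0 hα1 hg hsub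
          hmono hOPT hconf hi) (List.finRange n) st
        ⟨h, fun _ => hi.new_round hn hc, fun h0 => absurd h0 hne⟩
      refine ⟨{ st' with w := (1 - P.alpha) * st'.w }, by rw [linTGRound, h1, Option.map_some],
        ⟨⟨h2.arm.A_eq, h2.arm.one_le, h2.arm.eq_zero, h2.arm.norm_le, h2.arm.t_eq⟩,
          ⟨h2.history.A_eq, h2.history.b_eq⟩, by rw [← h2.w_eq],
          h2.greedy.next_round hα1 _ List.mem_finRange, h2.evals⟩, h3.2 rfl⟩
    obtain ⟨k, -, out, hout, ⟨h1, -⟩, h3⟩ := whileLoop_spec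
      (cond := fun s : LinTGState n d => P.alpha * gmax P F reward / P.kappa < s.w)
      (body := linTGRound P rule F reward) (s₀ := initState P F reward)
      (fun k s => RunInvariant P L rule F reward wt (linObjective F wt OPT)
        ((1 - P.alpha) ^ k * gmax P F reward) (List.finRange n) s ∧ Idle P rule F reward s [])
      ⟨⟨armInvariant_initState hN hF, runHistory_initState, by simp [initState], hgreedy0,
        by simp [initState]⟩, idle_initState⟩
      (by
        rintro k s ⟨h1, h2⟩ hc
        obtain ⟨s', h3, h4, h5⟩ := hround _ s h1 h2 hc
        refine ⟨s', h3, ?_, h5⟩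
        rwa [← mul_assoc, ← pow_succ'] at h4)
      ⌈Real.log (P.kappa / P.alpha) / P.alpha⌉₊
      (by
        rintro s ⟨h1, -⟩
        rw [not_lt, h1.w_eq]
        refine (mul_le_mul_of_nonneg_right (one_sub_pow_ceil_le hα0 hα1 hκ') hg0.le).trans
          (le_of_eq ?_)
        ring)
    refine ⟨out, hout, h1.greedy.card_le, ?_, h1.evals⟩
    refine h1.greedy.approx (a := a₀) hsub hmono hnonneg hκ hα0 hα1 hα2 heps hOPT hmax hg0 ?_ h1.w_eq
      (not_lt.1 h3)
    have := (abs_le.1 (hinit a₀)).2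
    linarith

end Run

/-! ### Union bound and conclusion. -/

section Main

/-- The failure probability of the initial phase. -/
lemma measure_exists_fhat_error_le {n d : ℕ} {P : LinTGParams} (hn : 0 < n)
    (heps : 0 < P.eps') (hdelta0 : 0 < P.delta) (hR : 0 < P.R) (hN : 0 < P.N0 n)
    (F : Finset (Fin n) → Fin d → ℝ) (wt : Fin d → ℝ)
    {Ω : Type*} [MeasurableSpace Ω] {μ : Measure Ω} [IsProbabilityMeasure μ]
    {ξ : ℕ → Ω → ℝ} (hξindep : iIndepFun ξ μ)
    (hξsub : ∀ t, HasSubgaussianMGF (ξ t) (Real.toNNReal (P.R ^ 2)) μ) :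
    μ {ω | ∃ a, P.eps' < |fhat P F (fun t x => x ⬝ᵥ wt + ξ t ω) a - linObjective F wt {a}|} ≤
      ENNReal.ofReal (P.delta / 3) := by
  have hN' : (0 : ℝ) < P.N0 n := by exact_mod_cast hN
  have hn' : (0 : ℝ) < n := by exact_mod_cast hn
  have hsubset : {ω | ∃ a, P.eps' <
      |fhat P F (fun t x => x ⬝ᵥ wt + ξ t ω) a - linObjective F wt {a}|} ⊆
      ⋃ a : Fin n, {ω | P.N0 n * P.eps' ≤ |∑ i ∈ range (P.N0 n), ξ (a * P.N0 n + i) ω|} := by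
    rintro ω ⟨a, ha⟩
    refine Set.mem_iUnion.2 ⟨a, ?_⟩
    have h1 : fhat P F (fun t x => x ⬝ᵥ wt + ξ t ω) a - linObjective F wt {a} =
        (∑ i ∈ range (P.N0 n), ξ (a * P.N0 n + i) ω) / P.N0 n := by
      rw [fhat, linObjective, sum_add_distrib, sum_const, card_range, nsmul_eq_mul]
      field_simp
      ring
    rw [h1, abs_div, abs_of_pos hN', lt_div_iff₀ hN'] at ha
    exact (mul_comm _ _).trans_le ha.le
  refine (measure_mono hsubset).trans ((measure_iUnion_fintype_le _ _).trans ?_)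
  have hone : ∀ a : Fin n, μ {ω | P.N0 n * P.eps' ≤
      |∑ i ∈ range (P.N0 n), ξ (a * P.N0 n + i) ω|} ≤ ENNReal.ofReal (P.delta / (3 * n)) := by
    intro a
    refine (measure_abs_sum_block_ge_le hξindep hξsub _ _ (by positivity)).trans
      (ENNReal.ofReal_le_ofReal ?_)
    rw [Real.coe_toNNReal _ (sq_nonneg _)]
    -- The choice of `N0` makes each two-sided tail at most `2 * δ / (6n) = δ / (3n)`.
    have h1 : Real.log (6 * n / P.delta) ≤ P.N0 n * P.eps' ^ 2 / (2 * P.R ^ 2) := by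
      have h2 : 2 * P.R ^ 2 / P.eps' ^ 2 * Real.log (6 * n / P.delta) ≤ P.N0 n := Nat.le_ceil _
      rw [div_mul_eq_mul_div, div_le_iff₀ (by positivity)] at h2
      rw [le_div_iff₀ (by positivity)]
      linarith
    have h2 : -(P.N0 n * P.eps') ^ 2 / (2 * P.N0 n * P.R ^ 2) ≤ -Real.log (6 * n / P.delta) := by
      refine le_trans (le_of_eq ?_) (neg_le_neg h1)
      field_simp
    have h3 := Real.exp_le_exp.2 h2
    rw [Real.exp_neg (Real.log _), Real.exp_log (by positivity), inv_div] at h3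
    refine (mul_le_mul_of_nonneg_left h3 zero_le_two).trans (le_of_eq ?_)
    field_simp
    ring
  refine (sum_le_sum fun a _ => hone a).trans (le_of_eq ?_)
  rw [sum_const, card_univ, Fintype.card_fin, ← ENNReal.ofReal_nsmul, nsmul_eq_mul]
  congr 1
  field_simp

theorem theorem2 {n d : ℕ} (hn : 0 < n) (hd : 0 < d)
    (F : Finset (Fin n) → Fin d → ℝ)
    (hmono : ∀ i, Monotone fun T => F T i)
    (hsub : ∀ i, SubmodularFn fun T => F T i)
    (hempty : ∀ i, 0 ≤ F ∅ i)
    (wt : Fin d → ℝ) (hwt : ∀ i, 0 ≤ wt i)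
    (P : LinTGParams)
    (hkappa : 0 < P.kappa) (heps : 0 < P.eps)
    (hdelta0 : 0 < P.delta) (hdelta1 : P.delta < 1)
    (halpha0 : 0 < P.alpha) (halpha1 : P.alpha < 1)
    (halpha2 : 2 ≤ P.kappa ∨ P.alpha < 1 / 2)
    (hlam : 0 < P.lam) (hR : 0 < P.R)
    (hS : 0 < P.S) (hwtS : ‖WithLp.toLp 2 wt‖ ≤ P.S)
    (L : ℝ) (hL : ∀ a : Fin n, ‖WithLp.toLp 2 (F {a})‖ ≤ L)
    (OPT : Finset (Fin n)) (hOPT : OPT.card ≤ P.kappa)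
    (hOPTmax : IsMaxOn (linObjective F wt) {T | T.card ≤ P.kappa} OPT)
    (rule : LinTGRule d)
    {Ω : Type*} [MeasurableSpace Ω] (μ : Measure Ω) [IsProbabilityMeasure μ]
    (ξ : ℕ → Ω → ℝ) (hξmeas : ∀ t, Measurable (ξ t))
    (hξindep : iIndepFun ξ μ)
    (hξident : ∀ t, IdentDistrib (ξ t) (ξ 0) μ μ)
    (hξsub : ∀ t, HasSubgaussianMGF (ξ t) (Real.toNNReal (P.R ^ 2)) μ) :
    (∀ ω, ∃ out, LinTG P rule F (fun t x => x ⬝ᵥ wt + ξ t ω) = some out ∧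
      (out.evals.length : ℝ) ≤ n * (⌈Real.log (P.kappa / P.alpha) / P.alpha⌉₊ : ℝ) ∧
      (Real.exp 2 * P.alpha ≤ P.kappa →
        (out.evals.length : ℝ) ≤ n * Real.log (P.kappa / P.alpha) / P.alpha)) ∧
    ENNReal.ofReal (1 - P.delta) ≤
      μ {ω | ∃ out, LinTG P rule F (fun t x => x ⬝ᵥ wt + ξ t ω) = some out ∧
        out.S.card ≤ P.kappa ∧
        (1 - 1 / Real.exp 1 - P.alpha) * linObjective F wt OPT - 2 * P.eps ≤
          linObjective F wt out.S ∧
        (P.lam ≤ 2 * P.R ^ 2 / P.S ^ 2 * Real.log (2 / P.delta) →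
          ∀ e ∈ out.evals, (e.samples : ℝ) ≤ e.sampleBound P rule F wt L)} := by
  have hκ' : (0 : ℝ) < P.kappa := by exact_mod_cast hkappa
  have hκ1 : (1 : ℝ) ≤ P.kappa := by exact_mod_cast hkappa
  have hn1 : (1 : ℝ) ≤ n := by exact_mod_cast hn
  have heps' : 0 < P.eps' := div_pos heps hκ'
  have hN : 0 < P.N0 n := by
    refine Nat.ceil_pos.2 (mul_pos (by positivity) (Real.log_pos ?_))
    rw [lt_div_iff₀ hdelta0]
    linarith
  have hF : ∀ a : Fin n, F {a} ⬝ᵥ F {a} ≤ L ^ 2 := fun a => by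
    rw [dotProduct_self_eq_norm_sq]
    exact pow_le_pow_left₀ (norm_nonneg _) (hL a) 2
  have hg : ∀ S a, gainVec F S a ⬝ᵥ gainVec F S a ≤ L ^ 2 :=
    fun S a => (gainVec_dotProduct_self_le hmono hsub hempty S a).trans (hF a)
  refine ⟨fun ω => ?_, ?_⟩
  · have hterm : ∀ K : ℕ, (1 - P.alpha) ^ K ≤ P.alpha / P.kappa →
        ∃ out, LinTG P rule F (fun t x => x ⬝ᵥ wt + ξ t ω) = some out ∧
          out.evals.length ≤ n * K := by
      intro K hK
      -- Multiplying `hK` by `g` needs `g > 0`; for `g ≤ 0` the loop never starts and `K = 0`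
      -- serves.
      rcases le_or_gt (gmax P F fun t x => x ⬝ᵥ wt + ξ t ω) 0 with hg0 | hg0
      · obtain ⟨out, h1, h2⟩ := linTG_terminates (rule := rule)
          (reward := fun t x => x ⬝ᵥ wt + ξ t ω) hlam hd hdelta0 hdelta1 heps' hN hF hg 0
          (by
            rw [pow_zero, one_mul, finalThreshold, le_div_iff₀ hκ']
            nlinarith)
        exact ⟨out, h1, h2.trans (by simp)⟩
      · refine linTG_terminates hlam hd hdelta0 hdelta1 heps' hN hF hg K ?_
        refine (mul_le_mul_of_nonneg_right hK hg0.le).trans (le_of_eq ?_)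
        rw [finalThreshold]
        ring
    obtain ⟨out, h1, h2⟩ := hterm _ (one_sub_pow_ceil_le halpha0 halpha1 hκ')
    refine ⟨out, h1, by exact_mod_cast h2, fun he => ?_⟩
    obtain ⟨out', h3, h4⟩ := hterm _ (one_sub_pow_floor_le halpha0 halpha1 hκ' he)
    obtain rfl : out = out' := Option.some.inj (h1.symm.trans h3)
    have h5 : (out.evals.length : ℝ) ≤ n * (⌊Real.log (P.kappa / P.alpha) / P.alpha⌋₊ : ℝ) := by
      exact_mod_cast h4
    refine h5.trans ?_
    rw [mul_div_assoc]
    refine mul_le_mul_of_nonneg_left (Nat.floor_le ?_) (by positivity)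
    refine div_nonneg (Real.log_nonneg ?_) halpha0.le
    rw [le_div_iff₀ halpha0]
    linarith
  · set φ : ℕ → Ω → Fin d → ℝ :=
      fun t ω => runFeature P rule F (fun s x => x ⬝ᵥ wt + ξ s ω) t with hφ
    set bad : Set Ω := {ω | ∃ t, 2 * P.R ^ 2 *
        Real.log (√((gramMatrix P.lam φ t ω).det / P.lam ^ d) / (P.delta / 2)) ≤
        noiseSum ξ φ t ω ⬝ᵥ ((gramMatrix P.lam φ t ω)⁻¹ *ᵥ noiseSum ξ φ t ω)} ∪
      {ω | ∃ a, P.eps' < |fhat P F (fun t x => x ⬝ᵥ wt + ξ t ω) a - linObjective F wt {a}|}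
      with hbad
    -- The two failure probabilities add up to `δ/2 + δ/3 ≤ δ`.
    have hμbad : μ bad ≤ ENNReal.ofReal P.delta := by
      refine (measure_union_le _ _).trans ((add_le_add
        (measure_exists_selfNormalized_le hlam hR hξmeas hξindep hξsub
          (fun t => measurable_runFeature hN rule t) (by positivity))
        (measure_exists_fhat_error_le hn heps' hdelta0 hR hN F wt hξindep hξsub)).trans ?_)
      rw [← ENNReal.ofReal_add (by positivity) (by positivity)]
      exact ENNReal.ofReal_le_ofReal (by linarith)
    set good : Set Ω := {ω | ∃ out, LinTG P rule F (fun t x => x ⬝ᵥ wt + ξ t ω) = some out ∧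
        out.S.card ≤ P.kappa ∧
        (1 - 1 / Real.exp 1 - P.alpha) * linObjective F wt OPT - 2 * P.eps ≤
          linObjective F wt out.S ∧
        (P.lam ≤ 2 * P.R ^ 2 / P.S ^ 2 * Real.log (2 / P.delta) →
          ∀ e ∈ out.evals, (e.samples : ℝ) ≤ e.sampleBound P rule F wt L)} with hgood
    -- Covering and subadditivity of the outer measure suffice, so measurability of the good event
    -- is not needed.
    have hcover : Set.univ ⊆ good ∪ bad := by
      intro ω _
      by_cases hω : ω ∈ bad
      · exact Or.inr hω
      · left
        have h1 : ∀ t, noiseSum ξ φ t ω ⬝ᵥ ((gramMatrix P.lam φ t ω)⁻¹ *ᵥ noiseSum ξ φ t ω) ≤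
            2 * P.R ^ 2 * Real.log (√((gramMatrix P.lam φ t ω).det / P.lam ^ d) / (P.delta / 2)) := by
          intro t
          by_contra h
          exact hω (Or.inl ⟨t, (not_le.1 h).le⟩)
        have h2 : ∀ a, |fhat P F (fun t x => x ⬝ᵥ wt + ξ t ω) a - linObjective F wt {a}| ≤ P.eps' := by
          intro a
          by_contra h
          exact hω (Or.inr ⟨a, not_le.1 h⟩)
        obtain ⟨out, h3, h4, h5, h6⟩ := linTG_correct (L := L) hn hlam hd hdelta0 hdelta1 hR hS heps' hN
          halpha0 halpha1 hkappa halpha2 hF hg (linObjective_submodular hsub hwt)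
          (linObjective_monotone hmono hwt) (linObjective_nonneg hmono hempty hwt) hOPT
          (fun T hT => hOPTmax hT)
          (fun st hst => abs_dotProduct_what_sub_le hlam hdelta0 hR hwtS h1 hst) h2
        refine ⟨out, h3, h4, ?_, h6⟩
        rwa [LinTGParams.eps', mul_div_cancel₀ _ hκ'.ne'] at h5
    have h1 : 1 ≤ μ good + ENNReal.ofReal P.delta := by
      rw [← measure_univ (μ := μ)]
      exact (measure_mono hcover).trans ((measure_union_le _ _).trans (add_le_add le_rfl hμbad))
    rw [ENNReal.ofReal_sub _ hdelta0.le, ENNReal.ofReal_one]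
    exact tsub_le_iff_right.2 h1

end Main
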